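/- Let $\mathbb K=\mathbb R$ or $\mathbb C$. A Lie quasi-bialgebra is a quadruple $\mathcal G=(\mathfrak g,[\,,\,],\varpi,\varphi)$, where $(\mathfrak g,[\,,\,])$ is a finite-dimensional Lie algebra over $\mathbb K$, $\varpi$ is a Lie algebra 1-cocycle on $\mathfrak g$ with values in the skew-symmetric maps $\mathfrak g^*\to\mathfrak g$, and $\varphi\in\wedge^3\mathfrak g$, such that the canonical double $\mathfrak d=\mathfrak g\oplus\mathfrak g^*$ with the skew-symmetric bracket $[x,y]_{\mathfrak d}=[x,y]$, $[x,\xi]_{\mathfrak d}=\varpi_x\xi-\mathrm{ad}_x^*\xi$, $[\xi,\eta]_{\mathfrak d}=\langle\eta,\varpi_\bullet\xi\rangle+\langle\xi\otimes\eta\otimes1,\varphi\rangle$ is a Lie algebra. Here $\mathrm{ad}^*_x$ denotes the transpose of $\mathrm{ad}_x$. Let $\mathfrak g=\mathfrak l\oplus\mathfrak m$ with $\mathfrak l$ a subalgebra and $[\mathfrak l,\mathfrak m]\subset\mathfrak m$, and assume that $\mathcal G$ is canonically compatible with this decomposition: $\varpi_z=0$ for $z\in\mathfrak l$, $\langle\mathfrak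 m^\perp,\varpi_\bullet\mathfrak m^\perp\rangle=0$, and $\varphi\in\mathrm{Alt}(\mathfrak l\otimes\mathfrak l\otimes\mathfrak l\oplus\mathfrak l\otimes\mathfrak m\otimes\mathfrak m)$. Let $i:\mathfrak l\to\mathfrak g$ be the inclusion, $p_{\mathfrak l}:\mathfrak g\to\mathfrak l$ the projection along $\mathfrak m$, and $s=p_{\mathfrak l}^*:\mathfrak l^*\to\mathfrak g^*$. Let $p_{\mathfrak g},p_{\mathfrak g^*}$ be the projections of $\mathfrak d$, let $i_{\mathfrak g}:\mathfrak g\to\mathfrak d$ be the inclusion, and on $\mathfrak d$ write $\mathrm{ad}=\mathrm{ad}^{\mathfrak d}$ and $\mathrm{Ad}_{e^{X}}=\exp(\mathrm{ad}_X)$. Let $\mathrm{ad}^{\mathfrak l\oplus\mathfrak l^*}$ be the adjoint action in the double of the Lie quasi-bialgebra $(\mathfrak l,[\,,\,],0,p_{\mathfrak l}^{(3)}\varphi)$. Spectra are taken in $\mathbb C$. Put $$U=\{p\in\mathfrak l^*:\ \mathrm{Spec}(\mathrm{ad}^{\mathfrak l\oplus\mathfrak l^*}_p)\cap i\pi\mathbb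 Z^*=\emptyset,\ 0\notin\mathrm{Spec}(p_{\mathfrak g}\mathrm{Ad}_{e^{-sp}}i_{\mathfrak g})\},$$ $$\ell_p(s\alpha+\xi)=F(\mathrm{ad}_p^{\mathfrak l\oplus\mathfrak l^*})\alpha-(p_{\mathfrak g}\mathrm{Ad}_{e^{-sp}}i_{\mathfrak g})^{-1}p_{\mathfrak g}\mathrm{Ad}_{e^{-sp}}\xi\qquad(p\in U,\ \alpha\in\mathfrak l^*,\ \xi\in\mathfrak l^\perp),\qquad F(z)=\coth z-\tfrac1z .$$ Let $N(U)=U\times\mathfrak l\times\mathfrak g^*$ be the vector bundle over $U$ with anchor $a_p(z,\xi)=i^*\xi-\mathrm{ad}_z^*p$ and with the bracket of sections (everything evaluated at $p$) $$[(z,\xi),(z',\xi')]_p=\big(d_pz'(a_p(z,\xi))-d_pz(a_p(z',\xi'))-[z,z']+\langle\xi,d_p\ell(\cdot)\xi'\rangle,$$ $$\qquad d_p\xi'(a_p(z,\xi))-d_p\xi(a_p(z',\xi'))+\mathrm{ad}_z^*\xi'-\mathrm{ad}_{z'}^*\xi+\langle\xi,\varpi_\bullet\xi'\rangle+\mathrm{ad}^*_{\ell_p\xi}\xi'-\mathrm{ad}^*_{\ell_p\xi'}\xi\big).$$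 Let $\mathfrak g_0^\star=\mathfrak l\oplus\mathfrak l^\perp\subset\mathfrak d$ with the bracket of $\mathfrak d$, and let $TU\times\mathfrak g_0^\star=U\times\mathfrak l^*\times\mathfrak g_0^\star$ be the trivial Lie algebroid over $U$ with vertex algebra $\mathfrak g_0^\star$: its anchor is the projection to $TU=U\times\mathfrak l^*$ and its bracket is $[(X,x),(X',x')]=([X,X'],X\cdot x'-X'\cdot x+[x,x'])$. **Theorem.** For $p\in U$, $\alpha\in\mathfrak l^*$, $z\in\mathfrak l$ and $\xi\in\mathfrak l^\perp$, the formula $$T_p(\alpha,z+\xi)=\Big(\tfrac{\sinh\mathrm{ad}_{sp}-\mathrm{ad}_{sp}}{\mathrm{ad}_{sp}^2}s\alpha-\tfrac{\sinh\mathrm{ad}_{sp}}{\mathrm{ad}_{sp}}z,\ \tfrac{\sinh\mathrm{ad}_{sp}}{\mathrm{ad}_{sp}}s\alpha-\sinh(\mathrm{ad}_{sp})z-p_{\mathfrak g^*}\mathrm{Ad}_{e^{sp}}\xi\Big)$$ defines an element of $\mathfrak l\times\mathfrak g^*$. The set $U$ is open, $TU\times\mathfrak g_0^\star$ and $N(U)$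 are Lie algebroids over $U$, and the bundle map $T:U\times\mathfrak l^*\times\mathfrak g_0^\star\to N(U)$ is an isomorphism of Lie algebroids over the identity of $U$: it is smooth with smooth inverse and intertwines the anchors and the brackets of smooth sections over every open subset of $U$ (smooth means $C^\infty$ if $\mathbb K=\mathbb R$ and holomorphic if $\mathbb K=\mathbb C$). -/

import Mathlib

open scoped ContDiff

set_option maxSynthPendingDepth 3

noncomputable section

/-! ### Lie algebroids on trivial vector bundles -/

/-- Anchor and bracket on the trivial vector bundle with fibre `E` over (an open part of) a vector
space `B`. Sections are functions `B → E`, tangent vectors of the base are elements of `B`. -/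
structure AlgebroidData (𝕜 B E : Type*) [RCLike 𝕜] [NormedAddCommGroup B] [NormedSpace 𝕜 B]
    [NormedAddCommGroup E] [NormedSpace 𝕜 E] where
  anchor : B → E →L[𝕜] B
  bracket : (B → E) → (B → E) → B → E

section Algebroids

variable {𝕜 B E E' : Type*} [RCLike 𝕜] [NormedAddCommGroup B] [NormedSpace 𝕜 B]
  [NormedAddCommGroup E] [NormedSpace 𝕜 E] [NormedAddCommGroup E'] [NormedSpace 𝕜 E']

/-- `A` is a Lie algebroid over the open set `U`. The laws are imposed on smooth sections over
every open subset `W` of `U` (smooth means `C^∞` for `𝕜 = ℝ` and holomorphic for `𝕜 = ℂ`). -/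
structure IsLieAlgebroid (U : Set B) (A : AlgebroidData 𝕜 B E) : Prop where
  isOpen : IsOpen U
  smooth_anchor : ContDiffOn 𝕜 ∞ A.anchor U
  smooth_bracket : ∀ W ⊆ U, IsOpen W → ∀ σ τ : B → E, ContDiffOn 𝕜 ∞ σ W → ContDiffOn 𝕜 ∞ τ W →
    ContDiffOn 𝕜 ∞ (A.bracket σ τ) W
  bracket_congr : ∀ W ⊆ U, IsOpen W → ∀ σ σ' τ : B → E, ContDiffOn 𝕜 ∞ σ W →
    ContDiffOn 𝕜 ∞ τ W → Set.EqOn σ σ' W → Set.EqOn (A.bracket σ τ) (A.bracket σ' τ) W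
  bracket_add : ∀ W ⊆ U, IsOpen W → ∀ σ τ τ' : B → E, ContDiffOn 𝕜 ∞ σ W →
    ContDiffOn 𝕜 ∞ τ W → ContDiffOn 𝕜 ∞ τ' W →
    Set.EqOn (A.bracket σ (τ + τ')) (A.bracket σ τ + A.bracket σ τ') W
  bracket_self : ∀ W ⊆ U, IsOpen W → ∀ σ : B → E, ContDiffOn 𝕜 ∞ σ W →
    Set.EqOn (A.bracket σ σ) 0 W
  bracket_skew : ∀ W ⊆ U, IsOpen W → ∀ σ τ : B → E, ContDiffOn 𝕜 ∞ σ W → ContDiffOn 𝕜 ∞ τ W →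
    Set.EqOn (A.bracket σ τ) (-A.bracket τ σ) W
  jacobi : ∀ W ⊆ U, IsOpen W → ∀ σ τ υ : B → E, ContDiffOn 𝕜 ∞ σ W → ContDiffOn 𝕜 ∞ τ W →
    ContDiffOn 𝕜 ∞ υ W → Set.EqOn (A.bracket σ (A.bracket τ υ))
      (A.bracket (A.bracket σ τ) υ + A.bracket τ (A.bracket σ υ)) W
  leibniz : ∀ W ⊆ U, IsOpen W → ∀ (f : B → 𝕜) (σ τ : B → E), ContDiffOn 𝕜 ∞ f W →
    ContDiffOn 𝕜 ∞ σ W → ContDiffOn 𝕜 ∞ τ W → ∀ p ∈ W,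
    A.bracket σ (fun q => f q • τ q) p
      = f p • A.bracket σ τ p + fderiv 𝕜 f p (A.anchor p (σ p)) • τ p
  anchor_bracket : ∀ W ⊆ U, IsOpen W → ∀ σ τ : B → E, ContDiffOn 𝕜 ∞ σ W →
    ContDiffOn 𝕜 ∞ τ W → ∀ p ∈ W,
    A.anchor p (A.bracket σ τ p)
      = VectorField.lieBracket 𝕜 (fun q => A.anchor q (σ q)) (fun q => A.anchor q (τ q)) p

/-- The bundle map `T` (over the identity of `U`) is an isomorphism of Lie algebroids: it is smooth
with a smooth inverse, and it intertwines anchors and brackets. -/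
structure IsLieAlgebroidIso (U : Set B) (A : AlgebroidData 𝕜 B E) (A' : AlgebroidData 𝕜 B E')
    (T : B → E →L[𝕜] E') : Prop where
  smooth : ContDiffOn 𝕜 ∞ T U
  exists_inverse : ∃ S : B → E' →L[𝕜] E, ContDiffOn 𝕜 ∞ S U ∧
    ∀ p ∈ U, (∀ e, S p (T p e) = e) ∧ ∀ e', T p (S p e') = e'
  anchor_comp : ∀ p ∈ U, ∀ e, A'.anchor p (T p e) = A.anchor p e
  map_bracket : ∀ W ⊆ U, IsOpen W → ∀ σ τ : B → E, ContDiffOn 𝕜 ∞ σ W → ContDiffOn 𝕜 ∞ τ W →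
    ∀ p ∈ W, T p (A.bracket σ τ p) = A'.bracket (fun q => T q (σ q)) (fun q => T q (τ q)) p

/-- The trivial Lie algebroid `T B × E` whose vertex Lie algebra is `E` with the bracket `br`. -/
def trivialAlgebroid (𝕜 : Type*) {B E : Type*} [RCLike 𝕜] [NormedAddCommGroup B] [NormedSpace 𝕜 B]
    [NormedAddCommGroup E] [NormedSpace 𝕜 E] (br : E → E → E) : AlgebroidData 𝕜 B (B × E) where
  anchor _ := ContinuousLinearMap.fst 𝕜 B E
  bracket σ τ p :=
    (VectorField.lieBracket 𝕜 (fun q => (σ q).1) (fun q => (τ q).1) p,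
      fderiv 𝕜 (fun q => (τ q).2) p (σ p).1 - fderiv 𝕜 (fun q => (σ q).2) p (τ p).1
        + br (σ p).2 (τ p).2)

end Algebroids

/-! ### Functions of endomorphisms -/

section Functions

variable {𝕜 E : Type*} [RCLike 𝕜] [NormedAddCommGroup E] [NormedSpace 𝕜 E]

/-- `f(A) = ∑ cₙ Aⁿ` for the entire function `f(z) = ∑ cₙ zⁿ`. -/
def entireCalc (c : ℕ → 𝕜) (A : E →L[𝕜] E) : E →L[𝕜] E := ∑' n, c n • A ^ n

/-- `sinh A`. -/
def opSinh (A : E →L[𝕜] E) : E →L[𝕜] E :=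
  entireCalc (fun n => if Odd n then ((n.factorial : 𝕜))⁻¹ else 0) A

/-- `(sinh A) / A`, that is `∑ A^(2k) / (2k+1)!`. -/
def opSinhDiv (A : E →L[𝕜] E) : E →L[𝕜] E :=
  entireCalc (fun n => if Even n then (((n + 1).factorial : 𝕜))⁻¹ else 0) A

/-- `(sinh A - A) / A²`, that is `∑ A^(2k+1) / (2k+3)!`. -/
def opSinhSub (A : E →L[𝕜] E) : E →L[𝕜] E :=
  entireCalc (fun n => if Odd n then (((n + 2).factorial : 𝕜))⁻¹ else 0) A

/-- `F(A)` for the meromorphic function `F(z) = coth z - 1/z`, written as the quotient of the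
entire functions `(z cosh z - sinh z)/z² = ∑ (1/(2k+2)! - 1/(2k+3)!) z^(2k+1)` and `(sinh z)/z`.
The denominator is invertible exactly when no eigenvalue of `A` is a pole `iπn`, `n ≠ 0`, of `F`. -/
def opCothSubInv (A : E →L[𝕜] E) : E →L[𝕜] E :=
  Ring.inverse (opSinhDiv A) *
    entireCalc (fun n => if Odd n then
      (((n + 1).factorial : 𝕜))⁻¹ - (((n + 2).factorial : 𝕜))⁻¹ else 0) A

/-- The embedding of `𝕜 = ℝ` or `ℂ` into `ℂ`. -/
def toComplexHom (𝕜 : Type*) [RCLike 𝕜] : 𝕜 →+* ℂ where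
  toFun z := ⟨RCLike.re z, RCLike.im z⟩
  map_one' := by apply Complex.ext <;> simp
  map_mul' x y := by apply Complex.ext <;> simp
  map_zero' := by apply Complex.ext <;> simp
  map_add' x y := by apply Complex.ext <;> simp

/-- The spectrum in `ℂ` of an endomorphism of a finite-dimensional real or complex vector space:
the complex roots of its characteristic polynomial. -/
def complexSpectrum [FiniteDimensional 𝕜 E] (A : E →L[𝕜] E) : Set ℂ :=
  {μ | (LinearMap.charpoly (A : E →ₗ[𝕜] E)).eval₂ (toComplexHom 𝕜) μ = 0}

end Functions

/-! ### Finite-dimensional duality -/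

section Duality

variable {𝕜 E : Type*} [RCLike 𝕜] [NormedAddCommGroup E] [NormedSpace 𝕜 E]
  [FiniteDimensional 𝕜 E]

theorem finrank_strongDual (𝕜 E : Type*) [RCLike 𝕜] [NormedAddCommGroup E] [NormedSpace 𝕜 E]
    [FiniteDimensional 𝕜 E] : Module.finrank 𝕜 (StrongDual 𝕜 E) = Module.finrank 𝕜 E := by
  rw [← (LinearMap.toContinuousLinearMap (𝕜 := 𝕜) (E := E) (F' := 𝕜)).finrank_eq]
  exact Subspace.dual_finrank_eq

/-- The canonical isomorphism `E ≃ E**`. -/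
def bidualEquiv (𝕜 E : Type*) [RCLike 𝕜] [NormedAddCommGroup E] [NormedSpace 𝕜 E]
    [FiniteDimensional 𝕜 E] : E ≃ₗ[𝕜] StrongDual 𝕜 (StrongDual 𝕜 E) :=
  LinearEquiv.ofInjectiveOfFinrankEq (K := 𝕜) (V := E)
    (V' := StrongDual 𝕜 (StrongDual 𝕜 E))
    (NormedSpace.inclusionInDoubleDual 𝕜 E : E →ₗ[𝕜] StrongDual 𝕜 (StrongDual 𝕜 E))
    (NormedSpace.inclusionInDoubleDualLi (E := E) 𝕜).injective
    (by rw [finrank_strongDual 𝕜 (StrongDual 𝕜 E), finrank_strongDual 𝕜 E])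

/-- The vector `v` of `E` with `⟨ξ, v⟩ = f ξ` for all `ξ` in `E*`. -/
def ofBidual (f : StrongDual 𝕜 (StrongDual 𝕜 E)) : E := (bidualEquiv 𝕜 E).symm f

theorem apply_ofBidual (f : StrongDual 𝕜 (StrongDual 𝕜 E)) (ξ : StrongDual 𝕜 E) :
    ξ (ofBidual f) = f ξ := by
  have h : bidualEquiv 𝕜 E (ofBidual f) = f := (bidualEquiv 𝕜 E).apply_symm_apply f
  calc ξ (ofBidual f) = bidualEquiv 𝕜 E (ofBidual f) ξ := rfl
    _ = f ξ := by rw [h]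

end Duality

/-! ### Lie quasi-bialgebras -/

/-- A quadruple `(𝔤, [,], ϖ, φ)` without its laws. The element `φ` of `∧³𝔤` is given as the
alternating trilinear form `(ξ, η, ζ) ↦ ⟨ξ ⊗ η ⊗ ζ, φ⟩` on `𝔤*`. -/
structure QuasiBialgebraData (𝕜 V : Type*) [RCLike 𝕜] [NormedAddCommGroup V] [NormedSpace 𝕜 V]
    where
  lie : V →ₗ[𝕜] V →ₗ[𝕜] V
  cocycle : V →ₗ[𝕜] StrongDual 𝕜 V →ₗ[𝕜] V
  assoc : (StrongDual 𝕜 V) [⋀^Fin 3]→ₗ[𝕜] 𝕜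

namespace QuasiBialgebraData

variable {𝕜 V : Type*} [RCLike 𝕜] [NormedAddCommGroup V] [NormedSpace 𝕜 V]
  [FiniteDimensional 𝕜 V] (G : QuasiBialgebraData 𝕜 V)

/-- `ad*_x ξ`, the transpose of `ad_x` applied to `ξ`: `⟨ad*_x ξ, y⟩ = ⟨ξ, [x, y]⟩`. -/
def adStar (x : V) (ξ : StrongDual 𝕜 V) : StrongDual 𝕜 V :=
  LinearMap.toContinuousLinearMap ((ξ : V →ₗ[𝕜] 𝕜) ∘ₗ G.lie x)

/-- `⟨η, ϖ_• ξ⟩`, the linear form `x ↦ ⟨η, ϖ_x ξ⟩`. -/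
def cocyclePair (η ξ : StrongDual 𝕜 V) : StrongDual 𝕜 V :=
  LinearMap.toContinuousLinearMap ((η : V →ₗ[𝕜] 𝕜) ∘ₗ G.cocycle.flip ξ)

/-- The linear form `ζ ↦ ⟨ξ ⊗ η ⊗ ζ, φ⟩` on `𝔤*`. -/
def assocForm (ξ η : StrongDual 𝕜 V) : StrongDual 𝕜 (StrongDual 𝕜 V) :=
  LinearMap.toContinuousLinearMap
    { toFun := fun ζ => G.assoc ![ξ, η, ζ]
      map_add' := fun ζ ζ' => by
        have h := G.assoc.map_update_add ![ξ, η, 0] 2 ζ ζ'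
        have e : ∀ t, Function.update ![ξ, η, 0] 2 t = ![ξ, η, t] := fun t => by
          funext i; fin_cases i <;> rfl
        simpa only [e] using h
      map_smul' := fun c ζ => by
        have h := G.assoc.map_update_smul ![ξ, η, 0] 2 c ζ
        have e : ∀ t, Function.update ![ξ, η, 0] 2 t = ![ξ, η, t] := fun t => by
          funext i; fin_cases i <;> rfl
        simpa only [e, RingHom.id_apply] using h }

/-- `⟨ξ ⊗ η ⊗ 1, φ⟩` in `𝔤`. -/
def assocContract (ξ η : StrongDual 𝕜 V) : V := ofBidual (G.assocForm ξ η)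

/-- The bracket of the canonical double `𝔡 = 𝔤 ⊕ 𝔤*`, the skew-symmetric extension of
`[x, y]_𝔡 = [x, y]`, `[x, ξ]_𝔡 = ϖ_x ξ - ad*_x ξ`,
`[ξ, η]_𝔡 = ⟨η, ϖ_• ξ⟩ + ⟨ξ ⊗ η ⊗ 1, φ⟩`. -/
def dlie (X Y : V × StrongDual 𝕜 V) : V × StrongDual 𝕜 V :=
  (G.lie X.1 Y.1 + G.cocycle X.1 Y.2 - G.cocycle Y.1 X.2 + G.assocContract X.2 Y.2,
    -G.adStar X.1 Y.2 + G.adStar Y.1 X.2 + G.cocyclePair Y.2 X.2)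

/-- `ad_X` on the canonical double. -/
def dad (X : V × StrongDual 𝕜 V) : (V × StrongDual 𝕜 V) →L[𝕜] (V × StrongDual 𝕜 V) :=
  LinearMap.toContinuousLinearMap
    { toFun := G.dlie X
      map_add' := fun Y Y' => by
        have h1 : G.assocContract X.2 (Y.2 + Y'.2)
            = G.assocContract X.2 Y.2 + G.assocContract X.2 Y'.2 := by
          have h : G.assocForm X.2 (Y.2 + Y'.2)
              = G.assocForm X.2 Y.2 + G.assocForm X.2 Y'.2 := by
            ext ζ
            have h := G.assoc.map_update_add ![X.2, 0, ζ] 1 Y.2 Y'.2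
            have e : ∀ t, Function.update ![X.2, 0, ζ] 1 t = ![X.2, t, ζ] := fun t => by
              funext i; fin_cases i <;> rfl
            simp only [e] at h
            exact h
          simp [assocContract, ofBidual, h]
        have h2 : G.adStar X.1 (Y.2 + Y'.2) = G.adStar X.1 Y.2 + G.adStar X.1 Y'.2 := by
          ext v; simp [adStar]
        have h3 : G.adStar (Y.1 + Y'.1) X.2 = G.adStar Y.1 X.2 + G.adStar Y'.1 X.2 := by
          ext v; simp [adStar]
        have h4 : G.cocyclePair (Y.2 + Y'.2) X.2
            = G.cocyclePair Y.2 X.2 + G.cocyclePair Y'.2 X.2 := by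
          ext v; simp [cocyclePair]
        ext1 <;> simp only [dlie, Prod.fst_add, Prod.snd_add, map_add, LinearMap.add_apply, h1, h2,
          h3, h4] <;> abel
      map_smul' := fun c Y => by
        have h1 : G.assocContract X.2 (c • Y.2) = c • G.assocContract X.2 Y.2 := by
          have h : G.assocForm X.2 (c • Y.2) = c • G.assocForm X.2 Y.2 := by
            ext ζ
            have h := G.assoc.map_update_smul ![X.2, 0, ζ] 1 c Y.2
            have e : ∀ t, Function.update ![X.2, 0, ζ] 1 t = ![X.2, t, ζ] := fun t => by
              funext i; fin_cases i <;> rfl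
            simp only [e] at h
            exact h
          simp [assocContract, ofBidual, h]
        have h2 : G.adStar X.1 (c • Y.2) = c • G.adStar X.1 Y.2 := by
          ext v; simp [adStar]
        have h3 : G.adStar (c • Y.1) X.2 = c • G.adStar Y.1 X.2 := by
          ext v; simp [adStar]
        have h4 : G.cocyclePair (c • Y.2) X.2 = c • G.cocyclePair Y.2 X.2 := by
          ext v; simp [cocyclePair]
        ext1 <;> simp only [dlie, Prod.smul_fst, Prod.smul_snd, map_smul, LinearMap.smul_apply, h1,
          h2, h3, h4, RingHom.id_apply, smul_add, smul_sub, smul_neg] }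

/-- `Ad_{e^X} = exp(ad_X)` on the canonical double. -/
def dAdExp (X : V × StrongDual 𝕜 V) : (V × StrongDual 𝕜 V) →L[𝕜] (V × StrongDual 𝕜 V) :=
  NormedSpace.exp (G.dad X)

end QuasiBialgebraData

/-- A Lie quasi-bialgebra `(𝔤, [,], ϖ, φ)`: `(𝔤, [,])` is a Lie algebra, `ϖ` is a 1-cocycle with
values in the skew-symmetric maps `𝔤* → 𝔤`, and the double is a Lie algebra. -/
structure LieQuasiBialgebra (𝕜 V : Type*) [RCLike 𝕜] [NormedAddCommGroup V] [NormedSpace 𝕜 V]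
    [FiniteDimensional 𝕜 V] extends QuasiBialgebraData 𝕜 V where
  lie_self : ∀ x, lie x x = 0
  lie_jacobi : ∀ x y z, lie x (lie y z) = lie (lie x y) z + lie y (lie x z)
  cocycle_skew : ∀ (x : V) (ξ η : StrongDual 𝕜 V), ξ (cocycle x η) = -η (cocycle x ξ)
  cocycle_lie : ∀ x y ξ, cocycle (lie x y) ξ
    = lie x (cocycle y ξ) + cocycle y (toQuasiBialgebraData.adStar x ξ)
      - lie y (cocycle x ξ) - cocycle x (toQuasiBialgebraData.adStar y ξ)
  dlie_self : ∀ X, toQuasiBialgebraData.dlie X X = 0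
  dlie_jacobi : ∀ X Y Z, toQuasiBialgebraData.dlie X (toQuasiBialgebraData.dlie Y Z)
    = toQuasiBialgebraData.dlie (toQuasiBialgebraData.dlie X Y) Z
      + toQuasiBialgebraData.dlie Y (toQuasiBialgebraData.dlie X Z)

/-- A reductive decomposition `𝔤 = 𝔩 ⊕ 𝔪`: `𝔩` is a subalgebra and `[𝔩, 𝔪] ⊆ 𝔪`. -/
structure ReductiveDecomposition {𝕜 V : Type*} [RCLike 𝕜] [NormedAddCommGroup V]
    [NormedSpace 𝕜 V] (G : QuasiBialgebraData 𝕜 V) where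
  l : Submodule 𝕜 V
  m : Submodule 𝕜 V
  isCompl : IsCompl l m
  lie_mem_l : ∀ z ∈ l, ∀ w ∈ l, G.lie z w ∈ l
  lie_mem_m : ∀ z ∈ l, ∀ u ∈ m, G.lie z u ∈ m

namespace ReductiveDecomposition

variable {𝕜 V : Type*} [RCLike 𝕜] [NormedAddCommGroup V] [NormedSpace 𝕜 V]
  [FiniteDimensional 𝕜 V] {G : QuasiBialgebraData 𝕜 V} (R : ReductiveDecomposition G)

/-- The annihilator `S^⊥` in `𝔤*` of a subspace `S` of `𝔤`. -/
def perp (S : Submodule 𝕜 V) : Submodule 𝕜 (StrongDual 𝕜 V) where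
  carrier := {ξ | ∀ v ∈ S, ξ v = 0}
  add_mem' {a b} ha hb v hv := by simp [ha v hv, hb v hv]
  zero_mem' v _ := by simp
  smul_mem' c a ha v hv := by simp [ha v hv]

/-- `G` is canonically compatible with `𝔤 = 𝔩 ⊕ 𝔪`: `ϖ_𝔩 = 0`, `⟨𝔪^⊥, ϖ_• 𝔪^⊥⟩ = 0`,
`φ ∈ Alt(𝔩⊗𝔩⊗𝔩 ⊕ 𝔩⊗𝔪⊗𝔪 ⊕ 𝔪⊗𝔪⊗𝔪)` (no component in `∧²𝔩 ⊗ 𝔪`) and `φ ≡ 0 mod 𝔩` (no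
component in `∧³𝔪`). Components are read off by pairing with `𝔩* = 𝔪^⊥` and `𝔪* = 𝔩^⊥`. -/
structure CanonicallyCompatible : Prop where
  cocycle_l : ∀ z ∈ R.l, G.cocycle z = 0
  cocycle_perp : ∀ x, ∀ ξ ∈ perp R.m, ∀ η ∈ perp R.m, ξ (G.cocycle x η) = 0
  assoc_llm : ∀ ξ ∈ perp R.m, ∀ η ∈ perp R.m, ∀ ζ ∈ perp R.l, G.assoc ![ξ, η, ζ] = 0
  assoc_mmm : ∀ ξ ∈ perp R.l, ∀ η ∈ perp R.l, ∀ ζ ∈ perp R.l, G.assoc ![ξ, η, ζ] = 0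

/-- The projection `p_𝔩 : 𝔤 → 𝔩` along `𝔪`. -/
def pl : V →L[𝕜] R.l :=
  LinearMap.toContinuousLinearMap (R.l.projectionOnto R.m R.isCompl)

/-- `s = p_𝔩* : 𝔩* → 𝔤*`. -/
def s : StrongDual 𝕜 R.l →L[𝕜] StrongDual 𝕜 V :=
  LinearMap.toContinuousLinearMap
    { toFun := fun α => α.comp R.pl
      map_add' := fun α β => by ext v; simp
      map_smul' := fun c α => by ext v; simp }

/-- `i* : 𝔤* → 𝔩*`, the restriction of linear forms to `𝔩`. -/
def iStar : StrongDual 𝕜 V →L[𝕜] StrongDual 𝕜 R.l :=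
  LinearMap.toContinuousLinearMap
    { toFun := fun ξ => ξ.comp R.l.subtypeL
      map_add' := fun α β => by ext v; simp
      map_smul' := fun c α => by ext v; simp }

/-- The bracket of the subalgebra `𝔩`. -/
def lieL : R.l →ₗ[𝕜] R.l →ₗ[𝕜] R.l :=
  LinearMap.mk₂ 𝕜 (fun z w => ⟨G.lie z w, R.lie_mem_l z z.2 w w.2⟩)
    (fun a b c => by ext; simp) (fun a b c => by ext; simp)
    (fun a b c => by ext; simp) (fun a b c => by ext; simp)

/-- The cocommutative quadruple `(𝔩, [,]_𝔩, 0, p_𝔩^{(3)} φ)`. -/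
def subData : QuasiBialgebraData 𝕜 R.l where
  lie := R.lieL
  cocycle := 0
  assoc := G.assoc.compLinearMap (R.s : StrongDual 𝕜 R.l →ₗ[𝕜] StrongDual 𝕜 V)

/-- `ad_p` on the double `𝔩 ⊕ 𝔩*` of `(𝔩, [,]_𝔩, 0, p_𝔩^{(3)} φ)`, for `p` in `𝔩*`. -/
def adL (p : StrongDual 𝕜 R.l) :
    (R.l × StrongDual 𝕜 R.l) →L[𝕜] (R.l × StrongDual 𝕜 R.l) :=
  R.subData.dad (0, p)

/-- `ad_{sp}` on the double `𝔡`, for `p` in `𝔩*`. -/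
def adS (p : StrongDual 𝕜 R.l) : (V × StrongDual 𝕜 V) →L[𝕜] (V × StrongDual 𝕜 V) :=
  G.dad (0, R.s p)

/-- `p_𝔤 Ad_{e^{-sp}} : 𝔡 → 𝔤`. -/
def projAdNeg (p : StrongDual 𝕜 R.l) : (V × StrongDual 𝕜 V) →L[𝕜] V :=
  (ContinuousLinearMap.fst 𝕜 V (StrongDual 𝕜 V)).comp (G.dAdExp (0, -R.s p))

/-- `p_𝔤 Ad_{e^{-sp}} i_𝔤`. -/
def projAdNegIncl (p : StrongDual 𝕜 R.l) : V →L[𝕜] V :=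
  (R.projAdNeg p).comp (ContinuousLinearMap.inl 𝕜 V (StrongDual 𝕜 V))

/-- The base `U ⊆ 𝔩*`. -/
def U : Set (StrongDual 𝕜 R.l) :=
  {p | (∀ μ ∈ complexSpectrum (R.adL p),
          ¬ ∃ n : ℤ, n ≠ 0 ∧ μ = Complex.I * (Real.pi : ℂ) * (n : ℂ)) ∧
        (0 : ℂ) ∉ complexSpectrum (R.projAdNegIncl p)}

/-- The Alekseev–Meinrenken `r`-matrix `p ↦ F(ad_p) : 𝔩* → 𝔩` of `(𝔩, [,]_𝔩, 0, p_𝔩^{(3)} φ)`.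
(`F` is odd and `ad_p` exchanges `𝔩` and `𝔩*`, so `F(ad_p)` maps `𝔩*` into `𝔩`.) -/
def rAM (p : StrongDual 𝕜 R.l) : StrongDual 𝕜 R.l →L[𝕜] R.l :=
  ((ContinuousLinearMap.fst 𝕜 R.l (StrongDual 𝕜 R.l)).comp (opCothSubInv (R.adL p))).comp
    (ContinuousLinearMap.inr 𝕜 R.l (StrongDual 𝕜 R.l))

/-- The canonical dynamical `ℓ`-matrix: `sα + ξ ↦ rAM_p α
- (p_𝔤 Ad_{e^{-sp}} i_𝔤)⁻¹ p_𝔤 Ad_{e^{-sp}} ξ` for `α ∈ 𝔩*`, `ξ ∈ 𝔩^⊥`. The components of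
`η ∈ 𝔤*` are `α = i* η` and `ξ = η - s i* η`. -/
def lcan (p : StrongDual 𝕜 R.l) : StrongDual 𝕜 V →L[𝕜] V :=
  (R.l.subtypeL.comp (R.rAM p)).comp R.iStar
    - ((Ring.inverse (R.projAdNegIncl p)).comp
        ((R.projAdNeg p).comp (ContinuousLinearMap.inr 𝕜 V (StrongDual 𝕜 V)))).comp
        (ContinuousLinearMap.id 𝕜 (StrongDual 𝕜 V) - R.s.comp R.iStar)

/-- `⟨ξ, d_pℓ(·) ξ'⟩ ∈ 𝔩`: the element of `𝔩 = 𝔩**` given by `α ↦ ⟨ξ, d_pℓ(α) ξ'⟩`. -/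
def derivPair (ell : StrongDual 𝕜 R.l → StrongDual 𝕜 V →L[𝕜] V) (p : StrongDual 𝕜 R.l)
    (ξ ξ' : StrongDual 𝕜 V) : R.l :=
  ofBidual (ξ.comp ((ContinuousLinearMap.apply 𝕜 V ξ').comp (fderiv 𝕜 ell p)))

/-- The anchor `(z, ξ) ↦ i* ξ - ad*_z p` of `N(U)` at `p`. -/
def anchorN (p : StrongDual 𝕜 R.l) : (R.l × StrongDual 𝕜 V) →L[𝕜] StrongDual 𝕜 R.l :=
  LinearMap.toContinuousLinearMap
    { toFun := fun e => R.iStar e.2 - R.subData.adStar e.1 p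
      map_add' := fun a b => by
        ext v
        simp [QuasiBialgebraData.adStar]
        abel
      map_smul' := fun c a => by
        ext v
        simp [QuasiBialgebraData.adStar, mul_sub] }

/-- The algebroid `N(U) = U × 𝔩 × 𝔤*` of an `ℓ`-matrix. -/
def algebroidN (ell : StrongDual 𝕜 R.l → StrongDual 𝕜 V →L[𝕜] V) :
    AlgebroidData 𝕜 (StrongDual 𝕜 R.l) (R.l × StrongDual 𝕜 V) where
  anchor := R.anchorN
  bracket σ τ p :=
    let z := (σ p).1
    let ξ := (σ p).2
    let z' := (τ p).1
    let ξ' := (τ p).2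
    (fderiv 𝕜 (fun q => (τ q).1) p (R.anchorN p (σ p))
        - fderiv 𝕜 (fun q => (σ q).1) p (R.anchorN p (τ p))
        - R.lieL z z' + R.derivPair ell p ξ ξ',
      fderiv 𝕜 (fun q => (τ q).2) p (R.anchorN p (σ p))
        - fderiv 𝕜 (fun q => (σ q).2) p (R.anchorN p (τ p))
        + G.adStar z ξ' - G.adStar z' ξ + G.cocyclePair ξ ξ'
        + G.adStar (ell p ξ) ξ' - G.adStar (ell p ξ') ξ)

/-- `𝔤⋆₀ = 𝔩 ⊕ 𝔩^⊥ ⊆ 𝔡`. -/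
def gStar : Submodule 𝕜 (V × StrongDual 𝕜 V) := R.l.prod (perp R.l)

theorem dlie_mem_gStar (h : R.CanonicallyCompatible) {X Y : V × StrongDual 𝕜 V}
    (hX : X ∈ R.gStar) (hY : Y ∈ R.gStar) : G.dlie X Y ∈ R.gStar := by
  obtain ⟨hX1, hX2⟩ := hX
  obtain ⟨hY1, hY2⟩ := hY
  have hφ : G.assocContract X.2 Y.2 ∈ R.l := by
    by_contra hn
    obtain ⟨f, hf, hf'⟩ := Submodule.exists_le_ker_of_notMem hn
    refine hf ?_
    have hp : LinearMap.toContinuousLinearMap f ∈ perp R.l := fun v hv => hf' hv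
    have := apply_ofBidual (G.assocForm X.2 Y.2) (LinearMap.toContinuousLinearMap f)
    exact this.trans (h.assoc_mmm _ hX2 _ hY2 _ hp)
  refine ⟨?_, ?_⟩
  · show G.lie X.1 Y.1 + G.cocycle X.1 Y.2 - G.cocycle Y.1 X.2 + G.assocContract X.2 Y.2 ∈ R.l
    rw [h.cocycle_l _ hX1, h.cocycle_l _ hY1]
    simpa using add_mem (R.lie_mem_l _ hX1 _ hY1) hφ
  · intro v hv
    have e1 := hY2 _ (R.lie_mem_l _ hX1 _ hv)
    have e2 := hX2 _ (R.lie_mem_l _ hY1 _ hv)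
    simp [QuasiBialgebraData.dlie, QuasiBialgebraData.adStar, QuasiBialgebraData.cocyclePair,
      h.cocycle_l _ hv, e1, e2]

/-- The bracket of `𝔤⋆₀`, restricted from the double. -/
def gStarLie (h : R.CanonicallyCompatible) (X Y : R.gStar) : R.gStar :=
  ⟨G.dlie X Y, R.dlie_mem_gStar h X.2 Y.2⟩

/-- `(α, z + ξ) ↦ sα`, with values in `𝔡`. -/
def partA : (StrongDual 𝕜 R.l × R.gStar) →L[𝕜] (V × StrongDual 𝕜 V) :=
  (ContinuousLinearMap.inr 𝕜 V (StrongDual 𝕜 V)).comp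
    (R.s.comp (ContinuousLinearMap.fst 𝕜 (StrongDual 𝕜 R.l) R.gStar))

/-- `(α, z + ξ) ↦ z`, with values in `𝔡`. -/
def partZ : (StrongDual 𝕜 R.l × R.gStar) →L[𝕜] (V × StrongDual 𝕜 V) :=
  (ContinuousLinearMap.inl 𝕜 V (StrongDual 𝕜 V)).comp
    ((ContinuousLinearMap.fst 𝕜 V (StrongDual 𝕜 V)).comp
      (R.gStar.subtypeL.comp (ContinuousLinearMap.snd 𝕜 (StrongDual 𝕜 R.l) R.gStar)))

/-- `(α, z + ξ) ↦ ξ`, with values in `𝔡`. -/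
def partXi : (StrongDual 𝕜 R.l × R.gStar) →L[𝕜] (V × StrongDual 𝕜 V) :=
  (ContinuousLinearMap.inr 𝕜 V (StrongDual 𝕜 V)).comp
    ((ContinuousLinearMap.snd 𝕜 V (StrongDual 𝕜 V)).comp
      (R.gStar.subtypeL.comp (ContinuousLinearMap.snd 𝕜 (StrongDual 𝕜 R.l) R.gStar)))

/-- The projection `p_{𝔤*}` of `𝔡` onto `𝔤* ⊆ 𝔡`. -/
def projDual (𝕜 V : Type*) [RCLike 𝕜] [NormedAddCommGroup V] [NormedSpace 𝕜 V] :
    (V × StrongDual 𝕜 V) →L[𝕜] (V × StrongDual 𝕜 V) :=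
  (ContinuousLinearMap.inr 𝕜 V (StrongDual 𝕜 V)).comp
    (ContinuousLinearMap.snd 𝕜 V (StrongDual 𝕜 V))

/-- `(α, z + ξ) ↦ ((sinh ad_{sp} - ad_{sp})/ad_{sp}²) sα - ((sinh ad_{sp})/ad_{sp}) z`, with values
in `𝔡`. -/
def trivFst (p : StrongDual 𝕜 R.l) :
    (StrongDual 𝕜 R.l × R.gStar) →L[𝕜] (V × StrongDual 𝕜 V) :=
  (opSinhSub (R.adS p)).comp R.partA - (opSinhDiv (R.adS p)).comp R.partZ

/-- `(α, z + ξ) ↦ ((sinh ad_{sp})/ad_{sp}) sα - sinh(ad_{sp}) z - p_{𝔤*} Ad_{e^{sp}} ξ`, with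
values in `𝔡`. -/
def trivSnd (p : StrongDual 𝕜 R.l) :
    (StrongDual 𝕜 R.l × R.gStar) →L[𝕜] (V × StrongDual 𝕜 V) :=
  (opSinhDiv (R.adS p)).comp R.partA - (opSinh (R.adS p)).comp R.partZ
    - (projDual 𝕜 V).comp ((G.dAdExp (0, R.s p)).comp R.partXi)

/-- The bundle map `T_p : 𝔩* × 𝔤⋆₀ → 𝔩 × 𝔤*` with components `trivFst` (which lies in
`𝔩 ⊆ 𝔡`) and `trivSnd` (which lies in `𝔤* ⊆ 𝔡`). -/
def triv (p : StrongDual 𝕜 R.l) :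
    (StrongDual 𝕜 R.l × R.gStar) →L[𝕜] (R.l × StrongDual 𝕜 V) :=
  ((R.pl.comp (ContinuousLinearMap.fst 𝕜 V (StrongDual 𝕜 V))).comp (R.trivFst p)).prod
    ((ContinuousLinearMap.snd 𝕜 V (StrongDual 𝕜 V)).comp (R.trivSnd p))

end ReductiveDecomposition

end

/-! Write A = ad_{sp} on the double 𝔡, Θ_p = (e^A - 1)/A and E_p = e^A. The bundle N(U) embeds in U
× 𝔡 by (z, ξ) ↦ z + ℓ_p ξ + ξ, and ℓ is built so that T composed with this embedding becomes (α, x)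
↦ Θ_p sα - E_p x. This is the gauge transformation of the trivial algebroid by e^{sp}, up to the
sign with which the bracket of 𝔡 enters (`triv_embedding`). The reasons are elementary.
Compatibility makes A exchange 𝔩 and s𝔩*, so even functions of A preserve each of them and odd
functions exchange them. On the 𝔩 ⊕ s𝔩* part, F(A) supplies exactly what (sinh A - A)/A² and sinh A
/ A miss of (e^A - 1)/A. On 𝔩^⊥, the map (p_𝔤 Ad_{e^{-sp}} i_𝔤)⁻¹ p_𝔤 Ad_{e^{-sp}} recovers, up to
sign, the 𝔤-part of E_p ξ from its 𝔤*-part. The two conditions defining U are the invertibility of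
the two denominators.

Granted this, T preserves anchors by a direct computation (`anchorN_triv`). It is injective because
the anchor determines α and E_p is invertible, and a dimension count makes it bijective.

For the brackets, the 𝔤*-component is visible through the embedding. It follows from the
Maurer–Cartan equation for Θ and from E_p being an automorphism of 𝔡 (`maurerCartan`, `ad_famExp`,
`gauge_bracket`). The 𝔩-component is not determined this way, since z is mixed with ℓ_p ξ. Its
pairing with α ∈ 𝔩* is computed with the invariant pairing of 𝔡. Since s𝔩*, 𝔩 and 𝔤⋆₀ are isotropic,
Θ sα is isotropic as well. The decisive fact is that the two-form defined by (sinh A - A)/A² is a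
primitive of half the Cartan three-form pulled back by Θ (`two_mul_cyclic_sinhSub`), which gives
`dorfman_identity`. `pairing_fderiv` identifies the term ⟨ξ, dℓ ξ'⟩ - ⟨·, [z, z']⟩ of the bracket of
N(U) with the terms of that identity.

The identities in p are obtained by inserting a parameter t, replacing A by tA, and differentiating
in t. The Lie algebroid laws of N(U) are transported from the trivial algebroid; no dynamical
Yang–Baxter equation is checked separately. -/

noncomputable section

/-! ### Entire functions of endomorphisms -/

/-- The coefficients `c` are dominated by those of the exponential series. -/
def ExpBounded {𝕜 : Type*} [RCLike 𝕜] (c : ℕ → 𝕜) : Prop :=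
  ∀ n, ‖c n‖ ≤ ((n.factorial : ℝ))⁻¹

section EntireCalc

variable {𝕜 E F : Type*} [RCLike 𝕜] [NormedAddCommGroup E] [NormedSpace 𝕜 E]
  [NormedAddCommGroup F] [NormedSpace 𝕜 F] {c c' : ℕ → 𝕜}

/-- `E` may be the zero space, where the identity has norm 0, so the exponent 0 only gives an
inequality. -/
theorem opNorm_pow_le (A : E →L[𝕜] E) (n : ℕ) : ‖A ^ n‖ ≤ ‖A‖ ^ n := by
  induction n with
  | zero => simpa using! ContinuousLinearMap.norm_id_le (𝕜 := 𝕜) (E := E)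
  | succ n ih =>
    rw [pow_succ, pow_succ]
    exact (norm_mul_le _ _).trans (by gcongr)

theorem summable_pow_div_factorial (r : ℝ) :
    Summable fun n : ℕ => ((n.factorial : ℝ))⁻¹ * r ^ n := by
  simpa [div_eq_inv_mul] using Real.summable_pow_div_factorial r

theorem ExpBounded.norm_smul_pow_le (hc : ExpBounded c) (A : E →L[𝕜] E) (n : ℕ) :
    ‖c n • A ^ n‖ ≤ ((n.factorial : ℝ))⁻¹ * ‖A‖ ^ n := by
  rw [norm_smul]
  exact mul_le_mul (hc n) (opNorm_pow_le A n) (norm_nonneg _) (by positivity)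

theorem ExpBounded.hasSum [CompleteSpace E] (hc : ExpBounded c) (A : E →L[𝕜] E) :
    HasSum (fun n => c n • A ^ n) (entireCalc c A) :=
  (Summable.of_norm_bounded (summable_pow_div_factorial ‖A‖) (hc.norm_smul_pow_le A)).hasSum

theorem ExpBounded.hasSum_apply [CompleteSpace E] (hc : ExpBounded c) (A : E →L[𝕜] E) (x : E) :
    HasSum (fun n => c n • (A ^ n) x) (entireCalc c A x) := by
  simpa using (hc.hasSum A).mapL (ContinuousLinearMap.apply 𝕜 E x)

theorem ExpBounded.analyticOnNhd [CompleteSpace E] (hc : ExpBounded c) :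
    AnalyticOnNhd 𝕜 (entireCalc c : (E →L[𝕜] E) → (E →L[𝕜] E)) Set.univ := by
  set p := FormalMultilinearSeries.ofScalars (E →L[𝕜] E) c with hp
  have hr : p.radius = ⊤ := by
    refine p.radius_eq_top_of_summable_norm fun r => ?_
    refine Summable.of_norm_bounded_eventually_nat (summable_pow_div_factorial (r : ℝ)) ?_
    -- The norm bound for scalar monomials is applied for n > 0 only; one term does not affect
    -- summability.
    filter_upwards [Filter.eventually_gt_atTop 0] with n hn
    rw [norm_mul, norm_norm, norm_pow, Real.norm_of_nonneg r.coe_nonneg]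
    gcongr
    exact (FormalMultilinearSeries.ofScalars_norm_le _ _ n hn).trans (hc n)
  have h := p.hasFPowerSeriesOnBall (by rw [hr]; exact ENNReal.zero_lt_top)
  have hs : p.sum = entireCalc c := by
    funext A
    exact FormalMultilinearSeries.ofScalars_sum_eq c A
  rw [hs, hr] at h
  simpa using h.analyticOnNhd

theorem ExpBounded.contDiff [CompleteSpace E] (hc : ExpBounded c) {n : WithTop ℕ∞} :
    ContDiff 𝕜 n (entireCalc c : (E →L[𝕜] E) → (E →L[𝕜] E)) := by
  rw [← contDiffOn_univ]
  exact hc.analyticOnNhd.contDiffOn uniqueDiffOn_univ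

theorem ExpBounded.commute [CompleteSpace E] (hc : ExpBounded c) (A : E →L[𝕜] E) :
    Commute A (entireCalc c A) := by
  have h1 := (hc.hasSum A).mul_left A
  have h2 := (hc.hasSum A).mul_right A
  refine h1.unique (h2.congr_fun ?_)
  intro n
  simp [← pow_succ, ← pow_succ']

theorem ExpBounded.commute_of_commute [CompleteSpace E] (hc : ExpBounded c) {A B : E →L[𝕜] E}
    (h : Commute B A) : Commute B (entireCalc c A) := by
  have h1 := (hc.hasSum A).mul_left B
  have h2 := (hc.hasSum A).mul_right B
  refine h1.unique (h2.congr_fun ?_)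
  intro n
  simp [(h.pow_right n).eq]

theorem ExpBounded.commute_entireCalc [CompleteSpace E] (hc : ExpBounded c) (hc' : ExpBounded c')
    (A : E →L[𝕜] E) : Commute (entireCalc c A) (entireCalc c' A) :=
  hc'.commute_of_commute (hc.commute A).symm

/-- Entire functions are natural for intertwining maps. -/
theorem ExpBounded.intertwine [CompleteSpace E] [CompleteSpace F] (hc : ExpBounded c)
    {A : E →L[𝕜] E} {B : F →L[𝕜] F} {j : E →L[𝕜] F} (h : ∀ x, j (A x) = B (j x)) (x : E) :
    j (entireCalc c A x) = entireCalc c B (j x) := by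
  have h1 := (hc.hasSum_apply A x).mapL j
  refine h1.unique ((hc.hasSum_apply B (j x)).congr_fun ?_)
  intro n
  have : ∀ n : ℕ, j ((A ^ n) x) = (B ^ n) (j x) := fun n => by
    induction n with
    | zero => simp
    | succ n ih => rw [pow_succ', pow_succ', mul_apply_eq_comp, mul_apply_eq_comp, h, ih]
  rw [map_smul, this]

/-- Even powers of `A` preserve `P`, and a finite-dimensional subspace is closed, so the limit stays
in it. With `mem_of_odd` this locates every component of T. -/
theorem ExpBounded.mem_of_even [CompleteSpace E] [FiniteDimensional 𝕜 E] (hc : ExpBounded c)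
    (he : ∀ n, Odd n → c n = 0) {A : E →L[𝕜] E} {P Q : Submodule 𝕜 E}
    (hP : ∀ x ∈ P, A x ∈ Q) (hQ : ∀ x ∈ Q, A x ∈ P) {x : E} (hx : x ∈ P) :
    entireCalc c A x ∈ P := by
  have key : ∀ n : ℕ, (A ^ (2 * n)) x ∈ P := fun n => by
    induction n with
    | zero => simpa
    | succ n ih =>
      have : 2 * (n + 1) = (2 * n + 1) + 1 := by ring
      rw [this, pow_succ', pow_succ']
      exact hQ _ (hP _ ih)
  refine P.closed_of_finiteDimensional.mem_of_tendsto (hc.hasSum_apply A x)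
    (Filter.Eventually.of_forall fun s => P.sum_mem fun n _ => ?_)
  rcases Nat.even_or_odd' n with ⟨k, rfl | rfl⟩
  · exact P.smul_mem _ (key k)
  · simp [he _ ⟨k, rfl⟩]

theorem ExpBounded.mem_of_odd [CompleteSpace E] [FiniteDimensional 𝕜 E] (hc : ExpBounded c)
    (ho : ∀ n, Even n → c n = 0) {A : E →L[𝕜] E} {P Q : Submodule 𝕜 E}
    (hP : ∀ x ∈ P, A x ∈ Q) (hQ : ∀ x ∈ Q, A x ∈ P) {x : E} (hx : x ∈ P) :
    entireCalc c A x ∈ Q := by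
  have key : ∀ n : ℕ, (A ^ (2 * n)) x ∈ P := fun n => by
    induction n with
    | zero => simpa
    | succ n ih =>
      have : 2 * (n + 1) = (2 * n + 1) + 1 := by ring
      rw [this, pow_succ', pow_succ']
      exact hQ _ (hP _ ih)
  refine Q.closed_of_finiteDimensional.mem_of_tendsto (hc.hasSum_apply A x)
    (Filter.Eventually.of_forall fun s => Q.sum_mem fun n _ => ?_)
  rcases Nat.even_or_odd' n with ⟨k, rfl | rfl⟩
  · simp [ho _ (even_two_mul k)]
  · rw [pow_succ']
    exact Q.smul_mem _ (hP _ (key k))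

theorem ExpBounded.mem_of_map [CompleteSpace E] [FiniteDimensional 𝕜 E] (hc : ExpBounded c)
    {A : E →L[𝕜] E} {P : Submodule 𝕜 E} (hP : ∀ x ∈ P, A x ∈ P) {x : E} (hx : x ∈ P) :
    entireCalc c A x ∈ P := by
  have key : ∀ n : ℕ, (A ^ n) x ∈ P := fun n => by
    induction n with
    | zero => simpa
    | succ n ih => rw [pow_succ']; exact hP _ ih
  exact P.closed_of_finiteDimensional.mem_of_tendsto (hc.hasSum_apply A x)
    (Filter.Eventually.of_forall fun s => P.sum_mem fun n _ => P.smul_mem _ (key n))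

theorem ExpBounded.neg_of_even [CompleteSpace E] (hc : ExpBounded c) (he : ∀ n, Odd n → c n = 0)
    (A : E →L[𝕜] E) : entireCalc c (-A) = entireCalc c A := by
  refine (hc.hasSum (-A)).unique ((hc.hasSum A).congr_fun fun n => ?_)
  rcases Nat.even_or_odd n with h | h
  · simp [h.neg_pow]
  · simp [he n h]

theorem ExpBounded.neg_of_odd [CompleteSpace E] (hc : ExpBounded c) (ho : ∀ n, Even n → c n = 0)
    (A : E →L[𝕜] E) : entireCalc c (-A) = -entireCalc c A := by
  refine (hc.hasSum (-A)).unique ((hc.hasSum A).neg.congr_fun fun n => ?_)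
  rcases Nat.even_or_odd n with h | h
  · simp [ho n h]
  · simp [h.neg_pow]

/-- Entire functions of a skew-adjoint endomorphism. -/
theorem ExpBounded.adjoint [CompleteSpace E] (hc : ExpBounded c) {A : E →L[𝕜] E}
    {b : E →L[𝕜] E →L[𝕜] 𝕜} (h : ∀ x y, b (A x) y = -b x (A y)) (x y : E) :
    b (entireCalc c A x) y = b x (entireCalc c (-A) y) := by
  have h1 := (hc.hasSum_apply A x).mapL (b.flip y)
  have h2 := (hc.hasSum_apply (-A) y).mapL (b x)
  refine h1.unique (h2.congr_fun fun n => ?_)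
  have : ∀ (n : ℕ) x, b ((A ^ n) x) y = b x (((-A) ^ n) y) := fun n => by
    induction n with
    | zero => simp
    | succ n ih =>
      intro x
      rw [pow_succ, pow_succ', mul_apply_eq_comp, mul_apply_eq_comp, ih, h]
      simp
  rw [ContinuousLinearMap.flip_apply, map_smul, map_smul, smul_apply, this]

/-- Term-by-term differentiation along `t ↦ t • A`. -/
theorem ExpBounded.hasDerivAt [CompleteSpace E] (hc : ExpBounded c) (hc' : ExpBounded c')
    (k : ℕ) (h : ∀ n, ((n + k + 1 : ℕ) : 𝕜) * c n = c' n) (A : E →L[𝕜] E) (t : 𝕜) :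
    HasDerivAt (fun t : 𝕜 => t ^ (k + 1) • entireCalc c (t • A))
      (t ^ k • entireCalc c' (t • A)) t := by
  have e1 : ∀ t : 𝕜, ∑' n, (t ^ (n + k + 1) * c n) • A ^ n
      = t ^ (k + 1) • entireCalc c (t • A) := fun t => by
    rw [entireCalc, ← ((hc.hasSum (t • A)).summable).tsum_const_smul]
    congr 1; funext n
    rw [smul_pow, smul_smul, smul_smul]
    congr 1; ring
  have e2 : ∀ t : 𝕜, ∑' n, ((n + k + 1 : ℕ) * t ^ (n + k) * c n) • A ^ n
      = t ^ k • entireCalc c' (t • A) := fun t => by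
    rw [entireCalc, ← ((hc'.hasSum (t • A)).summable).tsum_const_smul]
    congr 1; funext n
    rw [smul_pow, smul_smul, smul_smul, ← h n]
    congr 1; ring
  rw [← e2]
  simp_rw [← e1]
  -- The n-th term is t^(n+k+1) cₙ Aⁿ and its derivative is t^(n+k) c'ₙ Aⁿ. On the ball of radius
  -- ‖t‖ + 1 the derivatives are dominated by a multiple of the exponential series, which permits
  -- termwise differentiation.
  set r := ‖t‖ + 1 with hr
  have hball : t ∈ Metric.ball (0 : 𝕜) r := by simp [hr]
  refine hasDerivAt_tsum_of_isPreconnected (𝕜 := 𝕜) (F := E →L[𝕜] E)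
    (g := fun n t => (t ^ (n + k + 1) * c n) • A ^ n)
    (g' := fun n t => ((n + k + 1 : ℕ) * t ^ (n + k) * c n) • A ^ n)
    (u := fun n => r ^ k * (((n.factorial : ℝ))⁻¹ * (r * ‖A‖) ^ n)) (t := Metric.ball 0 r)
    (y₀ := t) ((summable_pow_div_factorial _).mul_left _) Metric.isOpen_ball
    (convex_ball (0 : 𝕜) r).isPreconnected ?_ ?_ hball ?_ hball
  · intro n y _
    have h1 : HasDerivAt (fun y : 𝕜 => y ^ (n + k + 1)) (((n + k + 1 : ℕ) : 𝕜) * y ^ (n + k)) y := by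
      simpa only [Nat.add_sub_cancel] using hasDerivAt_pow (n + k + 1) y
    exact (h1.mul_const (c n)).smul_const (A ^ n)
  · intro n y hy
    have hy' : ‖y‖ ≤ r := (mem_ball_zero_iff.1 hy).le
    have : (((n + k + 1 : ℕ) : 𝕜) * y ^ (n + k) * c n) • A ^ n
        = y ^ (n + k) • (c' n • A ^ n) := by
      rw [← h n, smul_smul]; congr 1; ring_nf
    rw [this, norm_smul, norm_pow]
    calc ‖y‖ ^ (n + k) * ‖c' n • A ^ n‖
        ≤ r ^ (n + k) * (((n.factorial : ℝ))⁻¹ * ‖A‖ ^ n) := by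
          gcongr
          exact hc'.norm_smul_pow_le A n
      _ = _ := by rw [pow_add, mul_pow]; ring
  · refine ((hc.hasSum (t • A)).summable.const_smul (t ^ (k + 1))).congr fun n => ?_
    rw [smul_pow, smul_smul, smul_smul]
    congr 1; ring

end EntireCalc

/-! ### The coefficient sequences -/

section Coefficients

variable (𝕜 : Type*) [RCLike 𝕜]

/-- Coefficients of `exp z`. -/
def cExp (n : ℕ) : 𝕜 := ((n.factorial : 𝕜))⁻¹
/-- Coefficients of `(exp z - 1) / z`. -/
def cExpDiv (n : ℕ) : 𝕜 := (((n + 1).factorial : 𝕜))⁻¹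
/-- Coefficients of `sinh z`. -/
def cSinh (n : ℕ) : 𝕜 := if Odd n then ((n.factorial : 𝕜))⁻¹ else 0
/-- Coefficients of `sinh z / z`. -/
def cSinhDiv (n : ℕ) : 𝕜 := if Even n then (((n + 1).factorial : 𝕜))⁻¹ else 0
/-- Coefficients of `(sinh z - z) / z²`. -/
def cSinhSub (n : ℕ) : 𝕜 := if Odd n then (((n + 2).factorial : 𝕜))⁻¹ else 0
/-- Coefficients of `(cosh z - 1) / z`. -/
def cCoshDiv (n : ℕ) : 𝕜 := if Odd n then (((n + 1).factorial : 𝕜))⁻¹ else 0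
/-- Coefficients of `(z cosh z - sinh z) / z²`. -/
def cCothNum (n : ℕ) : 𝕜 := if Odd n then
  (((n + 1).factorial : 𝕜))⁻¹ - (((n + 2).factorial : 𝕜))⁻¹ else 0

theorem norm_inv_factorial_le {m n : ℕ} (h : n ≤ m) :
    ‖((m.factorial : 𝕜))⁻¹‖ ≤ ((n.factorial : ℝ))⁻¹ := by
  rw [norm_inv, RCLike.norm_natCast]
  gcongr

theorem expBounded_cExp : ExpBounded (cExp 𝕜) := fun _ => norm_inv_factorial_le 𝕜 le_rfl

theorem expBounded_cExpDiv : ExpBounded (cExpDiv 𝕜) := fun n =>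
  norm_inv_factorial_le 𝕜 (Nat.le_succ n)

theorem expBounded_cSinh : ExpBounded (cSinh 𝕜) := fun n => by
  unfold cSinh; split_ifs
  · exact norm_inv_factorial_le 𝕜 le_rfl
  · simp

theorem expBounded_cSinhDiv : ExpBounded (cSinhDiv 𝕜) := fun n => by
  unfold cSinhDiv; split_ifs
  · exact norm_inv_factorial_le 𝕜 (by omega)
  · simp

theorem expBounded_cSinhSub : ExpBounded (cSinhSub 𝕜) := fun n => by
  unfold cSinhSub; split_ifs
  · exact norm_inv_factorial_le 𝕜 (by omega)
  · simp

theorem expBounded_cCoshDiv : ExpBounded (cCoshDiv 𝕜) := fun n => by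
  unfold cCoshDiv; split_ifs
  · exact norm_inv_factorial_le 𝕜 (by omega)
  · simp

theorem expBounded_cCothNum : ExpBounded (cCothNum 𝕜) := fun n => by
  unfold cCothNum; split_ifs
  · have h : (((n + 1).factorial : 𝕜))⁻¹ - (((n + 2).factorial : 𝕜))⁻¹
        = ((n + 1 : ℕ) : 𝕜) * (((n + 2).factorial : 𝕜))⁻¹ := by
      have h1 : ((n + 1).factorial : 𝕜) ≠ 0 := Nat.cast_ne_zero.2 (Nat.factorial_ne_zero _)
      have h2 : ((n : 𝕜) + 1 + 1) ≠ 0 := by exact_mod_cast Nat.succ_ne_zero (n + 1)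
      rw [Nat.factorial_succ (n + 1)]
      push_cast
      field_simp
      ring_nf
    rw [h, norm_mul, norm_inv, RCLike.norm_natCast, RCLike.norm_natCast, Nat.factorial_succ (n + 1),
      Nat.factorial_succ n]
    have h1 : (0 : ℝ) < n.factorial := by exact_mod_cast Nat.factorial_pos n
    push_cast
    rw [← div_eq_mul_inv, div_le_iff₀ (by positivity)]
    field_simp
    linarith [(Nat.cast_nonneg n : (0 : ℝ) ≤ n)]
  · simp

end Coefficients

/-! ### Identities between exp, sinh and their divided forms. -/

section Relations

variable {𝕜 E : Type*} [RCLike 𝕜] [NormedAddCommGroup E] [NormedSpace 𝕜 E] [CompleteSpace E]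

/-- Splitting off the constant term: g(z) = g(0) + z f(z) on coefficients. It replaces division by
`A`, which need not be invertible. -/
theorem ExpBounded.mul_entireCalc {c c' : ℕ → 𝕜} (hc : ExpBounded c) (hc' : ExpBounded c')
    (h : ∀ n, c' (n + 1) = c n) (A : E →L[𝕜] E) :
    entireCalc c' A = c' 0 • 1 + A * entireCalc c A := by
  have h1 := (hasSum_nat_add_iff' 1).2 (hc'.hasSum A)
  have h2 := (hc.hasSum A).mul_left A
  have := h1.unique (h2.congr_fun fun n => by simp [h, pow_succ'])
  simp at this
  rw [← this]; abel

omit [CompleteSpace E] in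
theorem exp_eq_entireCalc (A : E →L[𝕜] E) : NormedSpace.exp A = entireCalc (cExp 𝕜) A := by
  rw [NormedSpace.exp_eq_tsum 𝕜]; rfl

theorem exp_eq_one_add (A : E →L[𝕜] E) :
    NormedSpace.exp A = 1 + A * entireCalc (cExpDiv 𝕜) A := by
  rw [exp_eq_entireCalc, (expBounded_cExpDiv 𝕜).mul_entireCalc (expBounded_cExp 𝕜) fun _ => rfl]
  simp [cExp]

theorem opSinh_eq (A : E →L[𝕜] E) : opSinh A = A * opSinhDiv A := by
  have := (expBounded_cSinhDiv 𝕜).mul_entireCalc (expBounded_cSinh 𝕜)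
    (fun n => by simp [cSinh, cSinhDiv, Nat.odd_add_one]) A
  simpa [cSinh] using! this

theorem opSinhDiv_eq (A : E →L[𝕜] E) : opSinhDiv A = 1 + A * opSinhSub A := by
  have := (expBounded_cSinhSub 𝕜).mul_entireCalc (expBounded_cSinhDiv 𝕜)
    (fun n => by simp [cSinhSub, cSinhDiv, Nat.even_add_one]) A
  simpa [cSinhDiv] using! this

/-- The splitting of (e^z - 1)/z into its even and odd parts. -/
theorem expDiv_eq (A : E →L[𝕜] E) :
    entireCalc (cExpDiv 𝕜) A = opSinhDiv A + entireCalc (cCoshDiv 𝕜) A := by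
  refine ((expBounded_cExpDiv 𝕜).hasSum A).unique
    ((((expBounded_cSinhDiv 𝕜).hasSum A).add ((expBounded_cCoshDiv 𝕜).hasSum A)).congr_fun
      fun n => ?_)
  rcases Nat.even_or_odd n with h | h
  · simp [cExpDiv, cSinhDiv, cCoshDiv, h]
  · simp [cExpDiv, cSinhDiv, cCoshDiv, h]

/-- The odd part of (e^z - 1)/z exceeds (sinh z - z)/z² by the numerator of F. This excess is what
the ℓ-matrix contributes to the gauge transformation. -/
theorem coshDiv_eq (A : E →L[𝕜] E) :
    entireCalc (cCoshDiv 𝕜) A = entireCalc (cCothNum 𝕜) A + opSinhSub A := by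
  refine ((expBounded_cCoshDiv 𝕜).hasSum A).unique
    ((((expBounded_cCothNum 𝕜).hasSum A).add ((expBounded_cSinhSub 𝕜).hasSum A)).congr_fun
      fun n => ?_)
  rcases Nat.even_or_odd n with h | h
  · simp [cCothNum, cSinhSub, cCoshDiv, Nat.not_odd_iff_even.2 h]
  · simp [cCothNum, cSinhSub, cCoshDiv, h, ← add_smul]

theorem expDiv_neg (A : E →L[𝕜] E) :
    entireCalc (cExpDiv 𝕜) (-A) = opSinhDiv A - entireCalc (cCoshDiv 𝕜) A := by
  rw [expDiv_eq, (expBounded_cCoshDiv 𝕜).neg_of_odd (fun n h => by simp [cCoshDiv, h])]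
  have : opSinhDiv (-A) = opSinhDiv A :=
    (expBounded_cSinhDiv 𝕜).neg_of_even (fun n h => by simp [cSinhDiv, h]) A
  rw [this]; abel

theorem hasDerivAt_expDiv (A : E →L[𝕜] E) (t : 𝕜) :
    HasDerivAt (fun t : 𝕜 => t • entireCalc (cExpDiv 𝕜) (t • A)) (NormedSpace.exp (t • A)) t := by
  have := (expBounded_cExpDiv 𝕜).hasDerivAt (expBounded_cExp 𝕜) 0 (fun n => by
    have : ((n : 𝕜) + 1) ≠ 0 := by exact_mod_cast Nat.succ_ne_zero n
    simp [cExpDiv, cExp, Nat.factorial_succ]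
    field_simp) A t
  simpa [exp_eq_entireCalc] using this

theorem hasDerivAt_sinhSub (A : E →L[𝕜] E) (t : 𝕜) :
    HasDerivAt (fun t : 𝕜 => t ^ 2 • opSinhSub (t • A))
      (t • entireCalc (cCoshDiv 𝕜) (t • A)) t := by
  have := (expBounded_cSinhSub 𝕜).hasDerivAt (expBounded_cCoshDiv 𝕜) 1 (fun n => by
    have : ((n : 𝕜) + 1 + 1) ≠ 0 := by exact_mod_cast Nat.succ_ne_zero (n + 1)
    simp only [cSinhSub, cCoshDiv]
    split_ifs
    · rw [Nat.factorial_succ (n + 1)]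
      push_cast
      field_simp
    · simp) A t
  simpa using! this

/-- `(e^A - 1) / A = e^A (e^{-A} - 1) / (-A)`. -/
theorem exp_mul_expDiv_neg (A : E →L[𝕜] E) :
    NormedSpace.exp A * entireCalc (cExpDiv 𝕜) (-A) = entireCalc (cExpDiv 𝕜) A := by
  -- Since `A` need not be invertible, the identity is multiplied by t, evaluated at tA, and shown
  -- to have a t-constant defect, which vanishes at t = 0.
  set f : 𝕜 → (E →L[𝕜] E) := fun t =>
    NormedSpace.exp (t • A) * (t • entireCalc (cExpDiv 𝕜) (t • -A))
      - t • entireCalc (cExpDiv 𝕜) (t • A) with hf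
  have hd : ∀ t, HasDerivAt f 0 t := fun t => by
    have h := ((hasDerivAt_exp_smul_const A t).mul (hasDerivAt_expDiv (-A) t)).sub
      (hasDerivAt_expDiv A t)
    have e : NormedSpace.exp (t • A) * NormedSpace.exp (t • -A) = 1 := by
      let _ : NormedAlgebra ℚ (E →L[𝕜] E) := NormedAlgebra.restrictScalars ℚ 𝕜 _
      rw [← NormedSpace.exp_add_of_commute (by simp [Commute, SemiconjBy]), ]
      simp
    refine h.congr_deriv ?_
    have e3 : A * (t • entireCalc (cExpDiv 𝕜) (t • -A)) = 1 - NormedSpace.exp (t • -A) := by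
      rw [exp_eq_one_add (t • -A)]
      simp
    rw [mul_assoc, e3, mul_sub, mul_one, e]
    abel
  have := is_const_of_deriv_eq_zero (fun t => (hd t).differentiableAt) (fun t => (hd t).deriv) 1 0
  simp [hf] at this
  exact sub_eq_zero.1 this

end Relations

/-! ### Derivatives of functions of `ad` -/

section MixedPartials

variable {𝕜 B F : Type*} [RCLike 𝕜] [NormedAddCommGroup B] [NormedSpace 𝕜 B]
  [NormedAddCommGroup F] [NormedSpace 𝕜 F]

/-- Symmetry of mixed partial derivatives for a function of a scalar and a vector. -/
theorem hasDerivAt_fderiv_swap {G G' : 𝕜 → B → F}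
    (hG : ContDiff 𝕜 ∞ fun x : 𝕜 × B => G x.1 x.2)
    (hd : ∀ t p, HasDerivAt (fun t => G t p) (G' t p) t) (p Y : B) (t : 𝕜) :
    HasDerivAt (fun t => fderiv 𝕜 (G t) p Y) (fderiv 𝕜 (G' t) p Y) t := by
  set f : 𝕜 × B → F := fun x => G x.1 x.2 with hf
  have hfd : ∀ x, HasFDerivAt f (fderiv 𝕜 f x) x := fun x =>
    (hG.differentiable (by simp) x).hasFDerivAt
  have hf2 : ContDiff 𝕜 ∞ (fderiv 𝕜 f) := hG.fderiv_right (by simp)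
  have hfd2 : ∀ x, HasFDerivAt (fderiv 𝕜 f) (fderiv 𝕜 (fderiv 𝕜 f) x) x := fun x =>
    (hf2.differentiable (by simp) x).hasFDerivAt
  have hr : ∀ t p, HasFDerivAt (fun q : B => (t, q)) (ContinuousLinearMap.inr 𝕜 𝕜 B) p :=
    fun t p => hasFDerivAt_prodMk_right t p
  have hl : ∀ t p, HasDerivAt (fun s : 𝕜 => (s, p)) ((1 : 𝕜), (0 : B)) t :=
    fun t p => (hasDerivAt_id t).prodMk (hasDerivAt_const t p)
  have e1 : ∀ t p Y, fderiv 𝕜 (G t) p Y = fderiv 𝕜 f (t, p) (0, Y) := fun t p Y => by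
    have := ((hfd (t, p)).comp p (hr t p)).fderiv
    rw [show G t = f ∘ fun q => (t, q) from rfl, this]
    simp
  have e2 : ∀ t p, G' t p = fderiv 𝕜 f (t, p) (1, 0) := fun t p =>
    (hd t p).unique (HasFDerivAt.comp_hasDerivAt (l := f) t (hfd (t, p)) (hl t p))
  have e3 : G' t = fun q => fderiv 𝕜 f (t, q) (1, 0) := funext fun q => e2 t q
  have h1 : HasFDerivAt (fun q => fderiv 𝕜 f (t, q) (1, 0)) _ p :=
    ((ContinuousLinearMap.apply 𝕜 F ((1 : 𝕜), (0 : B))).hasFDerivAt).comp p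
      ((hfd2 (t, p)).comp p (hr t p))
  have h2 : HasDerivAt (fun s => fderiv 𝕜 f (s, p) (0, Y)) _ t :=
    ((ContinuousLinearMap.apply 𝕜 F ((0 : 𝕜), Y)).hasFDerivAt).comp_hasDerivAt t
      ((hfd2 (t, p)).comp_hasDerivAt t (hl t p))
  have hs : IsSymmSndFDerivAt 𝕜 f (t, p) :=
    hG.contDiffAt.isSymmSndFDerivAt (by simpa using WithTop.coe_le_coe.2 (le_top : (2 : ℕ∞) ≤ ⊤))
  simp_rw [e1]
  refine h2.congr_deriv ?_
  rw [e3, h1.fderiv]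
  simpa using hs (1, 0) (0, Y)

theorem eq_zero_of_hasDerivAt_zero {f : 𝕜 → F} (h : ∀ t, HasDerivAt f 0 t) (h0 : f 0 = 0) (t : 𝕜) :
    f t = 0 := by
  rw [← h0]
  exact is_const_of_deriv_eq_zero (fun t => (h t).differentiableAt) (fun t => (h t).deriv) t 0

end MixedPartials

/-! ### Calculus of f(t ad_p) in both p and t. -/

section AdFamilies

variable {𝕜 B D : Type*} [RCLike 𝕜] [NormedAddCommGroup B] [NormedSpace 𝕜 B]
  [NormedAddCommGroup D] [NormedSpace 𝕜 D] (ad : D →L[𝕜] D →L[𝕜] D) (κ : B →L[𝕜] D)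

/-- `exp (t ad_p)`. -/
def famExp (t : 𝕜) (p : B) : D →L[𝕜] D := NormedSpace.exp (t • ad (κ p))
/-- `(exp (t ad_p) - 1) / ad_p`. -/
def famExpDiv (t : 𝕜) (p : B) : D →L[𝕜] D := t • entireCalc (cExpDiv 𝕜) (t • ad (κ p))
/-- `sinh (t ad_p) / (t ad_p)`. -/
def famSinhDiv (t : 𝕜) (p : B) : D →L[𝕜] D := opSinhDiv (t • ad (κ p))
/-- `(sinh (t ad_p) - t ad_p) / ad_p²`. -/
def famSinhSub (t : 𝕜) (p : B) : D →L[𝕜] D := t ^ 2 • opSinhSub (t • ad (κ p))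
/-- `(cosh (t ad_p) - 1) / ad_p`. -/
def famCoshDiv (t : 𝕜) (p : B) : D →L[𝕜] D := t • entireCalc (cCoshDiv 𝕜) (t • ad (κ p))

variable [CompleteSpace D]

theorem ExpBounded.contDiff_fam {c : ℕ → 𝕜} (hc : ExpBounded c) (k : ℕ) :
    ContDiff 𝕜 ∞ fun x : 𝕜 × B => x.1 ^ k • entireCalc c (x.1 • ad (κ x.2)) :=
  (contDiff_fst.pow k).smul (hc.contDiff.comp
    (contDiff_fst.smul (ad.contDiff.comp (κ.contDiff.comp contDiff_snd))))

theorem contDiff_famExp : ContDiff 𝕜 ∞ fun x : 𝕜 × B => famExp ad κ x.1 x.2 := by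
  simpa [famExp, exp_eq_entireCalc] using (expBounded_cExp 𝕜).contDiff_fam ad κ 0

theorem contDiff_famExpDiv : ContDiff 𝕜 ∞ fun x : 𝕜 × B => famExpDiv ad κ x.1 x.2 := by
  simpa [famExpDiv] using (expBounded_cExpDiv 𝕜).contDiff_fam ad κ 1

theorem contDiff_famSinhSub : ContDiff 𝕜 ∞ fun x : 𝕜 × B => famSinhSub ad κ x.1 x.2 :=
  (expBounded_cSinhSub 𝕜).contDiff_fam ad κ 2

theorem contDiff_famSinhDiv : ContDiff 𝕜 ∞ fun x : 𝕜 × B => famSinhDiv ad κ x.1 x.2 := by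
  simpa using! (expBounded_cSinhDiv 𝕜).contDiff_fam ad κ 0

theorem contDiff_famCoshDiv : ContDiff 𝕜 ∞ fun x : 𝕜 × B => famCoshDiv ad κ x.1 x.2 := by
  simpa [famCoshDiv] using (expBounded_cCoshDiv 𝕜).contDiff_fam ad κ 1

variable {ad κ}

omit [CompleteSpace D] in
theorem contDiff_right_of_uncurry {f : 𝕜 → B → D →L[𝕜] D}
    (h : ContDiff 𝕜 ∞ fun x : 𝕜 × B => f x.1 x.2) (t : 𝕜) : ContDiff 𝕜 ∞ (f t) :=
  h.comp (contDiff_const.prodMk contDiff_id)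

omit [CompleteSpace D] in
theorem differentiable_of_uncurry {f : 𝕜 → B → D →L[𝕜] D}
    (h : ContDiff 𝕜 ∞ fun x : 𝕜 × B => f x.1 x.2) (t : 𝕜) : Differentiable 𝕜 (f t) :=
  (contDiff_right_of_uncurry h t).differentiable (by simp)

theorem famExp_eq (t : 𝕜) (p : B) :
    famExp ad κ t p = 1 + ad (κ p) * famExpDiv ad κ t p := by
  rw [famExp, famExpDiv, exp_eq_one_add]
  simp

theorem hasDerivAt_famExp (t : 𝕜) (p : B) :
    HasDerivAt (fun t => famExp ad κ t p) (ad (κ p) * famExp ad κ t p) t :=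
  hasDerivAt_exp_smul_const' _ t

theorem hasDerivAt_famExpDiv (t : 𝕜) (p : B) :
    HasDerivAt (fun t => famExpDiv ad κ t p) (famExp ad κ t p) t :=
  hasDerivAt_expDiv _ t

theorem hasDerivAt_famSinhSub (t : 𝕜) (p : B) :
    HasDerivAt (fun t => famSinhSub ad κ t p) (famCoshDiv ad κ t p) t :=
  hasDerivAt_sinhSub _ t

theorem famExp_inv (t : 𝕜) (p : B) :
    NormedSpace.exp (t • -ad (κ p)) * famExp ad κ t p = 1 := by
  let _ : NormedAlgebra ℚ (D →L[𝕜] D) := NormedAlgebra.restrictScalars ℚ 𝕜 _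
  rw [famExp, ← NormedSpace.exp_add_of_commute (by simp [Commute, SemiconjBy])]
  simp

theorem famExp_mul_inv (t : 𝕜) (p : B) :
    famExp ad κ t p * NormedSpace.exp (t • -ad (κ p)) = 1 := by
  let _ : NormedAlgebra ℚ (D →L[𝕜] D) := NormedAlgebra.restrictScalars ℚ 𝕜 _
  rw [famExp, ← NormedSpace.exp_add_of_commute (by simp [Commute, SemiconjBy])]
  simp

/-- The derivative of `p ↦ exp (t ad_p)`. -/
theorem fderiv_famExp (hJ : ∀ X Y, ad (ad X Y) = ad X * ad Y - ad Y * ad X) (t : 𝕜) (p Y : B) :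
    fderiv 𝕜 (famExp ad κ t) p Y = ad (famExpDiv ad κ t p (κ Y)) * famExp ad κ t p := by
  set A := ad (κ p) with hA
  set K : 𝕜 → (D →L[𝕜] D) := fun t => fderiv 𝕜 (famExp ad κ t) p Y with hK
  set S : 𝕜 → (D →L[𝕜] D) := fun t => ad (famExpDiv ad κ t p (κ Y)) * famExp ad κ t p with hS
  have dK : ∀ t, HasDerivAt K (ad (κ Y) * famExp ad κ t p + A * K t) t := fun t => by
    refine (hasDerivAt_fderiv_swap (contDiff_famExp ad κ) hasDerivAt_famExp p Y t).congr_deriv ?_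
    have h1 : HasFDerivAt (fun q => ad (κ q)) (ad.comp κ) p := (ad.comp κ).hasFDerivAt
    have h2 := (differentiable_of_uncurry (contDiff_famExp ad κ) t p).hasFDerivAt
    have h3 : HasFDerivAt (fun q => ad (κ q) * famExp ad κ t q) _ p := h1.mul' h2
    rw [h3.fderiv]
    simp [hK, hA, add_comm]
  have dS : ∀ t, HasDerivAt S (ad (famExp ad κ t p (κ Y)) * famExp ad κ t p
      + ad (famExpDiv ad κ t p (κ Y)) * (A * famExp ad κ t p)) t := fun t => by
    have h1 : HasDerivAt (fun t => famExpDiv ad κ t p (κ Y)) (famExp ad κ t p (κ Y)) t :=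
      (hasDerivAt_famExpDiv t p).clm_apply (hasDerivAt_const t (κ Y)) |>.congr_deriv (by simp)
    exact (ad.hasFDerivAt.comp_hasDerivAt t h1).mul (hasDerivAt_famExp t p)
  -- `K` and `S` vanish at t = 0 and solve the same inhomogeneous linear equation X' = A X + ad(κ Y)
  -- E. Multiplying the difference by the integrating factor e^{-tA} makes it constant.
  have key : ∀ t, NormedSpace.exp (t • -A) * (K t - S t) = 0 := by
    refine eq_zero_of_hasDerivAt_zero (fun t => ?_) ?_
    · refine ((hasDerivAt_exp_smul_const (-A) t).mul ((dK t).sub (dS t))).congr_deriv ?_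
      -- Jacobi enters here: E(κ Y) - κ Y = A Θ(κ Y), so its `ad` is the commutator of `A` with `ad
      -- (Θ (κ Y))`.
      have e : A * S t = ad (famExp ad κ t p (κ Y) - κ Y) * famExp ad κ t p
          + ad (famExpDiv ad κ t p (κ Y)) * (A * famExp ad κ t p) := by
        have : famExp ad κ t p (κ Y) - κ Y = A (famExpDiv ad κ t p (κ Y)) := by
          rw [famExp_eq]; simp [hA]
        rw [this, hA, hJ]
        simp only [hS, sub_mul, mul_assoc]
        abel
      have e' : (-A) * (K t - S t) + (ad (κ Y) * famExp ad κ t p + A * K t -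
          (ad (famExp ad κ t p (κ Y)) * famExp ad κ t p
            + ad (famExpDiv ad κ t p (κ Y)) * (A * famExp ad κ t p))) = 0 := by
        rw [neg_mul, mul_sub, e, map_sub, sub_mul]
        abel
      rw [mul_assoc, ← mul_add]
      simp only [Pi.sub_apply]
      rw [e', mul_zero]
    · have h0 : famExp ad κ 0 = fun _ => 1 := by funext q; simp [famExp]
      simp [hK, hS, h0, famExpDiv]
  have h := congrArg (fun T => famExp ad κ t p * T) (key t)
  have hi : famExp ad κ t p * NormedSpace.exp (t • -A) = 1 := famExp_mul_inv t p
  simp only [mul_zero, ← mul_assoc, hi, one_mul] at h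
  exact sub_eq_zero.1 h

/-- The exponential of a derivation is an automorphism: e^{-tA} [e^{tA} x, e^{tA} y] has zero
t-derivative, by Jacobi. -/
theorem ad_famExp (hJ : ∀ X Y, ad (ad X Y) = ad X * ad Y - ad Y * ad X) (t : 𝕜) (p : B) (x y : D) :
    ad (famExp ad κ t p x) (famExp ad κ t p y) = famExp ad κ t p (ad x y) := by
  have dE : ∀ t x, HasDerivAt (fun t => famExp ad κ t p x) (ad (κ p) (famExp ad κ t p x)) t :=
    fun t x => (hasDerivAt_famExp t p).clm_apply (hasDerivAt_const t x)
      |>.congr_deriv (by simp)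
  have key : NormedSpace.exp (t • -ad (κ p)) (ad (famExp ad κ t p x) (famExp ad κ t p y))
      - ad x y = 0 := by
    refine eq_zero_of_hasDerivAt_zero (f := fun t => NormedSpace.exp (t • -ad (κ p))
      (ad (famExp ad κ t p x) (famExp ad κ t p y)) - ad x y) (fun t => ?_) ?_ t
    · have h1 := (ad.hasFDerivAt.comp_hasDerivAt t (dE t x)).clm_apply (dE t y)
      refine (((hasDerivAt_exp_smul_const (-ad (κ p)) t).clm_apply h1).sub_const
        (ad x y)).congr_deriv ?_
      rw [hJ]
      simp only [Function.comp, mul_apply_eq_comp, neg_apply, sub_apply, ← map_add]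
      rw [show ∀ u v w : D, -u + (u - v + v) = 0 from fun u v _ => by abel]
      · simp
      · exact 0
    · simp [famExp]
  have h := congrArg (famExp ad κ t p) (sub_eq_zero.1 key)
  rw [← mul_apply_eq_comp, famExp_mul_inv] at h
  simpa using h

/-- The Maurer–Cartan equation. -/
theorem maurerCartan (hJ : ∀ X Y, ad (ad X Y) = ad X * ad Y - ad Y * ad X)
    (hS : ∀ X Y, ad X Y = -ad Y X) (t : 𝕜) (p X Y : B) :
    fderiv 𝕜 (famExpDiv ad κ t) p X (κ Y) - fderiv 𝕜 (famExpDiv ad κ t) p Y (κ X)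
      = ad (famExpDiv ad κ t p (κ X)) (famExpDiv ad κ t p (κ Y)) := by
  rw [← sub_eq_zero]
  refine eq_zero_of_hasDerivAt_zero (f := fun t =>
    fderiv 𝕜 (famExpDiv ad κ t) p X (κ Y) - fderiv 𝕜 (famExpDiv ad κ t) p Y (κ X)
      - ad (famExpDiv ad κ t p (κ X)) (famExpDiv ad κ t p (κ Y))) (fun t => ?_) ?_ t
  · have h1 : ∀ Z, HasDerivAt (fun t => famExpDiv ad κ t p (κ Z)) (famExp ad κ t p (κ Z)) t :=
      fun Z => (hasDerivAt_famExpDiv t p).clm_apply (hasDerivAt_const t (κ Z))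
        |>.congr_deriv (by simp)
    have h2 : ∀ Z W, HasDerivAt (fun t => fderiv 𝕜 (famExpDiv ad κ t) p Z (κ W))
        (fderiv 𝕜 (famExp ad κ t) p Z (κ W)) t := fun Z W =>
      (hasDerivAt_fderiv_swap (contDiff_famExpDiv ad κ) hasDerivAt_famExpDiv p Z t).clm_apply
        (hasDerivAt_const t (κ W)) |>.congr_deriv (by simp)
    have h3 := (ad.hasFDerivAt.comp_hasDerivAt t (h1 X)).clm_apply (h1 Y)
    refine (((h2 X Y).sub (h2 Y X)).sub h3).congr_deriv ?_
    -- The t-derivative of Θ is E, and ∂_X E (κ Y) = [Θ κX, E κY], so the left side grows at the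
    -- rate [Θ κX, E κY] - [Θ κY, E κX], which is the rate of [Θ κX, Θ κY].
    rw [fderiv_famExp hJ, fderiv_famExp hJ]
    simp only [mul_apply_eq_comp, Function.comp]
    rw [hS (famExpDiv ad κ t p (κ Y)) (famExp ad κ t p (κ X))]
    abel
  · have h0 : famExpDiv ad κ 0 = fun _ => 0 := by funext q; simp [famExpDiv]
    simp [h0]

end AdFamilies

/-! ### Symmetric pairs with an invariant pairing -/

section SymmetricPair

variable {𝕜 B D : Type*} [RCLike 𝕜] [NormedAddCommGroup B] [NormedSpace 𝕜 B]
  [NormedAddCommGroup D] [NormedSpace 𝕜 D]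

/-- A Lie algebra `D` with an invariant symmetric pairing `b`, a map `κ` into an isotropic
subspace `Q`, and isotropic subspaces `P`, `N` such that `ad (κ p)` exchanges `P` and `Q`. -/
structure IsSymmetricPair (ad : D →L[𝕜] D →L[𝕜] D) (b : D →L[𝕜] D →L[𝕜] 𝕜) (κ : B →L[𝕜] D)
    (P Q N : Submodule 𝕜 D) : Prop where
  jacobi : ∀ X Y, ad (ad X Y) = ad X * ad Y - ad Y * ad X
  skew : ∀ X Y, ad X Y = -ad Y X
  symm : ∀ x y, b x y = b y x
  invariant : ∀ X x y, b (ad X x) y = -b x (ad X y)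
  mem_Q : ∀ p, κ p ∈ Q
  map_P : ∀ p, ∀ x ∈ P, ad (κ p) x ∈ Q
  map_Q : ∀ p, ∀ x ∈ Q, ad (κ p) x ∈ P
  isotropic_P : ∀ x ∈ P, ∀ y ∈ P, b x y = 0
  isotropic_Q : ∀ x ∈ Q, ∀ y ∈ Q, b x y = 0
  isotropic_N : ∀ x ∈ N, ∀ y ∈ N, b x y = 0
  orthogonal_PN : ∀ x ∈ P, ∀ y ∈ N, b x y = 0
  ad_mem_N : ∀ x ∈ N, ∀ y ∈ N, ad x y ∈ N

theorem fderiv_pairing {b : D →L[𝕜] D →L[𝕜] 𝕜} {f g : B → D →L[𝕜] D} {p : B}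
    (hf : DifferentiableAt 𝕜 f p) (hg : DifferentiableAt 𝕜 g p) (u v : D) (Y : B) :
    fderiv 𝕜 (fun q => b (f q u) (g q v)) p Y
      = b (fderiv 𝕜 f p Y u) (g p v) + b (f p u) (fderiv 𝕜 g p Y v) := by
  have h1 := hf.hasFDerivAt.clm_apply (hasFDerivAt_const u p)
  have h2 := hg.hasFDerivAt.clm_apply (hasFDerivAt_const v p)
  have h3 : HasFDerivAt (fun q => b (f q u) (g q v)) _ p :=
    (b.hasFDerivAt.comp p h1).clm_apply h2
  rw [h3.fderiv]
  simp [add_comm]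

/-- Product rule for a pairing with a constant vector. -/
theorem fderiv_pairing_const {b : D →L[𝕜] D →L[𝕜] 𝕜} {f : B → D →L[𝕜] D} {p : B}
    (hf : DifferentiableAt 𝕜 f p) (u v : D) (Y : B) :
    fderiv 𝕜 (fun q => b (f q u) v) p Y = b (fderiv 𝕜 f p Y u) v := by
  simpa using fderiv_pairing (b := b) hf (differentiableAt_const (1 : D →L[𝕜] D)) u v Y

namespace IsSymmetricPair

variable [FiniteDimensional 𝕜 D] [CompleteSpace D] {ad : D →L[𝕜] D →L[𝕜] D}
  {b : D →L[𝕜] D →L[𝕜] 𝕜} {κ : B →L[𝕜] D} {P Q N : Submodule 𝕜 D}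
  (h : IsSymmetricPair ad b κ P Q N) (t : 𝕜) (p : B)
include h

omit [CompleteSpace D] [FiniteDimensional 𝕜 D] in
theorem smul_map_P {x : D} (hx : x ∈ P) : (t • ad (κ p)) x ∈ Q := Q.smul_mem _ (h.map_P p x hx)

omit [CompleteSpace D] [FiniteDimensional 𝕜 D] in
theorem smul_map_Q {x : D} (hx : x ∈ Q) : (t • ad (κ p)) x ∈ P := P.smul_mem _ (h.map_Q p x hx)

theorem sinhDiv_mem_Q {x : D} (hx : x ∈ Q) : famSinhDiv ad κ t p x ∈ Q :=
  (expBounded_cSinhDiv 𝕜).mem_of_even (fun n hn => by simp [cSinhDiv, hn])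
    (fun _ => h.smul_map_Q t p) (fun _ => h.smul_map_P t p) hx

theorem coshDiv_mem_P {x : D} (hx : x ∈ Q) : famCoshDiv ad κ t p x ∈ P :=
  P.smul_mem _ ((expBounded_cCoshDiv 𝕜).mem_of_odd
    (fun n hn => by simp [cCoshDiv, Nat.not_odd_iff_even.2 hn])
    (fun _ => h.smul_map_Q t p) (fun _ => h.smul_map_P t p) hx)

omit [FiniteDimensional 𝕜 D] [CompleteSpace D] in
theorem smul_skewAdjoint (x y : D) : b ((t • ad (κ p)) x) y = -b x ((t • ad (κ p)) y) := by
  simp [h.invariant]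

omit [FiniteDimensional 𝕜 D] in
-- `ad (κ p)` is skew-adjoint for the pairing, so its even functions are self-adjoint and its odd
-- functions skew-adjoint.
theorem sinhDiv_adjoint (x y : D) :
    b (famSinhDiv ad κ t p x) y = b x (famSinhDiv ad κ t p y) := by
  have := (expBounded_cSinhDiv 𝕜).adjoint (h.smul_skewAdjoint t p) x y
  rwa [(expBounded_cSinhDiv 𝕜).neg_of_even (fun n hn => by simp [cSinhDiv, hn])] at this

omit [FiniteDimensional 𝕜 D] in
theorem coshDiv_adjoint (x y : D) :
    b (famCoshDiv ad κ t p x) y = -b x (famCoshDiv ad κ t p y) := by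
  have := (expBounded_cCoshDiv 𝕜).adjoint (h.smul_skewAdjoint t p) x y
  rw [(expBounded_cCoshDiv 𝕜).neg_of_odd
    (fun n hn => by simp [cCoshDiv, Nat.not_odd_iff_even.2 hn])] at this
  simp [famCoshDiv, this]

omit [FiniteDimensional 𝕜 D] in
theorem sinhSub_adjoint (x y : D) :
    b (famSinhSub ad κ t p x) y = -b x (famSinhSub ad κ t p y) := by
  have := (expBounded_cSinhSub 𝕜).adjoint (h.smul_skewAdjoint t p) x y
  rw [(expBounded_cSinhSub 𝕜).neg_of_odd
    (fun n hn => by simp [cSinhSub, Nat.not_odd_iff_even.2 hn])] at this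
  have h2 : b (opSinhSub (t • ad (κ p)) x) y = b x ((-opSinhSub (t • ad (κ p))) y) := this
  simp [famSinhSub, h2]

omit [CompleteSpace D] [FiniteDimensional 𝕜 D] h in
theorem commute_sinhDiv_coshDiv [CompleteSpace D] :
    Commute (famSinhDiv ad κ t p) (famCoshDiv ad κ t p) :=
  ((expBounded_cSinhDiv 𝕜).commute_entireCalc (expBounded_cCoshDiv 𝕜) _).smul_right t

omit [FiniteDimensional 𝕜 D] h in
theorem expDiv_eq_add : famExpDiv ad κ t p = t • famSinhDiv ad κ t p + famCoshDiv ad κ t p := by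
  rw [famExpDiv, expDiv_eq, smul_add]; rfl

/-- Split Θ into its even part, which preserves `Q`, and its odd part, which maps `Q` to `P`. Equal
parities pair to zero by isotropy; the mixed terms cancel because the parts commute and one is
self-adjoint, the other skew-adjoint. -/
theorem expDiv_isotropic (X Y : B) :
    b (famExpDiv ad κ t p (κ X)) (famExpDiv ad κ t p (κ Y)) = 0 := by
  have h1 := h.isotropic_Q _ (h.sinhDiv_mem_Q t p (h.mem_Q X)) _
    (h.sinhDiv_mem_Q t p (h.mem_Q Y))
  have h2 := h.isotropic_P _ (h.coshDiv_mem_P t p (h.mem_Q X)) _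
    (h.coshDiv_mem_P t p (h.mem_Q Y))
  have h3 := h.sinhDiv_adjoint t p (κ X) (famCoshDiv ad κ t p (κ Y))
  have h4 := h.coshDiv_adjoint t p (κ X) (famSinhDiv ad κ t p (κ Y))
  have h5 : famSinhDiv ad κ t p (famCoshDiv ad κ t p (κ Y))
      = famCoshDiv ad κ t p (famSinhDiv ad κ t p (κ Y)) :=
    congrArg (fun T => T (κ Y)) (commute_sinhDiv_coshDiv t p).eq
  rw [h5] at h3
  simp only [expDiv_eq_add, add_apply, smul_apply, map_add, map_smul, smul_eq_mul]
  linear_combination t * t * h1 + h2 + t * h3 + t * h4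

theorem expDiv_pairing (X Y : B) :
    b (famExpDiv ad κ t p (κ X)) (κ Y) = b (famCoshDiv ad κ t p (κ X)) (κ Y) := by
  have h1 := h.isotropic_Q _ (h.sinhDiv_mem_Q t p (h.mem_Q X)) _ (h.mem_Q Y)
  simp [expDiv_eq_add, h1]

theorem expDiv_pairing_skew (X Y : B) :
    b (famExpDiv ad κ t p (κ X)) (κ Y) = -b (famExpDiv ad κ t p (κ Y)) (κ X) := by
  rw [h.expDiv_pairing, h.expDiv_pairing, h.coshDiv_adjoint, h.symm]

omit [FiniteDimensional 𝕜 D] in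
-- Moving e^{tA} to the other side as e^{-tA} turns (e^{tA} - 1)/A into (1 - e^{-tA})/A, whose odd
-- part has the opposite sign. For x in `Q` the even part then drops out, for x in `N` the odd part
-- does.
theorem expDiv_pairing_exp (X : B) (x : D) :
    b (famExpDiv ad κ t p (κ X)) (famExp ad κ t p x)
      = t • b (famSinhDiv ad κ t p (κ X)) x - b (famCoshDiv ad κ t p (κ X)) x := by
  have h1 := (expBounded_cExp 𝕜).adjoint (h.smul_skewAdjoint t p) x (famExpDiv ad κ t p (κ X))
  have h2 : entireCalc (cExp 𝕜) (-(t • ad (κ p))) (entireCalc (cExpDiv 𝕜) (t • ad (κ p)) (κ X))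
      = entireCalc (cExpDiv 𝕜) (-(t • ad (κ p))) (κ X) := by
    have := exp_mul_expDiv_neg (-(t • ad (κ p)))
    rw [neg_neg, exp_eq_entireCalc] at this
    exact congrArg (fun T => T (κ X)) this
  rw [famExp, exp_eq_entireCalc, h.symm, h1, famExpDiv, smul_apply, map_smul, h2, expDiv_neg,
    h.symm]
  simp [famSinhDiv, famCoshDiv, mul_sub]

theorem expDiv_pairing_exp_Q (X Y : B) :
    b (famExpDiv ad κ t p (κ X)) (famExp ad κ t p (κ Y)) = -b (famExpDiv ad κ t p (κ X)) (κ Y) := by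
  rw [h.expDiv_pairing_exp, h.expDiv_pairing,
    h.isotropic_Q _ (h.sinhDiv_mem_Q t p (h.mem_Q X)) _ (h.mem_Q Y)]
  simp

theorem expDiv_pairing_exp_N (X : B) {x : D} (hx : x ∈ N) :
    b (famExpDiv ad κ t p (κ X)) (famExp ad κ t p x) = t • b (famSinhDiv ad κ t p (κ X)) x := by
  rw [h.expDiv_pairing_exp, h.orthogonal_PN _ (h.coshDiv_mem_P t p (h.mem_Q X)) _ hx, sub_zero]

omit [FiniteDimensional 𝕜 D] in
theorem exp_isometry (x y : D) : b (famExp ad κ t p x) (famExp ad κ t p y) = b x y := by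
  have h1 := (expBounded_cExp 𝕜).adjoint (h.smul_skewAdjoint t p) x (famExp ad κ t p y)
  rw [← exp_eq_entireCalc, ← exp_eq_entireCalc] at h1
  refine h1.trans ?_
  have h2 := congrArg (fun T => T y) (famExp_inv (ad := ad) (κ := κ) t p)
  simp only [smul_neg] at h2
  exact congrArg (b x) h2

omit [FiniteDimensional 𝕜 D] [CompleteSpace D] in
theorem invariant_cyc (x y z : D) : b (ad x y) z = b (ad y z) x := by
  rw [h.skew x y, h.symm (ad y z)]
  have := h.invariant y x z
  simp [this]

/-- `b([Θγ, Θα], E β) = b(∂_γ Θ α, β) - b(∂_α Θ γ, β)`. -/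
theorem ad_expDiv_pairing_exp (X Y Z : B) :
    b (ad (famExpDiv ad κ t p (κ Z)) (famExpDiv ad κ t p (κ X))) (famExp ad κ t p (κ Y))
      = b (fderiv 𝕜 (famExpDiv ad κ t) p Z (κ X)) (κ Y)
        - b (fderiv 𝕜 (famExpDiv ad κ t) p X (κ Z)) (κ Y) := by
  have hd := differentiable_of_uncurry (contDiff_famExpDiv ad κ) t p
  have he := differentiable_of_uncurry (contDiff_famExp ad κ) t p
  have key : ∀ X Z, b (fderiv 𝕜 (famExpDiv ad κ t) p Z (κ X)) (famExp ad κ t p (κ Y))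
      - b (ad (famExpDiv ad κ t p (κ Z)) (famExpDiv ad κ t p (κ X))) (famExp ad κ t p (κ Y))
      = -b (fderiv 𝕜 (famExpDiv ad κ t) p Z (κ X)) (κ Y) := fun X Z => by
    -- Differentiating this identity along Z yields one derivative of Θ; Maurer–Cartan then relates
    -- the versions with X and Z exchanged.
    have h1 : (fun q => b (famExpDiv ad κ t q (κ X)) (famExp ad κ t q (κ Y)))
        = fun q => -b (famExpDiv ad κ t q (κ X)) (κ Y) :=
      funext fun q => h.expDiv_pairing_exp_Q t q X Y
    have h2 := congrArg (fun f => fderiv 𝕜 f p Z) h1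
    simp only [fderiv_pairing hd he] at h2
    rw [fderiv_fun_neg, neg_apply, fderiv_pairing_const hd, fderiv_famExp h.jacobi,
      mul_apply_eq_comp] at h2
    rw [h.invariant]
    linear_combination h2
  have hMC := congrArg (fun v => b v (famExp ad κ t p (κ Y))) (maurerCartan (ad := ad) (κ := κ)
    h.jacobi h.skew t p Z X)
  simp only [map_sub, sub_apply] at hMC
  have h3 := congrArg (fun v => b v (famExp ad κ t p (κ Y)))
    (h.skew (famExpDiv ad κ t p (κ X)) (famExpDiv ad κ t p (κ Z)))
  simp only [map_neg, neg_apply] at h3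
  linear_combination hMC - key X Z + key Z X + h3

theorem fderiv_expDiv_skew (X Y Z : B) :
    b (fderiv 𝕜 (famExpDiv ad κ t) p Z (κ X)) (κ Y)
      = -b (fderiv 𝕜 (famExpDiv ad κ t) p Z (κ Y)) (κ X) := by
  have hd := differentiable_of_uncurry (contDiff_famExpDiv ad κ) t p
  have h1 : (fun q => b (famExpDiv ad κ t q (κ X)) (κ Y))
      = fun q => -b (famExpDiv ad κ t q (κ Y)) (κ X) :=
    funext fun q => h.expDiv_pairing_skew t q X Y
  have h2 := congrArg (fun f => fderiv 𝕜 f p Z) h1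
  simp only [fderiv_pairing_const hd] at h2
  rwa [fderiv_fun_neg, neg_apply, fderiv_pairing_const hd] at h2

/-- The t-derivative of `famSinhSub` is `famCoshDiv`; against vectors of `Q` it may be replaced by
Θ, to which Maurer–Cartan applies. -/
theorem fderiv_coshDiv_pairing (X Y Z : B) :
    b (fderiv 𝕜 (famCoshDiv ad κ t) p Z (κ X)) (κ Y)
      = b (fderiv 𝕜 (famExpDiv ad κ t) p Z (κ X)) (κ Y) := by
  have hd := differentiable_of_uncurry (contDiff_famExpDiv ad κ) t p
  have hc := differentiable_of_uncurry (contDiff_famCoshDiv ad κ) t p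
  rw [← fderiv_pairing_const hd, ← fderiv_pairing_const hc]
  congr 2
  funext q
  exact (h.expDiv_pairing t q X Y).symm

/-- The two-form `b(Ze ·, ·)` is a primitive of half of the Cartan three-form. -/
theorem two_mul_cyclic_sinhSub (X Y Z : B) :
    2 * (b (fderiv 𝕜 (famSinhSub ad κ t) p X (κ Y)) (κ Z)
      + b (fderiv 𝕜 (famSinhSub ad κ t) p Y (κ Z)) (κ X)
      + b (fderiv 𝕜 (famSinhSub ad κ t) p Z (κ X)) (κ Y))
      = b (ad (famExpDiv ad κ t p (κ X)) (famExpDiv ad κ t p (κ Y))) (famExpDiv ad κ t p (κ Z)) := by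
  rw [← sub_eq_zero]
  refine eq_zero_of_hasDerivAt_zero (f := fun t =>
    2 * (b (fderiv 𝕜 (famSinhSub ad κ t) p X (κ Y)) (κ Z)
      + b (fderiv 𝕜 (famSinhSub ad κ t) p Y (κ Z)) (κ X)
      + b (fderiv 𝕜 (famSinhSub ad κ t) p Z (κ X)) (κ Y))
      - b (ad (famExpDiv ad κ t p (κ X)) (famExpDiv ad κ t p (κ Y))) (famExpDiv ad κ t p (κ Z)))
    (fun t => ?_) ?_ t
  · have h1 : ∀ Z, HasDerivAt (fun t => famExpDiv ad κ t p (κ Z)) (famExp ad κ t p (κ Z)) t :=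
      fun Z => (hasDerivAt_famExpDiv t p).clm_apply (hasDerivAt_const t (κ Z))
        |>.congr_deriv (by simp)
    have h2 : ∀ X Y Z, HasDerivAt (fun t => b (fderiv 𝕜 (famSinhSub ad κ t) p X (κ Y)) (κ Z))
        (b (fderiv 𝕜 (famExpDiv ad κ t) p X (κ Y)) (κ Z)) t := fun X Y Z => by
      have h3 := (hasDerivAt_fderiv_swap (contDiff_famSinhSub ad κ) hasDerivAt_famSinhSub p X t)
      rw [← h.fderiv_coshDiv_pairing]
      have h4 := (b.flip (κ Z)).hasFDerivAt.comp_hasDerivAt t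
        (h3.clm_apply (hasDerivAt_const t (κ Y)))
      refine h4.congr_deriv ?_
      simp
    have h5 := (b.hasFDerivAt.comp_hasDerivAt t
      ((ad.hasFDerivAt.comp_hasDerivAt t (h1 X)).clm_apply (h1 Y))).clm_apply (h1 Z)
    refine (((((h2 X Y Z).add (h2 Y Z X)).add (h2 Z X Y)).const_mul 2).sub h5).congr_deriv ?_
    simp only [Function.comp, map_add, add_apply]
    -- Differentiating the three-form in t puts one E in each of three terms. Each becomes a
    -- difference of derivatives of b(Θ·, ·), and by skewness each cyclic derivative occurs twice,
    -- whence the factor 2.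
    have a1 := h.ad_expDiv_pairing_exp t p Y Z X
    have a2 := h.ad_expDiv_pairing_exp t p Z X Y
    have a3 := h.ad_expDiv_pairing_exp t p X Y Z
    have s1 := h.fderiv_expDiv_skew t p X Z Y
    have s2 := h.fderiv_expDiv_skew t p Y X Z
    have s3 := h.fderiv_expDiv_skew t p Z Y X
    have c1 := h.invariant_cyc (famExp ad κ t p (κ X)) (famExpDiv ad κ t p (κ Y))
      (famExpDiv ad κ t p (κ Z))
    have c2 := h.invariant_cyc (famExpDiv ad κ t p (κ Z)) (famExpDiv ad κ t p (κ X))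
      (famExp ad κ t p (κ Y))
    linear_combination -c1 + c2 - a1 - a2 - a3 + s1 + s2 + s3
  · have h0 : famExpDiv ad κ 0 = fun _ => 0 := by funext q; simp [famExpDiv]
    have h1 : famSinhSub ad κ 0 = fun _ => 0 := by funext q; simp [famSinhSub]
    simp [h0, h1]

/-- A Koszul argument, as for the Levi-Civita connection. The expression b(∂_X Θ Y, Θ Z) is skew in
Y, Z because Θ has isotropic image on `κ`, and its skew part in X, Y is the Cartan three-form by
Maurer–Cartan. These two facts determine it. -/
theorem two_mul_fderiv_expDiv (X Y Z : B) :
    2 * b (fderiv 𝕜 (famExpDiv ad κ t) p X (κ Y)) (famExpDiv ad κ t p (κ Z))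
      = b (ad (famExpDiv ad κ t p (κ X)) (famExpDiv ad κ t p (κ Y))) (famExpDiv ad κ t p (κ Z)) := by
  have hd := differentiable_of_uncurry (contDiff_famExpDiv ad κ) t p
  have skew : ∀ X Y Z, b (fderiv 𝕜 (famExpDiv ad κ t) p X (κ Y)) (famExpDiv ad κ t p (κ Z))
      = -b (fderiv 𝕜 (famExpDiv ad κ t) p X (κ Z)) (famExpDiv ad κ t p (κ Y)) := fun X Y Z => by
    have h1 : (fun q => b (famExpDiv ad κ t q (κ Y)) (famExpDiv ad κ t q (κ Z)))
        = fun q => 0 := funext fun q => h.expDiv_isotropic t q Y Z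
    have h2 := congrArg (fun f => fderiv 𝕜 f p X) h1
    simp only [fderiv_pairing hd hd] at h2
    simp only [fderiv_const_apply, zero_apply] at h2
    rw [h.symm (famExpDiv ad κ t p (κ Y))] at h2
    linear_combination h2
  have hMC := fun X Y Z => congrArg (fun v => b v (famExpDiv ad κ t p (κ Z)))
    (maurerCartan (ad := ad) (κ := κ) h.jacobi h.skew t p X Y)
  simp only [map_sub, sub_apply] at hMC
  have c2 := h.invariant_cyc (famExpDiv ad κ t p (κ Y)) (famExpDiv ad κ t p (κ Z))
    (famExpDiv ad κ t p (κ X))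
  linear_combination hMC X Y Z - hMC Y Z X + hMC Z X Y + skew Y X Z - skew Z Y X + skew X Z Y - c2

/-- Differentiate `expDiv_pairing_exp_N` along Y, where ∂_Y E contributes ad(Θ κY) E, and use
Maurer–Cartan to exchange X and Y; the bracket terms cancel by invariance. -/
theorem fderiv_expDiv_pairing_exp (X Y : B) {x : D} (hx : x ∈ N) :
    b (fderiv 𝕜 (famExpDiv ad κ t) p X (κ Y)) (famExp ad κ t p x)
      = t • b (fderiv 𝕜 (famSinhDiv ad κ t) p Y x) (κ X) := by
  have hd := differentiable_of_uncurry (contDiff_famExpDiv ad κ) t p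
  have he := differentiable_of_uncurry (contDiff_famExp ad κ) t p
  have hs := differentiable_of_uncurry (contDiff_famSinhDiv ad κ) t p
  have h1 : (fun q => b (famExpDiv ad κ t q (κ X)) (famExp ad κ t q x))
      = fun q => t • b (famSinhDiv ad κ t q x) (κ X) := funext fun q => by
    rw [h.expDiv_pairing_exp_N t q X hx, h.sinhDiv_adjoint, h.symm]
  have h2 := congrArg (fun f => fderiv 𝕜 f p Y) h1
  simp only [fderiv_pairing hd he] at h2
  rw [fderiv_fun_const_smul (by
    exact ((b.flip (κ X)).differentiableAt.comp p (hs.clm_apply (differentiableAt_const x)))),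
    smul_apply, fderiv_pairing_const hs, fderiv_famExp h.jacobi, mul_apply_eq_comp] at h2
  have hMC := congrArg (fun v => b v (famExp ad κ t p x))
    (maurerCartan (ad := ad) (κ := κ) h.jacobi h.skew t p X Y)
  simp only [map_sub, sub_apply] at hMC
  have h3 := congrArg (fun v => b v (famExp ad κ t p x))
    (h.skew (famExpDiv ad κ t p (κ X)) (famExpDiv ad κ t p (κ Y)))
  simp only [map_neg, neg_apply] at h3
  have h4 := h.invariant (famExpDiv ad κ t p (κ Y)) (famExpDiv ad κ t p (κ X)) (famExp ad κ t p x)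
  linear_combination hMC + h2 + h3 - h4

/-- As ∂_Y E = ad(Θ κY) E, invariance and the automorphism property reduce the pairing to b(Θ κY, E
[x, x']), and [x, x'] is again in `N`. -/
theorem fderiv_exp_pairing_exp (Y : B) {x x' : D} (hx : x ∈ N) (hx' : x' ∈ N) :
    b (fderiv 𝕜 (famExp ad κ t) p Y x) (famExp ad κ t p x')
      = t • b (famSinhDiv ad κ t p (ad x x')) (κ Y) := by
  rw [fderiv_famExp h.jacobi, mul_apply_eq_comp, h.invariant_cyc, ad_famExp h.jacobi, h.symm,
    h.expDiv_pairing_exp_N t p Y (h.ad_mem_N _ hx _ hx'), h.sinhDiv_adjoint, h.symm]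

theorem fderiv_exp_pairing_expDiv (X Y : B) {x : D} (hx : x ∈ N) :
    b (fderiv 𝕜 (famExp ad κ t) p Y x) (famExpDiv ad κ t p (κ X))
      = t • b (fderiv 𝕜 (famSinhDiv ad κ t) p Y x) (κ X)
        - t • b (fderiv 𝕜 (famSinhDiv ad κ t) p X x) (κ Y) := by
  have hd := differentiable_of_uncurry (contDiff_famExpDiv ad κ) t p
  have he := differentiable_of_uncurry (contDiff_famExp ad κ) t p
  have hs := differentiable_of_uncurry (contDiff_famSinhDiv ad κ) t p
  have h1 : (fun q => b (famExp ad κ t q x) (famExpDiv ad κ t q (κ X)))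
      = fun q => t • b (famSinhDiv ad κ t q x) (κ X) := funext fun q => by
    rw [h.symm, h.expDiv_pairing_exp_N t q X hx, h.sinhDiv_adjoint, h.symm]
  have h2 := congrArg (fun f => fderiv 𝕜 f p Y) h1
  simp only [fderiv_pairing he hd] at h2
  rw [fderiv_fun_const_smul (by
    exact ((b.flip (κ X)).differentiableAt.comp p (hs.clm_apply (differentiableAt_const x)))),
    smul_apply, fderiv_pairing_const hs, h.symm (famExp ad κ t p x),
    h.fderiv_expDiv_pairing_exp t p Y X hx] at h2
  linear_combination h2

omit [FiniteDimensional 𝕜 D] in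
theorem fderiv_sinhSub_skew (X Y Z : B) :
    b (fderiv 𝕜 (famSinhSub ad κ t) p Z (κ X)) (κ Y)
      = -b (fderiv 𝕜 (famSinhSub ad κ t) p Z (κ Y)) (κ X) := by
  have hd := differentiable_of_uncurry (contDiff_famSinhSub ad κ) t p
  have h1 : (fun q => b (famSinhSub ad κ t q (κ X)) (κ Y))
      = fun q => -b (famSinhSub ad κ t q (κ Y)) (κ X) :=
    funext fun q => by rw [h.sinhSub_adjoint, h.symm]
  have h2 := congrArg (fun f => fderiv 𝕜 f p Z) h1
  simp only [fderiv_pairing_const hd] at h2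
  rwa [fderiv_fun_neg, neg_apply, fderiv_pairing_const hd] at h2

/-- The Dorfman-type identity behind the first component of the bracket. -/
theorem dorfman_identity (X X' Y : B) {x x' : D} (hx : x ∈ N) (hx' : x' ∈ N) :
    b (fderiv 𝕜 (famSinhSub ad κ 1) p X (κ X') - fderiv 𝕜 (famSinhDiv ad κ 1) p X x') (κ Y)
      - b (fderiv 𝕜 (famSinhSub ad κ 1) p X' (κ X) - fderiv 𝕜 (famSinhDiv ad κ 1) p X' x) (κ Y)
      + b (fderiv 𝕜 (famSinhSub ad κ 1) p Y (κ X) - fderiv 𝕜 (famSinhDiv ad κ 1) p Y x) (κ X')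
      - b (fderiv 𝕜 (famExpDiv ad κ 1) p Y (κ X) - fderiv 𝕜 (famExp ad κ 1) p Y x)
          (famExpDiv ad κ 1 p (κ X') - famExp ad κ 1 p x')
      + b (famSinhDiv ad κ 1 p (ad x x')) (κ Y) = 0 := by
  have a1 := h.two_mul_cyclic_sinhSub 1 p X X' Y
  have a2 := h.two_mul_fderiv_expDiv 1 p Y X X'
  have a3 := h.fderiv_sinhSub_skew 1 p Y X X'
  have a4 := h.invariant_cyc (famExpDiv ad κ 1 p (κ Y)) (famExpDiv ad κ 1 p (κ X))
    (famExpDiv ad κ 1 p (κ X'))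
  have a5 := h.fderiv_expDiv_pairing_exp 1 p Y X hx'
  have a6 := h.fderiv_exp_pairing_exp 1 p Y hx hx'
  have a7 := h.fderiv_exp_pairing_expDiv 1 p X' Y hx
  have two : (2 : 𝕜) ≠ 0 := two_ne_zero
  simp only [one_smul] at a5 a6 a7
  simp only [map_sub, sub_apply]
  rw [← mul_right_inj' two, mul_zero]
  linear_combination a1 - a2 - a4 - 2 * a3 + 2 * a5 - 2 * a6 + 2 * a7

end IsSymmetricPair

/-- Gauge transformation by `exp (ad_p)`. -/
theorem gauge_bracket [CompleteSpace D] {ad : D →L[𝕜] D →L[𝕜] D} {κ : B →L[𝕜] D}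
    (hJ : ∀ X Y, ad (ad X Y) = ad X * ad Y - ad Y * ad X)
    (hS : ∀ X Y, ad X Y = -ad Y X) {a a' : B → B} {x x' : B → D} {p : B}
    (ha : DifferentiableAt 𝕜 a p) (ha' : DifferentiableAt 𝕜 a' p)
    (hx : DifferentiableAt 𝕜 x p) (hx' : DifferentiableAt 𝕜 x' p) :
    fderiv 𝕜 (fun q => famExpDiv ad κ 1 q (κ (a' q)) - famExp ad κ 1 q (x' q)) p (a p)
      - fderiv 𝕜 (fun q => famExpDiv ad κ 1 q (κ (a q)) - famExp ad κ 1 q (x q)) p (a' p)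
      - ad (famExpDiv ad κ 1 p (κ (a p)) - famExp ad κ 1 p (x p))
          (famExpDiv ad κ 1 p (κ (a' p)) - famExp ad κ 1 p (x' p))
      = famExpDiv ad κ 1 p (κ (fderiv 𝕜 a' p (a p) - fderiv 𝕜 a p (a' p)))
        - famExp ad κ 1 p (fderiv 𝕜 x' p (a p) - fderiv 𝕜 x p (a' p) + ad (x p) (x' p)) := by
  have hd := differentiable_of_uncurry (contDiff_famExpDiv ad κ) 1 p
  have he := differentiable_of_uncurry (contDiff_famExp ad κ) 1 p
  have key : ∀ {a : B → B} {x : B → D}, DifferentiableAt 𝕜 a p → DifferentiableAt 𝕜 x p →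
      ∀ Y, fderiv 𝕜 (fun q => famExpDiv ad κ 1 q (κ (a q)) - famExp ad κ 1 q (x q)) p Y
        = fderiv 𝕜 (famExpDiv ad κ 1) p Y (κ (a p)) + famExpDiv ad κ 1 p (κ (fderiv 𝕜 a p Y))
          - (ad (famExpDiv ad κ 1 p (κ Y)) (famExp ad κ 1 p (x p))
            + famExp ad κ 1 p (fderiv 𝕜 x p Y)) := fun {a x} ha hx Y => by
    have h1 : HasFDerivAt (fun q => κ (a q)) (κ.comp (fderiv 𝕜 a p)) p :=
      κ.hasFDerivAt.comp p ha.hasFDerivAt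
    have h2 := (hd.hasFDerivAt.clm_apply h1).sub (he.hasFDerivAt.clm_apply hx.hasFDerivAt)
    have h3 : HasFDerivAt
      (fun q => famExpDiv ad κ 1 q (κ (a q)) - famExp ad κ 1 q (x q)) _ p := h2
    rw [h3.fderiv]
    have h4 := congrArg (fun T => T (x p)) (fderiv_famExp (ad := ad) (κ := κ) hJ 1 p Y)
    simp only [mul_apply_eq_comp] at h4
    simp [h4, add_comm]
  rw [key ha' hx', key ha hx]
  -- Maurer–Cartan absorbs the Θ–Θ bracket, the automorphism property the E–E bracket, and the mixed
  -- brackets cancel against the derivatives of E.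
  have hMC := maurerCartan (ad := ad) (κ := κ) hJ hS 1 p (a p) (a' p)
  have h1 := ad_famExp (κ := κ) hJ 1 p (x p) (x' p)
  have h2 := hS (famExp ad κ 1 p (x p)) (famExpDiv ad κ 1 p (κ (a' p)))
  simp only [map_sub, map_add, sub_apply, ← h1, ← hMC, h2]
  abel

end SymmetricPair

/-! ### Complexification and invertibility -/

section Complexification

theorem continuous_toComplexHom (𝕜 : Type*) [RCLike 𝕜] : Continuous (toComplexHom 𝕜) :=
  Complex.equivRealProdCLM.symm.continuous.comp
    (RCLike.continuous_re.prodMk RCLike.continuous_im)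

theorem norm_toComplexHom {𝕜 : Type*} [RCLike 𝕜] (z : 𝕜) : ‖toComplexHom 𝕜 z‖ = ‖z‖ := by
  have h : ‖toComplexHom 𝕜 z‖ ^ 2 = ‖z‖ ^ 2 := by
    rw [← Complex.normSq_eq_norm_sq, ← RCLike.normSq_eq_def', Complex.normSq_apply,
      RCLike.normSq_apply]
    rfl
  exact (sq_eq_sq₀ (norm_nonneg _) (norm_nonneg _)).1 h

variable {𝕜 E : Type*} [RCLike 𝕜] [NormedAddCommGroup E] [NormedSpace 𝕜 E]
  [FiniteDimensional 𝕜 E]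

/-- The complexified matrix of an endomorphism, as a ring homomorphism. -/
def complexMatrix (𝕜 E : Type*) [RCLike 𝕜] [NormedAddCommGroup E] [NormedSpace 𝕜 E]
    [FiniteDimensional 𝕜 E] :
    (E →L[𝕜] E) →+* Matrix (Fin (Module.finrank 𝕜 E)) (Fin (Module.finrank 𝕜 E)) ℂ :=
  ((toComplexHom 𝕜).mapMatrix.comp
    (LinearMap.toMatrixAlgEquiv (Module.finBasis 𝕜 E)).toRingEquiv.toRingHom).comp
    ContinuousLinearMap.toLinearMapRingHom

theorem complexMatrix_apply (A : E →L[𝕜] E) : complexMatrix 𝕜 E A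
    = (LinearMap.toMatrix (Module.finBasis 𝕜 E) (Module.finBasis 𝕜 E)
        (A : E →ₗ[𝕜] E)).map (toComplexHom 𝕜) := rfl

theorem complexMatrix_smul (c : 𝕜) (A : E →L[𝕜] E) :
    complexMatrix 𝕜 E (c • A) = toComplexHom 𝕜 c • complexMatrix 𝕜 E A := by
  ext i j
  simp [complexMatrix_apply]

theorem continuous_complexMatrix : Continuous (complexMatrix 𝕜 E) := by
  refine continuous_matrix fun i j => ?_
  have h : (fun A => complexMatrix 𝕜 E A i j) = fun A : E →L[𝕜] E =>
      toComplexHom 𝕜 ((Module.finBasis 𝕜 E).coord i (A (Module.finBasis 𝕜 E j))) := by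
    funext A
    simp [complexMatrix_apply, LinearMap.toMatrix_apply]
  rw [h]
  exact (continuous_toComplexHom 𝕜).comp
    ((LinearMap.continuous_of_finiteDimensional _).comp
      (ContinuousLinearMap.apply 𝕜 E (Module.finBasis 𝕜 E j)).continuous)

theorem isUnit_iff_isUnit_det (A : E →L[𝕜] E) :
    IsUnit A ↔ IsUnit (LinearMap.det (A : E →ₗ[𝕜] E)) := by
  have := FiniteDimensional.complete 𝕜 E
  rw [← LinearMap.isUnit_iff_isUnit_det, ContinuousLinearMap.isUnit_iff_bijective,
    Module.End.isUnit_iff]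
  rfl

/-- Invertibility is detected by the determinant, which commutes with the injective field
homomorphism into ℂ. -/
theorem isUnit_complexMatrix_iff (A : E →L[𝕜] E) : IsUnit (complexMatrix 𝕜 E A) ↔ IsUnit A := by
  rw [Matrix.isUnit_iff_isUnit_det, isUnit_iff_isUnit_det,
    ← LinearMap.det_toMatrix (Module.finBasis 𝕜 E), complexMatrix_apply]
  have : (Matrix.map (LinearMap.toMatrix (Module.finBasis 𝕜 E) (Module.finBasis 𝕜 E)
      (A : E →ₗ[𝕜] E)) (toComplexHom 𝕜)).det = toComplexHom 𝕜 _ :=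
    ((toComplexHom 𝕜).map_det _).symm
  rw [this, isUnit_iff_ne_zero, isUnit_iff_ne_zero, map_ne_zero]

/-- The complexification of an endomorphism. -/
def complexify (𝕜 E : Type*) [RCLike 𝕜] [NormedAddCommGroup E] [NormedSpace 𝕜 E]
    [FiniteDimensional 𝕜 E] (A : E →L[𝕜] E) :
    (Fin (Module.finrank 𝕜 E) → ℂ) →L[ℂ] (Fin (Module.finrank 𝕜 E) → ℂ) :=
  LinearMap.toContinuousLinearMap (Matrix.toLin' (complexMatrix 𝕜 E A))

theorem complexify_pow (A : E →L[𝕜] E) (n : ℕ) :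
    complexify 𝕜 E (A ^ n) = complexify 𝕜 E A ^ n := by
  ext1 v
  have : ∀ v, complexify 𝕜 E (A ^ n) v = (complexify 𝕜 E A ^ n) v := by
    induction n with
    | zero => intro v; simp [complexify]
    | succ n ih =>
      intro v
      rw [pow_succ (complexify 𝕜 E A), mul_apply_eq_comp, ← ih]
      simp [complexify, pow_succ]
  exact this v

/-- Complexification turns roots of a possibly real characteristic polynomial into eigenvalues with
actual eigenvectors. -/
theorem mem_complexSpectrum_iff (A : E →L[𝕜] E) (μ : ℂ) : μ ∈ complexSpectrum A ↔
    Module.End.HasEigenvalue (complexify 𝕜 E A : Module.End ℂ (Fin (Module.finrank 𝕜 E) → ℂ)) μ := by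
  have h : (complexify 𝕜 E A : Module.End ℂ (Fin (Module.finrank 𝕜 E) → ℂ))
      = Matrix.toLin' (complexMatrix 𝕜 E A) := rfl
  rw [Module.End.hasEigenvalue_iff_isRoot_charpoly, h, Matrix.charpoly_toLin', complexMatrix_apply]
  have h2 : (Matrix.map (LinearMap.toMatrix (Module.finBasis 𝕜 E) (Module.finBasis 𝕜 E)
      (A : E →ₗ[𝕜] E)) (toComplexHom 𝕜)).charpoly
      = (LinearMap.charpoly (A : E →ₗ[𝕜] E)).map (toComplexHom 𝕜) := by
    rw [← LinearMap.charpoly_toMatrix (A : E →ₗ[𝕜] E) (Module.finBasis 𝕜 E)]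
    exact Matrix.charpoly_map _ _
  rw [h2, Polynomial.IsRoot.def, Polynomial.eval_map]
  rfl

theorem isUnit_complexify_iff (A : E →L[𝕜] E) : IsUnit (complexify 𝕜 E A) ↔ IsUnit A := by
  rw [isUnit_iff_isUnit_det, ← isUnit_complexMatrix_iff, Matrix.isUnit_iff_isUnit_det,
    ← LinearMap.det_toLin']
  rfl

/-- The complexified matrix is a continuous ring homomorphism, semilinear over the scalar embedding,
so it passes through the series. -/
theorem ExpBounded.complexify {c : ℕ → 𝕜} (hc : ExpBounded c) (A : E →L[𝕜] E) :
    complexify 𝕜 E (entireCalc c A)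
      = entireCalc (fun n => toComplexHom 𝕜 (c n)) (complexify 𝕜 E A) := by
  have := FiniteDimensional.complete 𝕜 E
  have hc' : ExpBounded (fun n => toComplexHom 𝕜 (c n)) := fun n => by
    rw [norm_toComplexHom]; exact hc n
  ext1 v
  have h1 := (hc.hasSum A).map (complexMatrix 𝕜 E).toAddMonoidHom continuous_complexMatrix
  have h2 := h1.map (AddMonoidHom.mk' (fun M : Matrix _ _ ℂ =>
    M.mulVec v) (fun M N => Matrix.add_mulVec M N _))
    (continuous_id.matrix_mulVec continuous_const)
  refine HasSum.unique h2 ((hc'.hasSum_apply (_root_.complexify 𝕜 E A) v).congr_fun fun n => ?_)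
  rw [← complexify_pow]
  change (complexMatrix 𝕜 E (c n • A ^ n)).mulVec v = _
  rw [complexMatrix_smul, Matrix.smul_mulVec]
  rfl

end Complexification

/-! ### Spectral mapping for entire functions. -/

section Spectrum

variable {W : Type*} [NormedAddCommGroup W] [NormedSpace ℂ W] [FiniteDimensional ℂ W]

theorem ExpBounded.summable_scalar {c : ℕ → ℂ} (hc : ExpBounded c) (μ : ℂ) :
    Summable fun n => c n * μ ^ n :=
  Summable.of_norm_bounded (summable_pow_div_factorial ‖μ‖) fun n => by
    rw [norm_mul, norm_pow]
    exact mul_le_mul_of_nonneg_right (hc n) (by positivity)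

theorem ExpBounded.apply_eigenvector {c : ℕ → ℂ} (hc : ExpBounded c) {A : W →L[ℂ] W} {μ : ℂ}
    {v : W} (hv : A v = μ • v) : entireCalc c A v = (∑' n, c n * μ ^ n) • v := by
  have := FiniteDimensional.complete ℂ W
  refine (hc.hasSum_apply A v).unique (((hc.summable_scalar μ).hasSum.smul_const v).congr_fun
    fun n => ?_)
  have : (A ^ n) v = μ ^ n • v := by
    induction n with
    | zero => simp
    | succ n ih => rw [pow_succ, mul_apply_eq_comp, hv, map_smul, ih, smul_smul, pow_succ, mul_comm]
  rw [this, smul_smul]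

/-- Spectral mapping, at the level of invertibility. -/
theorem ExpBounded.isUnit_iff {c : ℕ → ℂ} (hc : ExpBounded c) (A : W →L[ℂ] W) :
    IsUnit (entireCalc c A)
      ↔ ∀ μ, Module.End.HasEigenvalue (A : Module.End ℂ W) μ → ∑' n, c n * μ ^ n ≠ 0 := by
  have := FiniteDimensional.complete ℂ W
  constructor
  · intro hu μ hμ h0
    obtain ⟨v, hv⟩ := hμ.exists_hasEigenvector
    have h1 : entireCalc c A v = 0 := by
      rw [hc.apply_eigenvector (μ := μ) (by exact hv.apply_eq_smul), h0, zero_smul]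
    have h2 := (ContinuousLinearMap.isUnit_iff_bijective.1 hu).1
    exact hv.2 (h2 (by rw [h1, map_zero]))
  · intro h
    have hinj : Function.Injective (entireCalc c A : W →ₗ[ℂ] W) := by
      rw [← LinearMap.ker_eq_bot]
      by_contra hne
      -- The kernel of f(A) is A-invariant. If nonzero it contains an eigenvector of A, on which
      -- f(A) acts as f(μ), forcing f(μ) = 0.
      set K := LinearMap.ker (entireCalc c A : W →ₗ[ℂ] W) with hK
      have : Nontrivial K := Submodule.nontrivial_iff_ne_bot.2 hne
      have hmap : ∀ x ∈ K, (A : W →ₗ[ℂ] W) x ∈ K := fun x hx => by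
        have hx' : entireCalc c A x = 0 := hx
        have := congrArg (fun T => T x) (hc.commute A).eq
        simp only [mul_apply_eq_comp, hx', map_zero] at this
        exact this.symm
      obtain ⟨μ, hμ⟩ := Module.End.exists_eigenvalue ((A : W →ₗ[ℂ] W).restrict hmap)
      obtain ⟨v, hv⟩ := hμ.exists_hasEigenvector
      have hAv : A v = μ • (v : W) := congrArg Subtype.val hv.apply_eq_smul
      have hv0 : (v : W) ≠ 0 := fun h0 => hv.2 (Subtype.ext h0)
      have h1 : entireCalc c A v = 0 := v.2
      rw [hc.apply_eigenvector hAv] at h1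
      refine h μ ?_ ((smul_eq_zero.1 h1).resolve_right hv0)
      exact Module.End.hasEigenvalue_of_hasEigenvector
        ⟨Module.End.mem_eigenspace_iff.2 hAv, hv0⟩
    exact ContinuousLinearMap.isUnit_iff_bijective.2
      ⟨hinj, LinearMap.injective_iff_surjective.1 hinj⟩

theorem tsum_cSinhDiv_eq_zero_iff (μ : ℂ) : ∑' n, cSinhDiv ℂ n * μ ^ n = 0
    ↔ ∃ n : ℤ, n ≠ 0 ∧ μ = Complex.I * (Real.pi : ℂ) * (n : ℂ) := by
  have key : μ * ∑' n, cSinhDiv ℂ n * μ ^ n = Complex.sinh μ := by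
    have h1 := ((expBounded_cSinhDiv ℂ).summable_scalar μ).hasSum.mul_left μ
    have hi : Function.Injective fun n : ℕ => 2 * n := fun a b h => by simpa using h
    rw [← hi.hasSum_iff] at h1
    · refine h1.unique ((Complex.hasSum_sinh μ).congr_fun fun n => ?_)
      simp [cSinhDiv, div_eq_inv_mul, pow_succ]
      ring
    · intro n hn
      have : ¬ Even n := fun ⟨k, hk⟩ => hn ⟨k, by simp; omega⟩
      simp [cSinhDiv, this]
  -- At 0 the series has value 1, which is why n = 0 is excluded; elsewhere its zeros are those of
  -- sinh, found through sin(μ i).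
  by_cases hμ : μ = 0
  · subst hμ
    rw [tsum_eq_single 0 (fun n hn => by simp [hn])]
    simp [cSinhDiv, Real.pi_ne_zero, eq_comm]
  · have h1 : ∑' n, cSinhDiv ℂ n * μ ^ n = 0 ↔ Complex.sinh μ = 0 := by
      rw [← key]; simp [hμ]
    have h2 : Complex.sinh μ = 0 ↔ Complex.sin (μ * Complex.I) = 0 := by
      rw [Complex.sin_mul_I]; simp
    rw [h1, h2, Complex.sin_eq_zero_iff]
    constructor
    · rintro ⟨k, hk⟩
      have h3 : μ = Complex.I * Real.pi * ((-k : ℤ) : ℂ) := by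
        have := congrArg (fun z => z * -Complex.I) hk
        simp only [mul_assoc, mul_neg, Complex.I_mul_I, neg_neg, mul_one] at this
        rw [this]; push_cast; ring
      refine ⟨-k, fun h0 => hμ ?_, h3⟩
      rw [h3, h0]; simp
    · rintro ⟨n, -, hn⟩
      refine ⟨-n, ?_⟩
      rw [hn]
      push_cast
      linear_combination (Real.pi : ℂ) * n * Complex.I_mul_I

end Spectrum

section Criterion

variable {𝕜 E : Type*} [RCLike 𝕜] [NormedAddCommGroup E] [NormedSpace 𝕜 E]
  [FiniteDimensional 𝕜 E]

theorem isUnit_opSinhDiv_iff (A : E →L[𝕜] E) : IsUnit (opSinhDiv A) ↔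
    ∀ μ ∈ complexSpectrum A, ¬ ∃ n : ℤ, n ≠ 0 ∧ μ = Complex.I * (Real.pi : ℂ) * (n : ℂ) := by
  have hc : (fun n => toComplexHom 𝕜 (cSinhDiv 𝕜 n)) = cSinhDiv ℂ := by
    funext n
    unfold cSinhDiv
    split_ifs <;> simp
  have h := (expBounded_cSinhDiv 𝕜).complexify A
  rw [hc] at h
  rw [← isUnit_complexify_iff, show opSinhDiv A = entireCalc (cSinhDiv 𝕜) A from rfl, h,
    (expBounded_cSinhDiv ℂ).isUnit_iff]
  simp only [mem_complexSpectrum_iff, ← tsum_cSinhDiv_eq_zero_iff]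

theorem isUnit_iff_zero_notMem_complexSpectrum (A : E →L[𝕜] E) :
    IsUnit A ↔ (0 : ℂ) ∉ complexSpectrum A := by
  rw [mem_complexSpectrum_iff, Module.End.hasEigenvalue_iff_mem_spectrum, spectrum.zero_mem_iff,
    not_not, ← isUnit_complexify_iff, isUnit_iff_isUnit_det, LinearMap.isUnit_iff_isUnit_det]

end Criterion

/-! ### The double as a Lie algebra with invariant pairing -/

section Double

variable {𝕜 V : Type*} [RCLike 𝕜] [NormedAddCommGroup V] [NormedSpace 𝕜 V]

theorem eq_of_forall_strongDual {v w : V} (h : ∀ ξ : StrongDual 𝕜 V, ξ v = ξ w) : v = w :=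
  SeparatingDual.eq_iff_forall_dual_eq.2 h

/-- The canonical pairing `⟨x + ξ, y + η⟩ = ξ y + η x` on `𝔤 ⊕ 𝔤*`. -/
def dpair (𝕜 V : Type*) [RCLike 𝕜] [NormedAddCommGroup V] [NormedSpace 𝕜 V] :
    (V × StrongDual 𝕜 V) →L[𝕜] (V × StrongDual 𝕜 V) →L[𝕜] 𝕜 :=
  let c : (V × StrongDual 𝕜 V) →L[𝕜] (V × StrongDual 𝕜 V) →L[𝕜] 𝕜 :=
    (ContinuousLinearMap.id 𝕜 (StrongDual 𝕜 V)).bilinearComp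
      (ContinuousLinearMap.snd 𝕜 V (StrongDual 𝕜 V)) (ContinuousLinearMap.fst 𝕜 V (StrongDual 𝕜 V))
  c + c.flip

@[simp] theorem dpair_apply (X Y : V × StrongDual 𝕜 V) : dpair 𝕜 V X Y = X.2 Y.1 + Y.2 X.1 := rfl

theorem dpair_symm (X Y : V × StrongDual 𝕜 V) : dpair 𝕜 V X Y = dpair 𝕜 V Y X := by
  simp [add_comm]

variable [FiniteDimensional 𝕜 V]

namespace QuasiBialgebraData

variable (G : QuasiBialgebraData 𝕜 V)

@[simp] theorem apply_assocContract (ξ η ζ : StrongDual 𝕜 V) :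
    ζ (G.assocContract ξ η) = G.assoc ![ξ, η, ζ] := apply_ofBidual _ _

@[simp] theorem adStar_apply (x y : V) (ξ : StrongDual 𝕜 V) : G.adStar x ξ y = ξ (G.lie x y) := rfl

@[simp] theorem cocyclePair_apply (η ξ : StrongDual 𝕜 V) (x : V) :
    G.cocyclePair η ξ x = η (G.cocycle x ξ) := rfl

@[simp] theorem dad_apply (X Y : V × StrongDual 𝕜 V) : G.dad X Y = G.dlie X Y := rfl

omit [FiniteDimensional 𝕜 V] in
theorem assoc_swap_left (ξ η ζ : StrongDual 𝕜 V) :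
    G.assoc ![η, ξ, ζ] = -G.assoc ![ξ, η, ζ] := by
  rw [← G.assoc.map_swap ![ξ, η, ζ] (show (0 : Fin 3) ≠ 1 by decide)]
  congr 1; funext i; fin_cases i <;> rfl

omit [FiniteDimensional 𝕜 V] in
theorem assoc_swap_right (ξ η ζ : StrongDual 𝕜 V) :
    G.assoc ![ξ, ζ, η] = -G.assoc ![ξ, η, ζ] := by
  rw [← G.assoc.map_swap ![ξ, η, ζ] (show (1 : Fin 3) ≠ 2 by decide)]
  congr 1; funext i; fin_cases i <;> rfl

end QuasiBialgebraData

namespace LieQuasiBialgebra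

variable (G : LieQuasiBialgebra 𝕜 V)

theorem lie_skew (x y : V) : G.lie x y = -G.lie y x := by
  have h := G.lie_self (x + y)
  simp only [map_add, LinearMap.add_apply, G.lie_self, zero_add, add_zero] at h
  exact eq_neg_of_add_eq_zero_right h

/-- Checked on components from the skewness of the bracket, of ϖ_x and of φ. Only linearity in the
second argument is built into `dad`; linearity in the first, needed for `adD`, is deduced from this.
-/
theorem dlie_skew (X Y : V × StrongDual 𝕜 V) : G.dlie X Y = -G.dlie Y X := by
  have h1 : G.assocContract Y.2 X.2 = -G.assocContract X.2 Y.2 :=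
    eq_of_forall_strongDual (𝕜 := 𝕜) fun ζ => by simp [G.assoc_swap_left X.2 Y.2]
  have h2 : G.cocyclePair X.2 Y.2 = -G.cocyclePair Y.2 X.2 := by
    ext x; exact G.cocycle_skew x X.2 Y.2
  ext1
  · simp only [QuasiBialgebraData.dlie, Prod.fst_neg, G.lie_skew Y.1 X.1, h1]
    abel
  · simp only [QuasiBialgebraData.dlie, Prod.snd_neg, h2]
    abel

/-- The adjoint representation of the double. -/
def adD : (V × StrongDual 𝕜 V) →L[𝕜] (V × StrongDual 𝕜 V) →L[𝕜] (V × StrongDual 𝕜 V) :=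
  LinearMap.toContinuousLinearMap
    { toFun := G.dad
      map_add' := fun X Y => by
        refine ContinuousLinearMap.ext fun Z => ?_
        have := (G.dad Z).map_add X Y
        simp only [QuasiBialgebraData.dad_apply] at this
        rw [add_apply, QuasiBialgebraData.dad_apply, QuasiBialgebraData.dad_apply,
          QuasiBialgebraData.dad_apply, G.dlie_skew _ Z, this, G.dlie_skew X Z, G.dlie_skew Y Z,
          neg_add]
      map_smul' := fun c X => by
        refine ContinuousLinearMap.ext fun Z => ?_
        have := (G.dad Z).map_smul c X
        simp only [QuasiBialgebraData.dad_apply] at this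
        rw [smul_apply, QuasiBialgebraData.dad_apply, QuasiBialgebraData.dad_apply,
          G.dlie_skew _ Z, this, G.dlie_skew X Z, smul_neg]
        rfl }

@[simp] theorem adD_apply (X : V × StrongDual 𝕜 V) : G.adD X = G.dad X := rfl

theorem adD_jacobi (X Y : V × StrongDual 𝕜 V) :
    G.adD (G.adD X Y) = G.adD X * G.adD Y - G.adD Y * G.adD X := by
  refine ContinuousLinearMap.ext fun Z => ?_
  simp only [sub_apply, mul_apply_eq_comp, adD_apply, QuasiBialgebraData.dad_apply]
  rw [G.dlie_jacobi X Y Z, add_sub_cancel_right]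

/-- Invariance of the canonical pairing amounts to the antisymmetry of φ, of the maps ϖ_x and of the
bracket of 𝔤, one hypothesis for each type of term. -/
theorem adD_invariant (X Y Z : V × StrongDual 𝕜 V) :
    dpair 𝕜 V (G.adD X Y) Z = -dpair 𝕜 V Y (G.adD X Z) := by
  have h1 := G.assoc_swap_right X.2 Y.2 Z.2
  have h2 := G.cocycle_skew X.1 Z.2 Y.2
  have h3 : X.2 (G.lie Y.1 Z.1) = -X.2 (G.lie Z.1 Y.1) := by rw [G.lie_skew]; simp
  simp only [dpair_apply, adD_apply, QuasiBialgebraData.dad_apply, QuasiBialgebraData.dlie,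
    add_apply, neg_apply, map_add, map_sub, QuasiBialgebraData.adStar_apply,
    QuasiBialgebraData.cocyclePair_apply, QuasiBialgebraData.apply_assocContract]
  linear_combination h1 + h2 + h3

end LieQuasiBialgebra

end Double

/-! ### Reductive decompositions -/

namespace ReductiveDecomposition

variable {𝕜 V : Type*} [RCLike 𝕜] [NormedAddCommGroup V] [NormedSpace 𝕜 V]
  [FiniteDimensional 𝕜 V]

section General

variable {G : QuasiBialgebraData 𝕜 V} (R : ReductiveDecomposition G)

theorem pl_coe (z : R.l) : R.pl z = z := Submodule.projectionOnto_apply_left R.isCompl z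

theorem pl_eq_zero {u : V} (hu : u ∈ R.m) : R.pl u = 0 :=
  (Submodule.projectionOnto_apply_eq_zero_iff R.isCompl).2 hu

theorem sub_pl_mem (v : V) : v - R.pl v ∈ R.m := by
  rw [← Submodule.projectionOnto_apply_eq_zero_iff R.isCompl]
  have := R.pl_coe (R.pl v)
  change R.pl (v - R.pl v) = 0
  rw [map_sub, this, sub_self]

@[simp] theorem s_apply (α : StrongDual 𝕜 R.l) (v : V) : R.s α v = α (R.pl v) := rfl

@[simp] theorem iStar_apply (ξ : StrongDual 𝕜 V) (z : R.l) : R.iStar ξ z = ξ z := rfl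

theorem s_mem_perp (α : StrongDual 𝕜 R.l) : R.s α ∈ perp R.m := fun u hu => by
  simp [R.pl_eq_zero hu]

@[simp] theorem iStar_s (α : StrongDual 𝕜 R.l) : R.iStar (R.s α) = α := by
  ext z; simp [R.pl_coe]

theorem iStar_eq_zero {ξ : StrongDual 𝕜 V} (h : ξ ∈ perp R.l) : R.iStar ξ = 0 := by
  ext z; simpa using h z z.2

theorem s_iStar {ξ : StrongDual 𝕜 V} (h : ξ ∈ perp R.m) : R.s (R.iStar ξ) = ξ := by
  ext v
  have := h _ (R.sub_pl_mem v)
  rw [map_sub, sub_eq_zero] at this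
  simp [this]

theorem sub_s_iStar_mem (ξ : StrongDual 𝕜 V) : ξ - R.s (R.iStar ξ) ∈ perp R.l := fun z hz => by
  have := R.pl_coe ⟨z, hz⟩
  simp only at this
  simp [this]

theorem mem_l_of_forall_perp {v : V} (h : ∀ ζ ∈ perp R.l, ζ v = 0) : v ∈ R.l := by
  by_contra hn
  obtain ⟨f, hf, hf'⟩ := Submodule.exists_le_ker_of_notMem hn
  exact hf (h (LinearMap.toContinuousLinearMap f) fun v hv => hf' hv)

/-- The map `p ↦ s p`, with values in the double. -/
def sD : StrongDual 𝕜 R.l →L[𝕜] (V × StrongDual 𝕜 V) :=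
  (ContinuousLinearMap.inr 𝕜 V (StrongDual 𝕜 V)).comp R.s

@[simp] theorem sD_apply (α : StrongDual 𝕜 R.l) : R.sD α = (0, R.s α) := rfl

/-- The inclusion `𝔩 ⊕ 𝔩* → 𝔡`. -/
def inclD : (R.l × StrongDual 𝕜 R.l) →L[𝕜] (V × StrongDual 𝕜 V) :=
  R.l.subtypeL.prodMap R.s

@[simp] theorem inclD_apply (x : R.l × StrongDual 𝕜 R.l) : R.inclD x = ((x.1 : V), R.s x.2) := rfl

theorem inclD_injective : Function.Injective R.inclD := fun x y h => by
  have h1 : (x.1 : V) = y.1 := congrArg Prod.fst h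
  have h2 := congrArg R.iStar (congrArg Prod.snd h)
  simp only [inclD_apply, iStar_s] at h2
  exact Prod.ext (Subtype.ext h1) h2

end General

variable {G : LieQuasiBialgebra 𝕜 V} (R : ReductiveDecomposition G.toQuasiBialgebraData)

theorem adStar_mem_perp {z : V} (hz : z ∈ R.l) {ξ : StrongDual 𝕜 V} (hξ : ξ ∈ perp R.m) :
    G.adStar z ξ ∈ perp R.m := fun u hu => hξ _ (R.lie_mem_m z hz u hu)

/-- Because [𝔩, 𝔪] ⊆ 𝔪, the annihilator of 𝔪 is stable under ad*_z for z in 𝔩, and it is the image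
of s. -/
theorem adStar_s (z : R.l) (p : StrongDual 𝕜 R.l) :
    G.adStar z (R.s p) = R.s (R.subData.adStar z p) := by
  rw [← R.s_iStar (R.adStar_mem_perp z.2 (R.s_mem_perp p))]
  congr 1
  ext w
  simp only [iStar_apply, QuasiBialgebraData.adStar_apply, s_apply]
  congr 1
  exact R.pl_coe ⟨_, R.lie_mem_l z z.2 w w.2⟩

variable {R} (hR : R.CanonicallyCompatible)
include hR

namespace CanonicallyCompatible

theorem assocContract_mem {ξ η : StrongDual 𝕜 V} (hξ : ξ ∈ perp R.m) (hη : η ∈ perp R.m) :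
    G.assocContract ξ η ∈ R.l :=
  R.mem_l_of_forall_perp fun ζ hζ => by simpa using hR.assoc_llm ξ hξ η hη ζ hζ

theorem dlie_perp_l {ξ : StrongDual 𝕜 V} {z : V} (hz : z ∈ R.l) :
    G.dlie (0, ξ) (z, 0) = (0, G.adStar z ξ) := by
  have h1 : G.assocContract ξ 0 = 0 := eq_of_forall_strongDual (𝕜 := 𝕜) fun ζ => by
    simpa using G.assoc.map_coord_zero (m := ![ξ, 0, ζ]) 1 rfl
  ext1
  · simp [QuasiBialgebraData.dlie, hR.cocycle_l z hz, h1]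
  · ext v; simp [QuasiBialgebraData.dlie]

theorem dlie_perp_perp {ξ η : StrongDual 𝕜 V} (hξ : ξ ∈ perp R.m) (hη : η ∈ perp R.m) :
    G.dlie (0, ξ) (0, η) = (G.assocContract ξ η, 0) := by
  ext1
  · simp [QuasiBialgebraData.dlie]
  · ext v; simp [QuasiBialgebraData.dlie, hR.cocycle_perp v η hη ξ hξ]

/-- Here P = 𝔩, Q = s𝔩* = 𝔪^⊥ and N = 𝔤⋆₀. The condition ϖ_𝔩 = 0 sends P into Q. The vanishing of
⟨𝔪^⊥, ϖ 𝔪^⊥⟩ and of the 𝔩𝔩𝔪 part of φ sends Q into P. The vanishing of the 𝔪𝔪𝔪 part, again with ϖ_𝔩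
= 0, makes N a subalgebra. -/
theorem isSymmetricPair : IsSymmetricPair G.adD (dpair 𝕜 V) R.sD (R.l.prod ⊥)
    (Submodule.prod ⊥ (perp R.m)) R.gStar where
  jacobi := G.adD_jacobi
  skew := G.dlie_skew
  symm := dpair_symm
  invariant := G.adD_invariant
  mem_Q p := ⟨rfl, R.s_mem_perp p⟩
  map_P p x hx := by
    obtain ⟨z, ξ⟩ := x
    obtain ⟨hz, hξ⟩ := hx
    obtain rfl : ξ = 0 := hξ
    rw [LieQuasiBialgebra.adD_apply, QuasiBialgebraData.dad_apply, sD_apply, hR.dlie_perp_l hz]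
    exact ⟨rfl, R.adStar_mem_perp hz (R.s_mem_perp p)⟩
  map_Q p x hx := by
    obtain ⟨z, ξ⟩ := x
    obtain ⟨hz, hξ⟩ := hx
    obtain rfl : z = 0 := hz
    rw [LieQuasiBialgebra.adD_apply, QuasiBialgebraData.dad_apply, sD_apply,
      hR.dlie_perp_perp (R.s_mem_perp p) hξ]
    exact ⟨hR.assocContract_mem (R.s_mem_perp p) hξ, rfl⟩
  isotropic_P x hx y hy := by
    have h1 : x.2 = 0 := hx.2
    have h2 : y.2 = 0 := hy.2
    simp [h1, h2]
  isotropic_Q x hx y hy := by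
    have h1 : x.1 = 0 := hx.1
    have h2 : y.1 = 0 := hy.1
    simp [h1, h2]
  isotropic_N x hx y hy := by
    simp [hx.2 _ hy.1, hy.2 _ hx.1]
  orthogonal_PN x hx y hy := by
    have h1 : x.2 = 0 := hx.2
    simp [h1, hy.2 _ hx.1]
  ad_mem_N x hx y hy := R.dlie_mem_gStar hR hx hy

/-- The double of `𝔩` is a subalgebra of the double of `𝔤`, as far as `ad_p` is concerned. -/
theorem inclD_adL (p : StrongDual 𝕜 R.l) (x : R.l × StrongDual 𝕜 R.l) :
    R.inclD (R.adL p x) = R.adS p (R.inclD x) := by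
  obtain ⟨z, α⟩ := x
  have e1 : R.adS p (R.inclD (z, α)) = R.adS p ((z : V), 0) + R.adS p (0, R.s α) := by
    rw [← map_add]; simp
  have e2 : R.adS p ((z : V), 0) = (0, G.adStar z (R.s p)) := hR.dlie_perp_l z.2
  have e3 : R.adS p (0, R.s α) = (G.assocContract (R.s p) (R.s α), 0) :=
    hR.dlie_perp_perp (R.s_mem_perp p) (R.s_mem_perp α)
  have e4 : R.adL p (z, α) = (R.subData.assocContract p α, R.subData.adStar z p) := by
    change R.subData.dlie (0, p) (z, α) = _
    ext1
    · simp [QuasiBialgebraData.dlie, subData]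
    · ext v
      simp [QuasiBialgebraData.dlie, subData]
  rw [e1, e2, e3, e4, R.adStar_s]
  ext1
  · simp only [inclD_apply, Prod.fst_add, zero_add]
    refine eq_of_forall_strongDual (𝕜 := 𝕜) fun ζ => ?_
    have h1 := R.subData.apply_assocContract p α (R.iStar ζ)
    have h2 : R.subData.assoc ![p, α, R.iStar ζ]
        = G.assoc ![R.s p, R.s α, R.s (R.iStar ζ)] := by
      refine congrArg G.assoc ?_
      funext i; fin_cases i <;> rfl
    -- Without an 𝔩𝔩𝔪 part, φ contracted with two elements of s𝔩* sees only the component s i*ζ of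
    -- ζ, so the projected φ suffices.
    have h3 := hR.assoc_llm _ (R.s_mem_perp p) _ (R.s_mem_perp α) _ (R.sub_s_iStar_mem ζ)
    have h4 : G.assoc ![R.s p, R.s α, ζ - R.s (R.iStar ζ)]
        = G.assoc ![R.s p, R.s α, ζ] - G.assoc ![R.s p, R.s α, R.s (R.iStar ζ)] := by
      simp only [← QuasiBialgebraData.apply_assocContract]
      simp
    rw [h4, sub_eq_zero] at h3
    rw [G.apply_assocContract, h3, ← h2, ← h1]
    rfl
  · simp

end CanonicallyCompatible

end ReductiveDecomposition

/-! ### The base `U` and the trivialization -/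

section Functions

variable {𝕜 E : Type*} [RCLike 𝕜] [NormedAddCommGroup E] [NormedSpace 𝕜 E] [CompleteSpace E]

/-- F(A) is only applied to vectors in the image of sinh A / A, where the denominator clears. -/
theorem opCothSubInv_mul {A : E →L[𝕜] E} (h : IsUnit (opSinhDiv A)) :
    opCothSubInv A * opSinhDiv A = entireCalc (cCothNum 𝕜) A := by
  have hc : entireCalc (cCothNum 𝕜) A * opSinhDiv A = opSinhDiv A * entireCalc (cCothNum 𝕜) A :=
    ((expBounded_cCothNum 𝕜).commute_entireCalc (expBounded_cSinhDiv 𝕜) A).eq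
  change Ring.inverse (opSinhDiv A) * entireCalc (cCothNum 𝕜) A * opSinhDiv A = _
  rw [mul_assoc, hc, ← mul_assoc, Ring.inverse_mul_cancel _ h, one_mul]

/-- The coefficients of a and z are (sinh x - x)/x² + sinh x / x + (x cosh x - sinh x)/x² = (e^x -
1)/x and sinh x / x + sinh x + (cosh x - sinh x / x) = e^x. -/
theorem sinh_sub_add_cothNum (A : E →L[𝕜] E) (a z : E) :
    opSinhSub A a - opSinhDiv A z + (opSinhDiv A a - opSinh A z)
      + (entireCalc (cCothNum 𝕜) A a - A (entireCalc (cCothNum 𝕜) A z))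
      = entireCalc (cExpDiv 𝕜) A a - NormedSpace.exp A z := by
  rw [exp_eq_one_add, opSinh_eq, expDiv_eq, coshDiv_eq]
  simp only [add_apply, mul_apply_eq_comp, one_apply_eq_self, map_add]
  have e : opSinhDiv A z = z + A (opSinhSub A z) := by
    conv_lhs => rw [opSinhDiv_eq]
    rfl
  nth_rewrite 1 [e]
  abel

theorem ExpBounded.apply_comm {c : ℕ → 𝕜} (hc : ExpBounded c) (A : E →L[𝕜] E) (x : E) :
    entireCalc c A (A x) = A (entireCalc c A x) :=
  congrArg (fun T => T x) (hc.commute A).eq.symm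

end Functions

namespace ReductiveDecomposition

variable {𝕜 V : Type*} [RCLike 𝕜] [NormedAddCommGroup V] [NormedSpace 𝕜 V]
  [FiniteDimensional 𝕜 V]

theorem mem_U_iff {G : QuasiBialgebraData 𝕜 V} (R : ReductiveDecomposition G)
    {p : StrongDual 𝕜 R.l} :
    p ∈ R.U ↔ IsUnit (opSinhDiv (R.adL p)) ∧ IsUnit (R.projAdNegIncl p) := by
  rw [isUnit_opSinhDiv_iff, isUnit_iff_zero_notMem_complexSpectrum]
  rfl

variable {G : LieQuasiBialgebra 𝕜 V} (R : ReductiveDecomposition G.toQuasiBialgebraData)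

theorem adS_eq (p : StrongDual 𝕜 R.l) : R.adS p = G.adD (R.sD p) := rfl

theorem famSinhDiv_one (p : StrongDual 𝕜 R.l) :
    famSinhDiv G.adD R.sD 1 p = opSinhDiv (R.adS p) := by simp [famSinhDiv, adS_eq]

theorem famSinhSub_one (p : StrongDual 𝕜 R.l) :
    famSinhSub G.adD R.sD 1 p = opSinhSub (R.adS p) := by simp [famSinhSub, adS_eq]

theorem famExp_one (p : StrongDual 𝕜 R.l) :
    famExp G.adD R.sD 1 p = NormedSpace.exp (R.adS p) := by simp [famExp, adS_eq]

theorem famExpDiv_one (p : StrongDual 𝕜 R.l) :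
    famExpDiv G.adD R.sD 1 p = entireCalc (cExpDiv 𝕜) (R.adS p) := by simp [famExpDiv, adS_eq]

theorem dAdExp_neg (p : StrongDual 𝕜 R.l) : G.dAdExp (0, -R.s p) = famExp G.adD R.sD (-1) p := by
  have : ((0 : V), -R.s p) = -R.sD p := by simp
  rw [QuasiBialgebraData.dAdExp, this, ← LieQuasiBialgebra.adD_apply, map_neg, famExp]
  simp

theorem projAdNeg_eq (p : StrongDual 𝕜 R.l) : R.projAdNeg p
    = (ContinuousLinearMap.fst 𝕜 V (StrongDual 𝕜 V)).comp (famExp G.adD R.sD (-1) p) := by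
  rw [projAdNeg, dAdExp_neg]

/-- The `𝔩`-component of an element of `𝔤⋆₀`, in the double. -/
def coordZ (x : R.gStar) : V × StrongDual 𝕜 V := ((x : V × StrongDual 𝕜 V).1, 0)

/-- The `𝔩^⊥`-component of an element of `𝔤⋆₀`, in the double. -/
def coordXi (x : R.gStar) : V × StrongDual 𝕜 V := (0, (x : V × StrongDual 𝕜 V).2)

theorem coordZ_add_coordXi (x : R.gStar) : R.coordZ x + R.coordXi x = x := by
  simp [coordZ, coordXi]

theorem trivFst_apply (p : StrongDual 𝕜 R.l) (e : StrongDual 𝕜 R.l × R.gStar) :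
    R.trivFst p e = opSinhSub (R.adS p) (R.sD e.1) - opSinhDiv (R.adS p) (R.coordZ e.2) := rfl

theorem trivSnd_apply (p : StrongDual 𝕜 R.l) (e : StrongDual 𝕜 R.l × R.gStar) :
    R.trivSnd p e = opSinhDiv (R.adS p) (R.sD e.1) - opSinh (R.adS p) (R.coordZ e.2)
      - (0, (NormedSpace.exp (R.adS p) (R.coordXi e.2)).2) := rfl

theorem coordZ_mem (x : R.gStar) : R.coordZ x ∈ R.l.prod (⊥ : Submodule 𝕜 (StrongDual 𝕜 V)) :=
  ⟨x.2.1, rfl⟩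

variable {R}

theorem lcan_s {p : StrongDual 𝕜 R.l} (hu : IsUnit (opSinhDiv (R.adL p)))
    {u : R.l × StrongDual 𝕜 R.l} {β : StrongDual 𝕜 R.l} (h : opSinhDiv (R.adL p) u = (0, β)) :
    R.lcan p (R.s β) = (R.inclD (entireCalc (cCothNum 𝕜) (R.adL p) u)).1 := by
  have : CompleteSpace R.l := FiniteDimensional.complete 𝕜 R.l
  have h1 : R.lcan p (R.s β) = ((opCothSubInv (R.adL p) (0, β)).1 : V) := by
    simp [lcan, rAM]
  rw [h1, ← h, ← mul_apply_eq_comp, opCothSubInv_mul hu]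
  rfl

variable (hR : R.CanonicallyCompatible)
include hR

namespace CanonicallyCompatible

theorem adS_map_P (p : StrongDual 𝕜 R.l) :
    ∀ x ∈ R.l.prod (⊥ : Submodule 𝕜 (StrongDual 𝕜 V)),
      R.adS p x ∈ Submodule.prod (⊥ : Submodule 𝕜 V) (perp R.m) :=
  hR.isSymmetricPair.map_P p

theorem adS_map_Q (p : StrongDual 𝕜 R.l) :
    ∀ x ∈ Submodule.prod (⊥ : Submodule 𝕜 V) (perp R.m),
      R.adS p x ∈ R.l.prod (⊥ : Submodule 𝕜 (StrongDual 𝕜 V)) :=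
  hR.isSymmetricPair.map_Q p

theorem sD_mem (p : StrongDual 𝕜 R.l) : R.sD p ∈ Submodule.prod (⊥ : Submodule 𝕜 V) (perp R.m) :=
  hR.isSymmetricPair.mem_Q p

section
variable [CompleteSpace V]

/-- A matter of parity: the odd function carries sα into 𝔩 and the even one keeps z there. -/
theorem trivFst_mem (p : StrongDual 𝕜 R.l) (e : StrongDual 𝕜 R.l × R.gStar) :
    R.trivFst p e ∈ R.l.prod (⊥ : Submodule 𝕜 (StrongDual 𝕜 V)) := by
  rw [trivFst_apply]
  exact sub_mem ((expBounded_cSinhSub 𝕜).mem_of_odd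
      (fun n hn => by simp [cSinhSub, Nat.not_odd_iff_even.2 hn]) (hR.adS_map_Q p)
      (hR.adS_map_P p) (hR.sD_mem e.1))
    ((expBounded_cSinhDiv 𝕜).mem_of_even (fun n hn => by simp [cSinhDiv, hn]) (hR.adS_map_P p)
      (hR.adS_map_Q p) (R.coordZ_mem e.2))

theorem sinh_part_mem (p : StrongDual 𝕜 R.l) (e : StrongDual 𝕜 R.l × R.gStar) :
    opSinhDiv (R.adS p) (R.sD e.1) - opSinh (R.adS p) (R.coordZ e.2)
      ∈ Submodule.prod (⊥ : Submodule 𝕜 V) (perp R.m) :=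
  sub_mem ((expBounded_cSinhDiv 𝕜).mem_of_even (fun n hn => by simp [cSinhDiv, hn])
      (hR.adS_map_Q p) (hR.adS_map_P p) (hR.sD_mem e.1))
    ((expBounded_cSinh 𝕜).mem_of_odd
      (fun n hn => by simp [cSinh, Nat.not_odd_iff_even.2 hn]) (hR.adS_map_P p)
      (hR.adS_map_Q p) (R.coordZ_mem e.2))

theorem trivFst_eq (p : StrongDual 𝕜 R.l) (e : StrongDual 𝕜 R.l × R.gStar) :
    R.trivFst p e = (((R.triv p e).1 : V), 0) := by
  have h := hR.trivFst_mem p e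
  refine Prod.ext ?_ h.2
  exact (congrArg Subtype.val (R.pl_coe ⟨_, h.1⟩)).symm

theorem trivSnd_eq (p : StrongDual 𝕜 R.l) (e : StrongDual 𝕜 R.l × R.gStar) :
    R.trivSnd p e = (0, (R.triv p e).2) := by
  refine Prod.ext ?_ rfl
  rw [trivSnd_apply, Prod.fst_sub, sub_zero]
  exact (hR.sinh_part_mem p e).1

/-- `p_{𝔤*} Ad_{e^{sp}}` preserves `𝔩^⊥`. -/
theorem exp_coordXi_mem (p : StrongDual 𝕜 R.l) (x : R.gStar) :
    (NormedSpace.exp (R.adS p) (R.coordXi x)).2 ∈ perp R.l := fun w hw => by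
  -- The subspace 𝔩 ⊕ 𝔪^⊥ is stable under A. Hence ⟨e^A ξ, w⟩ = ⟨ξ, e^{-A} w⟩, where e^{-A} w has
  -- its 𝔤-part in 𝔩, on which ξ vanishes.
  have hmap : ∀ y ∈ R.l.prod (perp R.m), (-R.adS p) y ∈ R.l.prod (perp R.m) := fun y hy => by
    have e : y = (y.1, 0) + (0, y.2) := by simp
    have h1 := hR.adS_map_P p (y.1, 0) ⟨hy.1, rfl⟩
    have h2 := hR.adS_map_Q p (0, y.2) ⟨rfl, hy.2⟩
    rw [e, neg_apply, map_add]
    refine neg_mem (add_mem ⟨?_, h1.2⟩ ⟨h2.1, ?_⟩)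
    · rw [show (R.adS p (y.1, 0)).1 = 0 from h1.1]; exact zero_mem _
    · rw [show (R.adS p (0, y.2)).2 = 0 from h2.2]; exact zero_mem _
  have h1 := (expBounded_cExp 𝕜).adjoint (b := dpair 𝕜 V) (G.adD_invariant (R.sD p))
    (R.coordXi x) (w, 0)
  have h2 := (expBounded_cExp 𝕜).mem_of_map hmap
    (show ((w, 0) : V × StrongDual 𝕜 V) ∈ R.l.prod (perp R.m) from ⟨hw, zero_mem _⟩)
  rw [exp_eq_entireCalc]
  simp only [dpair_apply] at h1
  simp only [zero_apply, add_zero] at h1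
  refine h1.trans ?_
  have h3 := x.2.2 _ h2.1
  simpa [coordXi] using! h3

/-- With y = e^A ξ, the vector e^{-A} y = ξ has no 𝔤-part. Solving p_𝔤 e^{-A}(y₁ + y₂) = 0 for the
𝔤-part y₁ gives the formula for ℓ_p on 𝔩^⊥. -/
theorem lcan_perp {p : StrongDual 𝕜 R.l} (hu : IsUnit (R.projAdNegIncl p)) {x : R.gStar} :
    R.lcan p (NormedSpace.exp (R.adS p) (R.coordXi x)).2
      = (NormedSpace.exp (R.adS p) (R.coordXi x)).1 := by
  set y := NormedSpace.exp (R.adS p) (R.coordXi x) with hy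
  have h0 : R.projAdNeg p y = 0 := by
    have := congrArg (fun T => T (R.coordXi x)) (famExp_inv (ad := G.adD) (κ := R.sD) 1 p)
    simp only [mul_apply_eq_comp, one_smul, famExp_one, ← hy] at this
    have e : famExp G.adD R.sD (-1) p = NormedSpace.exp (-G.adD (R.sD p)) := by simp [famExp]
    rw [projAdNeg_eq, e]
    exact congrArg Prod.fst this
  have h1 : y = (y.1, 0) + (0, y.2) := by simp
  rw [h1, map_add] at h0
  have h2 : R.iStar y.2 = 0 := R.iStar_eq_zero (hR.exp_coordXi_mem p x)
  have h3 : R.projAdNegIncl p y.1 = R.projAdNeg p (y.1, 0) := rfl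
  have h4 : R.lcan p y.2 = -(Ring.inverse (R.projAdNegIncl p) (R.projAdNeg p (0, y.2))) := by
    simp only [lcan, sub_apply, ContinuousLinearMap.comp_apply, h2, map_zero, ContinuousLinearMap.id_apply,
      sub_zero, zero_sub]
    simp
  have h5 := congrArg (fun T => T y.1) (Ring.inverse_mul_cancel _ hu)
  simp only [mul_apply_eq_comp, one_apply_eq_self] at h5
  rw [h4, ← map_neg, ← eq_neg_of_add_eq_zero_left h0, ← h3, h5]

omit [CompleteSpace V] in
/-- An element of the double of `𝔩` describing `T_p (α, z)`. -/
theorem exists_inclD_eq (p : StrongDual 𝕜 R.l) (e : StrongDual 𝕜 R.l × R.gStar) :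
    ∃ u : R.l × StrongDual 𝕜 R.l, R.inclD u = R.sD e.1 - R.adS p (R.coordZ e.2) := by
  refine ⟨(0, e.1) - R.adL p (⟨_, e.2.2.1⟩, 0), ?_⟩
  rw [map_sub, hR.inclD_adL]
  simp [coordZ]

/-- The argument is (sinh A / A)(sα - Az), and sα - Az comes from the double of 𝔩. There F cancels
the factor sinh A / A, leaving the numerator of F applied to sα - Az; naturality along `inclD`
returns to 𝔡. -/
theorem lcan_sinh_part {p : StrongDual 𝕜 R.l} (hu : IsUnit (opSinhDiv (R.adL p)))
    (e : StrongDual 𝕜 R.l × R.gStar) :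
    ((R.lcan p (opSinhDiv (R.adS p) (R.sD e.1) - opSinh (R.adS p) (R.coordZ e.2)).2, 0) :
        V × StrongDual 𝕜 V)
      = entireCalc (cCothNum 𝕜) (R.adS p) (R.sD e.1)
        - R.adS p (entireCalc (cCothNum 𝕜) (R.adS p) (R.coordZ e.2)) := by
  have : CompleteSpace R.l := FiniteDimensional.complete 𝕜 R.l
  obtain ⟨u, hju⟩ := hR.exists_inclD_eq p e
  have hQ : R.inclD u ∈ Submodule.prod (⊥ : Submodule 𝕜 V) (perp R.m) := by
    rw [hju]; exact sub_mem (hR.sD_mem e.1) (hR.adS_map_P p _ (R.coordZ_mem e.2))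
  have hSju : R.inclD (opSinhDiv (R.adL p) u)
      = opSinhDiv (R.adS p) (R.sD e.1) - opSinh (R.adS p) (R.coordZ e.2) := by
    rw [opSinh_eq, mul_apply_eq_comp]
    refine ((expBounded_cSinhDiv 𝕜).intertwine (hR.inclD_adL p) u).trans ?_
    rw [hju, map_sub, (expBounded_cSinhDiv 𝕜).apply_comm]
    rfl
  have hSu : opSinhDiv (R.adL p) u = (0, (opSinhDiv (R.adL p) u).2) := by
    refine Prod.ext (Subtype.ext ?_) rfl
    have h := (hR.sinh_part_mem p e).1
    rw [← hSju] at h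
    exact h
  have hHju := (expBounded_cCothNum 𝕜).intertwine (hR.inclD_adL p) u
  have hH0 := ((expBounded_cCothNum 𝕜).mem_of_odd
      (fun n hn => by simp [cCothNum, Nat.not_odd_iff_even.2 hn]) (hR.adS_map_Q p)
      (hR.adS_map_P p) hQ).2
  rw [← (expBounded_cCothNum 𝕜).apply_comm, ← map_sub, ← hju, ← hSju]
  refine Prod.ext ?_ hH0.symm
  rw [← hHju]
  exact lcan_s hu hSu

/-- Under the embedding `(z, ξ) ↦ z + ξ + ℓ_p ξ`, the trivialization is a gauge transformation. -/
theorem triv_embedding {p : StrongDual 𝕜 R.l} (hp : p ∈ R.U)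
    (e : StrongDual 𝕜 R.l × R.gStar) :
    R.trivFst p e + R.trivSnd p e + (R.lcan p (R.triv p e).2, 0)
      = famExpDiv G.adD R.sD 1 p (R.sD e.1) - famExp G.adD R.sD 1 p e.2 := by
  obtain ⟨hu1, hu2⟩ := R.mem_U_iff.1 hp
  have h1 : (R.triv p e).2 = (opSinhDiv (R.adS p) (R.sD e.1) - opSinh (R.adS p) (R.coordZ e.2)).2
      - (NormedSpace.exp (R.adS p) (R.coordXi e.2)).2 := rfl
  have h2 : ((R.lcan p (R.triv p e).2, 0) : V × StrongDual 𝕜 V)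
      = (entireCalc (cCothNum 𝕜) (R.adS p) (R.sD e.1)
        - R.adS p (entireCalc (cCothNum 𝕜) (R.adS p) (R.coordZ e.2)))
        - ((NormedSpace.exp (R.adS p) (R.coordXi e.2)).1, 0) := by
    rw [h1, map_sub, hR.lcan_perp hu2, ← hR.lcan_sinh_part hu1 e]
    simp
  have h3 : NormedSpace.exp (R.adS p) (R.coordXi e.2)
      = ((NormedSpace.exp (R.adS p) (R.coordXi e.2)).1, 0)
        + (0, (NormedSpace.exp (R.adS p) (R.coordXi e.2)).2) := by simp
  have h4 : NormedSpace.exp (R.adS p) (e.2 : V × StrongDual 𝕜 V)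
      = NormedSpace.exp (R.adS p) (R.coordZ e.2) + (((NormedSpace.exp (R.adS p) (R.coordXi e.2)).1, 0)
        + (0, (NormedSpace.exp (R.adS p) (R.coordXi e.2)).2)) := by
    rw [← h3, ← map_add, R.coordZ_add_coordXi]
  rw [h2, trivFst_apply, trivSnd_apply, famExpDiv_one, famExp_one, h4, sub_add_eq_sub_sub,
    ← sinh_sub_add_cothNum]
  abel

/-- The term ad*_z p is A applied to the first component, and i* kills the 𝔩^⊥ part. What remains is
sinh A / A - A (sinh A - A)/A² = 1 on sα, while the two sinh A terms in z cancel. No invertibility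
is involved, so p is arbitrary. -/
theorem anchorN_triv (p : StrongDual 𝕜 R.l) (e : StrongDual 𝕜 R.l × R.gStar) :
    R.anchorN p (R.triv p e) = e.1 := by
  set A := R.adS p with hA
  have h1 : R.anchorN p (R.triv p e)
      = R.iStar (R.triv p e).2 - R.subData.adStar (R.triv p e).1 p := rfl
  have h2 : A (R.trivFst p e) = R.sD (R.subData.adStar (R.triv p e).1 p) := by
    rw [hR.trivFst_eq, sD_apply, ← R.adStar_s]
    exact hR.dlie_perp_l (R.triv p e).1.2
  have h3 := hR.sinh_part_mem p e
  have h4 : R.iStar (R.triv p e).2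
      = R.iStar (opSinhDiv A (R.sD e.1) - opSinh A (R.coordZ e.2)).2 := by
    change R.iStar (R.trivSnd p e).2 = _
    rw [trivSnd_apply, Prod.snd_sub, map_sub, R.iStar_eq_zero (hR.exp_coordXi_mem p e.2), sub_zero]
  have h5 : R.sD (R.iStar (R.triv p e).2)
      = opSinhDiv A (R.sD e.1) - opSinh A (R.coordZ e.2) := by
    rw [h4]
    exact Prod.ext h3.1.symm (R.s_iStar h3.2)
  have h6 : R.sD (R.anchorN p (R.triv p e)) = R.sD e.1 := by
    rw [h1, map_sub, h5, ← h2, trivFst_apply, map_sub, ← hA]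
    have e1 : opSinh A (R.coordZ e.2) = A (opSinhDiv A (R.coordZ e.2)) := by rw [opSinh_eq]; rfl
    have e2 : opSinhDiv A (R.sD e.1) = R.sD e.1 + A (opSinhSub A (R.sD e.1)) := by
      rw [opSinhDiv_eq]; rfl
    rw [e1, e2]
    abel
  have h7 := congrArg (fun X : V × StrongDual 𝕜 V => R.iStar X.2) h6
  simpa using h7

/-- On the kernel the anchor gives α = 0, and the gauge form then reads e^A x = 0. -/
theorem triv_injective {p : StrongDual 𝕜 R.l} (hp : p ∈ R.U) : Function.Injective (R.triv p) := by
  rw [injective_iff_map_eq_zero]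
  intro e he
  have h1 : e.1 = 0 := by rw [← hR.anchorN_triv p e, he, map_zero]
  have h2 := hR.triv_embedding hp e
  rw [hR.trivFst_eq, hR.trivSnd_eq, he, h1] at h2
  simp only [map_zero, Prod.fst_zero, Prod.snd_zero, zero_sub] at h2
  have h3 : famExp G.adD R.sD 1 p e.2 = 0 := by
    rw [← neg_eq_zero, ← h2]; simp
  have h4 := congrArg (fun T => T (e.2 : V × StrongDual 𝕜 V))
    (famExp_inv (ad := G.adD) (κ := R.sD) 1 p)
  simp only [mul_apply_eq_comp, h3, map_zero] at h4
  exact Prod.ext h1 (Subtype.ext h4.symm)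

end

end CanonicallyCompatible

end ReductiveDecomposition

/-! ### Smoothness and invertibility of the trivialization -/

section Units

variable {𝕜 E : Type*} [RCLike 𝕜] [NormedAddCommGroup E] [NormedSpace 𝕜 E] [CompleteSpace E]

theorem isOpen_isUnit_clm : IsOpen {A : E →L[𝕜] E | IsUnit A} :=
  Units.isOpen

theorem contDiffAt_inverse_clm {A : E →L[𝕜] E} (h : IsUnit A) :
    ContDiffAt 𝕜 ∞ (Ring.inverse : (E →L[𝕜] E) → (E →L[𝕜] E)) A :=
  contDiffAt_ringInverse 𝕜 h.unit

end Units

namespace ReductiveDecomposition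

variable {𝕜 V : Type*} [RCLike 𝕜] [NormedAddCommGroup V] [NormedSpace 𝕜 V]
  [FiniteDimensional 𝕜 V] {G : LieQuasiBialgebra 𝕜 V}
  (R : ReductiveDecomposition G.toQuasiBialgebraData)

/-- The linear isomorphism `(α, z + ξ) ↦ (z, sα + ξ)`. -/
def fibreEquiv : (StrongDual 𝕜 R.l × R.gStar) ≃ₗ[𝕜] (R.l × StrongDual 𝕜 V) :=
  LinearEquiv.ofBijective
    { toFun := fun e => (⟨_, e.2.2.1⟩, R.s e.1 + (e.2 : V × StrongDual 𝕜 V).2)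
      map_add' := fun a b => by
        refine Prod.ext (Subtype.ext rfl) ?_
        simp only [Prod.fst_add, Prod.snd_add, map_add, Submodule.coe_add]
        abel
      map_smul' := fun c a => by
        refine Prod.ext (Subtype.ext rfl) ?_
        simp } <| by
    constructor
    · rw [injective_iff_map_eq_zero]
      intro e he
      have h1 : (e.2 : V × StrongDual 𝕜 V).1 = 0 := congrArg (fun x => ((x.1 : R.l) : V)) he
      have h2 : R.s e.1 + (e.2 : V × StrongDual 𝕜 V).2 = 0 := congrArg Prod.snd he
      have h3 := congrArg R.iStar h2
      rw [map_add, iStar_s, R.iStar_eq_zero e.2.2.2, add_zero, map_zero] at h3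
      rw [h3, map_zero, zero_add] at h2
      exact Prod.ext h3 (Subtype.ext (Prod.ext h1 h2))
    · rintro ⟨z, η⟩
      refine ⟨(R.iStar η, ⟨((z : V), η - R.s (R.iStar η)), z.2, R.sub_s_iStar_mem η⟩), ?_⟩
      simp

theorem contDiff_entireCalc_adS [CompleteSpace V] {c : ℕ → 𝕜} (hc : ExpBounded c) :
    ContDiff 𝕜 ∞ fun p => entireCalc c (R.adS p) :=
  hc.contDiff.comp (G.adD.contDiff.comp R.sD.contDiff)

theorem contDiff_triv [CompleteSpace V] : ContDiff 𝕜 ∞ R.triv := by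
  have h1 : ContDiff 𝕜 ∞ fun p => opSinhSub (R.adS p) :=
    R.contDiff_entireCalc_adS (expBounded_cSinhSub 𝕜)
  have h2 : ContDiff 𝕜 ∞ fun p => opSinhDiv (R.adS p) :=
    R.contDiff_entireCalc_adS (expBounded_cSinhDiv 𝕜)
  have h3 : ContDiff 𝕜 ∞ fun p => opSinh (R.adS p) :=
    R.contDiff_entireCalc_adS (expBounded_cSinh 𝕜)
  have h4 : ContDiff 𝕜 ∞ fun p => G.dAdExp (0, R.s p) := by
    have : (fun p => G.dAdExp (0, R.s p)) = fun p => entireCalc (cExp 𝕜) (R.adS p) :=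
      funext fun p => exp_eq_entireCalc _
    rw [this]
    exact R.contDiff_entireCalc_adS (expBounded_cExp 𝕜)
  have hF : ContDiff 𝕜 ∞ R.trivFst :=
    (h1.clm_comp contDiff_const).sub (h2.clm_comp contDiff_const)
  have hS : ContDiff 𝕜 ∞ R.trivSnd :=
    ((h2.clm_comp contDiff_const).sub (h3.clm_comp contDiff_const)).sub
      (contDiff_const.clm_comp (h4.clm_comp contDiff_const))
  have e : R.triv = fun p =>
      (ContinuousLinearMap.inl 𝕜 R.l (StrongDual 𝕜 V)).comp
        ((R.pl.comp (ContinuousLinearMap.fst 𝕜 V (StrongDual 𝕜 V))).comp (R.trivFst p))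
      + (ContinuousLinearMap.inr 𝕜 R.l (StrongDual 𝕜 V)).comp
        ((ContinuousLinearMap.snd 𝕜 V (StrongDual 𝕜 V)).comp (R.trivSnd p)) := by
    funext p
    refine ContinuousLinearMap.ext fun e => ?_
    simp [triv]
  rw [e]
  exact (contDiff_const.clm_comp (contDiff_const.clm_comp hF)).add
    (contDiff_const.clm_comp (contDiff_const.clm_comp hS))

theorem contDiff_projAdNeg [CompleteSpace V] : ContDiff 𝕜 ∞ R.projAdNeg := by
  have e : R.projAdNeg = fun p => (ContinuousLinearMap.fst 𝕜 V (StrongDual 𝕜 V)).comp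
      (famExp G.adD R.sD (-1) p) := funext fun p => R.projAdNeg_eq p
  rw [e]
  exact contDiff_const.clm_comp (contDiff_right_of_uncurry (contDiff_famExp _ _) _)

theorem contDiff_projAdNegIncl [CompleteSpace V] : ContDiff 𝕜 ∞ R.projAdNegIncl :=
  R.contDiff_projAdNeg.clm_comp contDiff_const

variable {R} (hR : R.CanonicallyCompatible)
include hR

namespace CanonicallyCompatible

/-- Linearity in p is read off in 𝔡 through the injection `inclD`, where `adD` is already bilinear.
-/
theorem contDiff_adL : ContDiff 𝕜 ∞ R.adL := by
  let L : StrongDual 𝕜 R.l →ₗ[𝕜]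
      ((R.l × StrongDual 𝕜 R.l) →L[𝕜] (R.l × StrongDual 𝕜 R.l)) :=
    { toFun := R.adL
      map_add' := fun p q => ContinuousLinearMap.ext fun x => R.inclD_injective <| by
        rw [add_apply, map_add, hR.inclD_adL, hR.inclD_adL, hR.inclD_adL, adS_eq, adS_eq, adS_eq,
          map_add, map_add, add_apply]
      map_smul' := fun c p => ContinuousLinearMap.ext fun x => R.inclD_injective <| by
        rw [smul_apply, map_smul, hR.inclD_adL, hR.inclD_adL, adS_eq, adS_eq,
          map_smul, map_smul, smul_apply]
        rfl }
  exact (LinearMap.toContinuousLinearMap L).contDiff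

theorem contDiff_entireCalc_adL {c : ℕ → 𝕜} (hc : ExpBounded c) :
    ContDiff 𝕜 ∞ fun p => entireCalc c (R.adL p) := by
  have : CompleteSpace R.l := FiniteDimensional.complete 𝕜 R.l
  exact hc.contDiff.comp hR.contDiff_adL

theorem isOpen_U : IsOpen R.U := by
  have : CompleteSpace V := FiniteDimensional.complete 𝕜 V
  have : CompleteSpace R.l := FiniteDimensional.complete 𝕜 R.l
  have e : R.U = (fun p => opSinhDiv (R.adL p)) ⁻¹' {A | IsUnit A}
      ∩ R.projAdNegIncl ⁻¹' {A | IsUnit A} := Set.ext fun p => R.mem_U_iff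
  rw [e]
  exact (isOpen_isUnit_clm.preimage (hR.contDiff_entireCalc_adL (expBounded_cSinhDiv 𝕜)).continuous).inter
    (isOpen_isUnit_clm.preimage R.contDiff_projAdNegIncl.continuous)

theorem contDiffAt_lcan {p : StrongDual 𝕜 R.l} (hp : p ∈ R.U) : ContDiffAt 𝕜 ∞ R.lcan p := by
  have : CompleteSpace V := FiniteDimensional.complete 𝕜 V
  have : CompleteSpace R.l := FiniteDimensional.complete 𝕜 R.l
  obtain ⟨hu1, hu2⟩ := R.mem_U_iff.1 hp
  have h1 : ContDiffAt 𝕜 ∞ (fun q => Ring.inverse (opSinhDiv (R.adL q))) p := by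
    exact ContDiffAt.comp p (contDiffAt_inverse_clm hu1)
      (hR.contDiff_entireCalc_adL (expBounded_cSinhDiv 𝕜)).contDiffAt
  have h2 : ContDiffAt 𝕜 ∞ (fun q => Ring.inverse (R.projAdNegIncl q)) p := by
    exact ContDiffAt.comp p (contDiffAt_inverse_clm hu2) R.contDiff_projAdNegIncl.contDiffAt
  have h3 : ContDiffAt 𝕜 ∞ (fun q => opCothSubInv (R.adL q)) p :=
    h1.clm_comp (hR.contDiff_entireCalc_adL (expBounded_cCothNum 𝕜)).contDiffAt
  have h4 : ContDiffAt 𝕜 ∞ R.rAM p :=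
    (contDiffAt_const.clm_comp h3).clm_comp contDiffAt_const
  exact ((contDiffAt_const.clm_comp h4).clm_comp contDiffAt_const).sub
    ((h2.clm_comp (R.contDiff_projAdNeg.contDiffAt.clm_comp contDiffAt_const)).clm_comp
      contDiffAt_const)

/-- Both fibres have the same dimension by `fibreEquiv`, so injectivity is enough. -/
theorem triv_bijective {p : StrongDual 𝕜 R.l} (hp : p ∈ R.U) : Function.Bijective (R.triv p) := by
  have : CompleteSpace V := FiniteDimensional.complete 𝕜 V
  have hi := hR.triv_injective hp
  exact ⟨hi, (LinearMap.injective_iff_surjective_of_finrank_eq_finrank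
    (f := (R.triv p : (StrongDual 𝕜 R.l × R.gStar) →ₗ[𝕜] (R.l × StrongDual 𝕜 V)))
    R.fibreEquiv.finrank_eq).1 hi⟩

/-- `T_p` as an isomorphism. -/
def trivEquiv {p : StrongDual 𝕜 R.l} (hp : p ∈ R.U) :
    (StrongDual 𝕜 R.l × R.gStar) ≃L[𝕜] (R.l × StrongDual 𝕜 V) :=
  (LinearEquiv.ofBijective (R.triv p : (StrongDual 𝕜 R.l × R.gStar) →ₗ[𝕜] (R.l × StrongDual 𝕜 V))
    (hR.triv_bijective hp)).toContinuousLinearEquiv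

theorem coe_trivEquiv {p : StrongDual 𝕜 R.l} (hp : p ∈ R.U) :
    (hR.trivEquiv hp : (StrongDual 𝕜 R.l × R.gStar) →L[𝕜] (R.l × StrongDual 𝕜 V)) = R.triv p := rfl

theorem exists_inverse_triv : ∃ S : StrongDual 𝕜 R.l →
    (R.l × StrongDual 𝕜 V) →L[𝕜] (StrongDual 𝕜 R.l × R.gStar), ContDiffOn 𝕜 ∞ S R.U ∧
    ∀ p ∈ R.U, (∀ e, S p (R.triv p e) = e) ∧ ∀ e', R.triv p (S p e') = e' := by
  have : CompleteSpace V := FiniteDimensional.complete 𝕜 V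
  have : CompleteSpace R.gStar := FiniteDimensional.complete 𝕜 R.gStar
  -- The default value of `inverse` at non-invertible maps plays no role on U.
  refine ⟨fun p => ContinuousLinearMap.inverse (R.triv p), fun p hp => ?_, fun p hp => ?_⟩
  · have h := contDiffAt_map_inverse (n := ∞) (hR.trivEquiv hp)
    rw [hR.coe_trivEquiv hp] at h
    exact (ContDiffAt.comp p h R.contDiff_triv.contDiffAt).contDiffWithinAt
  · simp only [← hR.coe_trivEquiv hp, ContinuousLinearMap.inverse_equiv]
    exact ⟨fun e => (hR.trivEquiv hp).symm_apply_apply e,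
      fun e => (hR.trivEquiv hp).apply_symm_apply e⟩

/-- `ℓ_p` is skew-symmetric. -/
theorem lcan_self {p : StrongDual 𝕜 R.l} (hp : p ∈ R.U) (ξ : StrongDual 𝕜 V) :
    ξ (R.lcan p ξ) = 0 := by
  have : CompleteSpace V := FiniteDimensional.complete 𝕜 V
  -- For this e, the gauge image Θa - Ex equals ξ + ℓ_p ξ, whose pairing with itself is 2⟨ξ, ℓ_p ξ⟩.
  obtain ⟨e, he⟩ := (hR.triv_bijective hp).2 ((0 : R.l), ξ)
  have hξ : (R.triv p e).2 = ξ := by rw [he]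
  have hz : (R.triv p e).1 = 0 := by rw [he]
  have h := hR.isSymmetricPair
  set Θ := famExpDiv G.adD R.sD 1 p with hΘ
  set E := famExp G.adD R.sD 1 p with hE
  set S := opSinhDiv (R.adS p) with hS
  set a := R.sD e.1 with ha
  set x : V × StrongDual 𝕜 V := (e.2 : V × StrongDual 𝕜 V) with hx
  have h1 := hR.triv_embedding hp e
  have h2 : dpair 𝕜 V (Θ a - E x) (Θ a - E x) = 2 * ξ (R.lcan p ξ) := by
    rw [← h1, hR.trivFst_eq, hR.trivSnd_eq, hξ, hz]
    simp [two_mul]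
  -- Θa and Ex are isotropic, so only the cross terms survive.
  have h3 : dpair 𝕜 V (Θ a - E x) (Θ a - E x) = -2 * dpair 𝕜 V (S a) x := by
    have i1 := h.expDiv_isotropic 1 p e.1 e.1
    have i2 := h.expDiv_pairing_exp_N 1 p e.1 e.2.2
    have i3 := h.exp_isometry 1 p x x
    rw [h.isotropic_N x e.2.2 x e.2.2] at i3
    rw [famSinhDiv_one, one_smul] at i2
    have i4 := dpair_symm (E x) (Θ a)
    simp only [map_sub, sub_apply]
    linear_combination i1 - 2 * i2 + i3 - i4
  have h4 : S (R.coordZ e.2) = famSinhSub G.adD R.sD 1 p a := by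
    have := hR.trivFst_eq p e
    rw [trivFst_apply, hz, ← famSinhSub_one] at this
    exact (sub_eq_zero.1 this).symm
  -- The vanishing first component of T_p e gives Sz = ((sinh A - A)/A²) a. Self-adjointness of S
  -- then yields the pairing of a with its image under a skew-adjoint operator.
  have h5 : dpair 𝕜 V (S a) x = 0 := by
    have j1 := h.sinhDiv_adjoint 1 p a (R.coordZ e.2)
    have j2 := h.sinhSub_adjoint 1 p a a
    rw [dpair_symm, ← sub_eq_zero, sub_neg_eq_add, ← two_mul] at j2
    have j3 : dpair 𝕜 V (S a) (R.coordXi e.2) = 0 := by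
      have : (S a).1 = 0 := ((expBounded_cSinhDiv 𝕜).mem_of_even
        (fun n hn => by simp [cSinhDiv, hn]) (hR.adS_map_Q p) (hR.adS_map_P p) (hR.sD_mem e.1)).1
      simp [this, coordXi]
    rw [famSinhDiv_one, ← hS, h4] at j1
    rw [hx, ← R.coordZ_add_coordXi, map_add, j3, add_zero, j1]
    exact (mul_eq_zero.1 j2).resolve_left two_ne_zero
  rw [h2, h5, mul_zero] at h3
  exact (mul_eq_zero.1 h3).resolve_left two_ne_zero

theorem lcan_skew {p : StrongDual 𝕜 R.l} (hp : p ∈ R.U) (ξ η : StrongDual 𝕜 V) :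
    ξ (R.lcan p η) = -η (R.lcan p ξ) := by
  have h := hR.lcan_self hp (ξ + η)
  simp only [map_add, add_apply, hR.lcan_self hp, zero_add, add_zero] at h
  exact eq_neg_of_add_eq_zero_right h

end CanonicallyCompatible

end ReductiveDecomposition

/-! ### Trivial Lie algebroids and transport of Lie algebroid structures -/

section Algebroids

variable {𝕜 B E E' : Type*} [RCLike 𝕜] [NormedAddCommGroup B] [NormedSpace 𝕜 B]
  [NormedAddCommGroup E] [NormedSpace 𝕜 E] [NormedAddCommGroup E'] [NormedSpace 𝕜 E']

theorem fderiv_clm_comp_apply (L : E →L[𝕜] E') {f : B → E} {p : B} (hf : DifferentiableAt 𝕜 f p)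
    (v : B) : fderiv 𝕜 (fun q => L (f q)) p v = L (fderiv 𝕜 f p v) := by
  have h : HasFDerivAt (fun q => L (f q)) (L.comp (fderiv 𝕜 f p)) p :=
    L.hasFDerivAt.comp p hf.hasFDerivAt
  rw [h.fderiv]; rfl

theorem fderiv_clm_apply_apply {c : B → E →L[𝕜] E'} {f : B → E} {p : B}
    (hc : DifferentiableAt 𝕜 c p) (hf : DifferentiableAt 𝕜 f p) (v : B) :
    fderiv 𝕜 (fun q => c q (f q)) p v = fderiv 𝕜 c p v (f p) + c p (fderiv 𝕜 f p v) := by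
  rw [fderiv_clm_apply hc hf]
  simp [add_comm]

theorem ContDiffOn.contDiffAt_of_isOpen {F : Type*} [NormedAddCommGroup F] [NormedSpace 𝕜 F]
    {f : B → F} {W : Set B} (h : ContDiffOn 𝕜 ∞ f W) (hW : IsOpen W) {p : B} (hp : p ∈ W) :
    ContDiffAt 𝕜 ∞ f p := h.contDiffAt (hW.mem_nhds hp)

theorem ContDiffOn.differentiableAt_of_isOpen {F : Type*} [NormedAddCommGroup F]
    [NormedSpace 𝕜 F] {f : B → F} {W : Set B} (h : ContDiffOn 𝕜 ∞ f W) (hW : IsOpen W) {p : B}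
    (hp : p ∈ W) : DifferentiableAt 𝕜 f p :=
  (h.contDiffAt_of_isOpen hW hp).differentiableAt (by simp)

theorem contDiffOn_fderiv_apply {F : Type*} [NormedAddCommGroup F] [NormedSpace 𝕜 F]
    {f : B → F} {a : B → B} {W : Set B} (hW : IsOpen W) (hf : ContDiffOn 𝕜 ∞ f W)
    (ha : ContDiffOn 𝕜 ∞ a W) : ContDiffOn 𝕜 ∞ (fun p => fderiv 𝕜 f p (a p)) W :=
  (hf.fderiv_of_isOpen hW (by simp)).clm_apply ha

theorem minSmoothness_le_infty : minSmoothness 𝕜 2 ≤ ∞ := by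
  simpa using WithTop.coe_le_coe.2 (le_top : (2 : ℕ∞) ≤ ⊤)

theorem fderiv_eq_of_eqOn {F : Type*} [NormedAddCommGroup F] [NormedSpace 𝕜 F] {f g : B → F}
    {W : Set B} (hW : IsOpen W) (h : Set.EqOn f g W) {p : B} (hp : p ∈ W) :
    fderiv 𝕜 f p = fderiv 𝕜 g p :=
  (Filter.eventuallyEq_of_mem (hW.mem_nhds hp) h).fderiv_eq

theorem lieBracket_eq_of_eqOn {f f' g g' : B → B} {W : Set B} (hW : IsOpen W)
    (hf : Set.EqOn f f' W) (hg : Set.EqOn g g' W) {p : B} (hp : p ∈ W) :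
    VectorField.lieBracket 𝕜 f g p = VectorField.lieBracket 𝕜 f' g' p := by
  simp only [VectorField.lieBracket, fderiv_eq_of_eqOn hW hf hp, fderiv_eq_of_eqOn hW hg hp,
    hf hp, hg hp]

theorem isLieAlgebroid_trivialAlgebroid [CompleteSpace B] {U : Set B} (hU : IsOpen U)
    (L : E →L[𝕜] E →L[𝕜] E) {br : E → E → E} (hbr : ∀ x y, br x y = L x y)
    (hself : ∀ x, L x x = 0) (hskew : ∀ x y, L x y = -L y x)
    (hjac : ∀ x y z, L x (L y z) = L (L x y) z + L y (L x z)) :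
    IsLieAlgebroid U (trivialAlgebroid 𝕜 (B := B) br) where
  isOpen := hU
  smooth_anchor := contDiffOn_const
  smooth_bracket W _ hW σ τ hσ hτ := by
    simp only [trivialAlgebroid, hbr, VectorField.lieBracket]
    exact ((contDiffOn_fderiv_apply hW hτ.fst hσ.fst).sub
      (contDiffOn_fderiv_apply hW hσ.fst hτ.fst)).prodMk
      (((contDiffOn_fderiv_apply hW hτ.snd hσ.fst).sub
        (contDiffOn_fderiv_apply hW hσ.snd hτ.fst)).add
        ((L.contDiff.comp_contDiffOn hσ.snd).clm_apply hτ.snd))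
  bracket_congr W _ hW σ σ' τ _ _ h p hp := by
    have h1 : Set.EqOn (fun q => (σ q).1) (fun q => (σ' q).1) W := fun q hq => by simp [h hq]
    have h2 : Set.EqOn (fun q => (σ q).2) (fun q => (σ' q).2) W := fun q hq => by simp [h hq]
    simp only [trivialAlgebroid, lieBracket_eq_of_eqOn hW h1 (Set.eqOn_refl _ W) hp,
      fderiv_eq_of_eqOn hW h2 hp, h hp]
  bracket_add W _ hW σ τ τ' hσ hτ hτ' p hp := by
    have d1 := hτ.fst.differentiableAt_of_isOpen hW hp
    have d2 := hτ.snd.differentiableAt_of_isOpen hW hp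
    have d1' := hτ'.fst.differentiableAt_of_isOpen hW hp
    have d2' := hτ'.snd.differentiableAt_of_isOpen hW hp
    simp only [trivialAlgebroid, hbr, VectorField.lieBracket, Pi.add_apply, Prod.fst_add,
      Prod.snd_add, fderiv_fun_add d1 d1', fderiv_fun_add d2 d2', map_add, add_apply,
      Prod.mk_add_mk]
    congr 1 <;> abel
  bracket_self W _ hW σ hσ p hp := by
    simp [trivialAlgebroid, hbr, hself]
  bracket_skew W _ hW σ τ hσ hτ p hp := by
    simp only [trivialAlgebroid, hbr, VectorField.lieBracket, Pi.neg_apply, Prod.neg_mk]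
    rw [hskew]
    congr 1 <;> abel
  jacobi W _ hW σ τ υ hσ hτ hυ p hp := by
    -- The derivative along a Lie bracket of vector fields is the commutator of derivatives; this
    -- removes all second derivatives from the fibre part of Jacobi, leaving the pointwise Jacobi
    -- identity of `L`.
    have hd := fun {y : B → E} {a b : B → B} (hy : ContDiffOn 𝕜 ∞ y W) (ha : ContDiffOn 𝕜 ∞ a W)
      (hb : ContDiffOn 𝕜 ∞ b W) => VectorField.fderiv_apply_lieBracket
        (hy.contDiffAt_of_isOpen hW hp) minSmoothness_le_infty
        (hb.differentiableAt_of_isOpen hW hp) (ha.differentiableAt_of_isOpen hW hp)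
    have hL : ∀ {x y : B → E}, ContDiffOn 𝕜 ∞ x W → ContDiffOn 𝕜 ∞ y W →
        DifferentiableAt 𝕜 (fun q => L (x q) (y q)) p ∧ ∀ v,
        fderiv 𝕜 (fun q => L (x q) (y q)) p v
          = L (fderiv 𝕜 x p v) (y p) + L (x p) (fderiv 𝕜 y p v) := fun {x y} hx hy => by
      have dx := hx.differentiableAt_of_isOpen hW hp
      have dy := hy.differentiableAt_of_isOpen hW hp
      have dL : DifferentiableAt 𝕜 (fun q => L (x q)) p := L.differentiableAt.comp p dx
      refine ⟨dL.clm_apply dy, fun v => ?_⟩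
      rw [fderiv_clm_apply_apply dL dy, fderiv_clm_comp_apply L dx]
    have key : ∀ {σ τ υ : B → B × E}, ContDiffOn 𝕜 ∞ σ W → ContDiffOn 𝕜 ∞ τ W →
        ContDiffOn 𝕜 ∞ υ W → ∀ v,
        fderiv 𝕜 (fun q => fderiv 𝕜 (fun r => (υ r).2) q (τ q).1
            - fderiv 𝕜 (fun r => (τ r).2) q (υ q).1 + L (τ q).2 (υ q).2) p v
          = fderiv 𝕜 (fun q => fderiv 𝕜 (fun r => (υ r).2) q (τ q).1) p v
            - fderiv 𝕜 (fun q => fderiv 𝕜 (fun r => (τ r).2) q (υ q).1) p v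
            + (L (fderiv 𝕜 (fun r => (τ r).2) p v) (υ p).2
              + L (τ p).2 (fderiv 𝕜 (fun r => (υ r).2) p v)) := fun {σ τ υ} hσ hτ hυ v => by
      have d1 := (contDiffOn_fderiv_apply hW hυ.snd hτ.fst).differentiableAt_of_isOpen hW hp
      have d2 := (contDiffOn_fderiv_apply hW hτ.snd hυ.fst).differentiableAt_of_isOpen hW hp
      obtain ⟨d3, e3⟩ := hL hτ.snd hυ.snd
      have d12 : DifferentiableAt 𝕜 (fun q => fderiv 𝕜 (fun r => (υ r).2) q (τ q).1
          - fderiv 𝕜 (fun r => (τ r).2) q (υ q).1) p := d1.sub d2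
      rw [fderiv_fun_add d12 d3, fderiv_fun_sub d1 d2, add_apply, sub_apply, e3]
    simp only [trivialAlgebroid, hbr, Pi.add_apply, Prod.mk_add_mk]
    refine Prod.ext ?_ ?_
    · exact VectorField.leibniz_identity_lieBracket minSmoothness_le_infty
        (hσ.fst.contDiffAt_of_isOpen hW hp) (hτ.fst.contDiffAt_of_isOpen hW hp)
        (hυ.fst.contDiffAt_of_isOpen hW hp)
    · simp only [key hσ hτ hυ, key hυ hσ hτ, key hτ hσ hυ, hd hσ.snd hτ.fst hυ.fst,
        hd hυ.snd hσ.fst hτ.fst, hd hτ.snd hσ.fst hυ.fst, map_add, map_sub, add_apply, sub_apply,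
        hjac (σ p).2 (τ p).2 (υ p).2]
      rw [hskew (fderiv 𝕜 (fun r => (σ r).2) p (τ p).1) (υ p).2,
        hskew (fderiv 𝕜 (fun r => (τ r).2) p (σ p).1) (υ p).2,
        hskew (fderiv 𝕜 (fun r => (σ r).2) p (υ p).1) (τ p).2]
      abel
  leibniz W _ hW f σ τ hf hσ hτ p hp := by
    have df := hf.differentiableAt_of_isOpen hW hp
    have d1 := hτ.fst.differentiableAt_of_isOpen hW hp
    have d2 := hτ.snd.differentiableAt_of_isOpen hW hp
    simp only [trivialAlgebroid, hbr, VectorField.lieBracket, Prod.smul_fst, Prod.smul_snd,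
      fderiv_fun_smul df d1, fderiv_fun_smul df d2, map_smul, add_apply, smul_apply,
      ContinuousLinearMap.smulRight_apply, ContinuousLinearMap.coe_fst']
    refine Prod.ext ?_ ?_
    · simp only [Prod.fst_add, Prod.smul_fst, smul_sub]; abel
    · simp only [Prod.snd_add, Prod.smul_snd, smul_sub, smul_add]; abel
  anchor_bracket W _ hW σ τ hσ hτ p hp := rfl

/-- A bracket which is isomorphic to that of a Lie algebroid defines a Lie algebroid. -/
theorem IsLieAlgebroid.of_iso {U : Set B} {A : AlgebroidData 𝕜 B E} {A' : AlgebroidData 𝕜 B E'}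
    {T : B → E →L[𝕜] E'} (hA : IsLieAlgebroid U A) (hT : IsLieAlgebroidIso U A A' T)
    (hloc : ∀ W ⊆ U, IsOpen W → ∀ σ σ' τ τ' : B → E', Set.EqOn σ σ' W → Set.EqOn τ τ' W →
      Set.EqOn (A'.bracket σ τ) (A'.bracket σ' τ') W) :
    IsLieAlgebroid U A' := by
  obtain ⟨S, hS, hST⟩ := hT.exists_inverse
  have hanchor : ∀ p ∈ U, ∀ e, A'.anchor p e = A.anchor p (S p e) := fun p hp e => by
    rw [← hT.anchor_comp p hp, (hST p hp).2]
  have smooth : ∀ {W}, W ⊆ U → ∀ {σ : B → E'}, ContDiffOn 𝕜 ∞ σ W →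
      ContDiffOn 𝕜 ∞ (fun q => S q (σ q)) W := fun {W} hWU {σ} hσ => (hS.mono hWU).clm_apply hσ
  have key : ∀ {W}, W ⊆ U → IsOpen W → ∀ {σ τ : B → E'}, ContDiffOn 𝕜 ∞ σ W →
      ContDiffOn 𝕜 ∞ τ W → Set.EqOn (A'.bracket σ τ)
        (fun p => T p (A.bracket (fun q => S q (σ q)) (fun q => S q (τ q)) p)) W :=
    fun {W} hWU hW {σ τ} hσ hτ p hp => by
      simp only
      rw [hT.map_bracket _ hWU hW _ _ (smooth hWU hσ) (smooth hWU hτ) p hp]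
      exact hloc _ hWU hW _ _ _ _ (fun q hq => ((hST q (hWU hq)).2 _).symm)
        (fun q hq => ((hST q (hWU hq)).2 _).symm) hp
  -- Needed for nested brackets: S applied to an A'-bracket is again an A-bracket, though only on
  -- `W`, so locality must be invoked before it can be substituted inside another bracket.
  have key' : ∀ {W}, W ⊆ U → IsOpen W → ∀ {σ τ : B → E'}, ContDiffOn 𝕜 ∞ σ W →
      ContDiffOn 𝕜 ∞ τ W → Set.EqOn (A.bracket (fun q => S q (σ q)) (fun q => S q (τ q)))
        (fun p => S p (A'.bracket σ τ p)) W := fun {W} hWU hW {σ τ} hσ hτ p hp => by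
    simp only
    rw [key hWU hW hσ hτ hp, (hST p (hWU hp)).1]
  have smooth_br : ∀ {W}, W ⊆ U → IsOpen W → ∀ {σ τ : B → E'}, ContDiffOn 𝕜 ∞ σ W →
      ContDiffOn 𝕜 ∞ τ W → ContDiffOn 𝕜 ∞ (A'.bracket σ τ) W := fun {W} hWU hW {σ τ} hσ hτ =>
    ((hT.smooth.mono hWU).clm_apply (hA.smooth_bracket _ hWU hW _ _ (smooth hWU hσ)
      (smooth hWU hτ))).congr (key hWU hW hσ hτ)
  -- The laws give locality in the first argument; skewness carries it to the second.
  have congr_right : ∀ {W}, W ⊆ U → IsOpen W → ∀ {σ τ τ' : B → E}, ContDiffOn 𝕜 ∞ σ W →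
      ContDiffOn 𝕜 ∞ τ W → Set.EqOn τ τ' W →
      Set.EqOn (A.bracket σ τ) (A.bracket σ τ') W := fun {W} hWU hW {σ τ τ'} hσ hτ h p hp => by
    have hτ' : ContDiffOn 𝕜 ∞ τ' _ := hτ.congr fun q hq => (h hq).symm
    rw [hA.bracket_skew _ hWU hW _ _ hσ hτ hp, hA.bracket_skew _ hWU hW _ _ hσ hτ' hp,
      Pi.neg_apply, Pi.neg_apply, hA.bracket_congr _ hWU hW _ _ _ hτ hσ h hp]
  exact
  { isOpen := hA.isOpen
    smooth_anchor := (hA.smooth_anchor.clm_comp hS).congr fun p hp =>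
      ContinuousLinearMap.ext fun e => hanchor p hp e
    smooth_bracket := fun W hWU hW σ τ hσ hτ => smooth_br hWU hW hσ hτ
    bracket_congr := fun W hWU hW σ σ' τ _ _ h => hloc W hWU hW _ _ _ _ h (Set.eqOn_refl _ _)
    bracket_add := fun W hWU hW σ τ τ' hσ hτ hτ' p hp => by
      have h := hA.bracket_add W hWU hW _ _ _ (smooth hWU hσ) (smooth hWU hτ) (smooth hWU hτ') hp
      rw [Pi.add_apply] at h ⊢
      rw [key (τ := τ + τ') hWU hW hσ (hτ.add hτ') hp, key hWU hW hσ hτ hp, key hWU hW hσ hτ' hp]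
      simp only
      rw [← map_add, ← h]
      congr 2
      funext q
      simp
    bracket_self := fun W hWU hW σ hσ p hp => by
      rw [key hWU hW hσ hσ hp]
      simp only
      rw [hA.bracket_self W hWU hW _ (smooth hWU hσ) hp]
      simp
    bracket_skew := fun W hWU hW σ τ hσ hτ p hp => by
      rw [Pi.neg_apply, key hWU hW hσ hτ hp, key hWU hW hτ hσ hp]
      simp only
      rw [hA.bracket_skew W hWU hW _ _ (smooth hWU hσ) (smooth hWU hτ) hp]
      simp
    jacobi := fun W hWU hW σ τ υ hσ hτ hυ p hp => by
      have h := hA.jacobi W hWU hW _ _ _ (smooth hWU hσ) (smooth hWU hτ) (smooth hWU hυ) hp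
      rw [Pi.add_apply] at h ⊢
      have c1 := congr_right hWU hW (smooth hWU hσ)
        (hA.smooth_bracket W hWU hW _ _ (smooth hWU hτ) (smooth hWU hυ)) (key' hWU hW hτ hυ) hp
      have c2 := congr_right hWU hW (smooth hWU hτ)
        (hA.smooth_bracket W hWU hW _ _ (smooth hWU hσ) (smooth hWU hυ)) (key' hWU hW hσ hυ) hp
      have c3 := hA.bracket_congr W hWU hW _ _ _
        (hA.smooth_bracket W hWU hW _ _ (smooth hWU hσ) (smooth hWU hτ)) (smooth hWU hυ)
        (key' hWU hW hσ hτ) hp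
      rw [key hWU hW hσ (smooth_br hWU hW hτ hυ) hp, key hWU hW (smooth_br hWU hW hσ hτ) hυ hp,
        key hWU hW hτ (smooth_br hWU hW hσ hυ) hp]
      simp only
      rw [← c1, ← c2, ← c3, h, map_add]
    leibniz := fun W hWU hW f σ τ hf hσ hτ p hp => by
      have h := hA.leibniz W hWU hW f _ _ hf (smooth hWU hσ) (smooth hWU hτ) p hp
      rw [key (τ := fun q => f q • τ q) hWU hW hσ (hf.smul hτ) hp, key hWU hW hσ hτ hp, hanchor p (hWU hp)]
      simp only [map_smul]
      rw [h, map_add, map_smul, map_smul, (hST p (hWU hp)).2]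
    anchor_bracket := fun W hWU hW σ τ hσ hτ p hp => by
      rw [key hWU hW hσ hτ hp, hT.anchor_comp p (hWU hp),
        hA.anchor_bracket W hWU hW _ _ (smooth hWU hσ) (smooth hWU hτ) p hp]
      exact lieBracket_eq_of_eqOn hW (fun q hq => (hanchor q (hWU hq) _).symm)
        (fun q hq => (hanchor q (hWU hq) _).symm) hp }

end Algebroids

/-! ### The trivialization intertwines the brackets -/

namespace ReductiveDecomposition

variable {𝕜 V : Type*} [RCLike 𝕜] [NormedAddCommGroup V] [NormedSpace 𝕜 V]
  [FiniteDimensional 𝕜 V]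

theorem algebroidN_bracket_eqOn {G : QuasiBialgebraData 𝕜 V} (R : ReductiveDecomposition G)
    (ell : StrongDual 𝕜 R.l → StrongDual 𝕜 V →L[𝕜] V) {W : Set (StrongDual 𝕜 R.l)}
    (hW : IsOpen W) {σ σ' τ τ' : StrongDual 𝕜 R.l → R.l × StrongDual 𝕜 V}
    (hσ : Set.EqOn σ σ' W) (hτ : Set.EqOn τ τ' W) :
    Set.EqOn ((R.algebroidN ell).bracket σ τ) ((R.algebroidN ell).bracket σ' τ') W := by
  intro p hp
  have h1 : Set.EqOn (fun q => (σ q).1) (fun q => (σ' q).1) W := fun q hq => by simp [hσ hq]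
  have h2 : Set.EqOn (fun q => (σ q).2) (fun q => (σ' q).2) W := fun q hq => by simp [hσ hq]
  have h3 : Set.EqOn (fun q => (τ q).1) (fun q => (τ' q).1) W := fun q hq => by simp [hτ hq]
  have h4 : Set.EqOn (fun q => (τ q).2) (fun q => (τ' q).2) W := fun q hq => by simp [hτ hq]
  simp only [algebroidN, fderiv_eq_of_eqOn hW h1 hp, fderiv_eq_of_eqOn hW h2 hp,
    fderiv_eq_of_eqOn hW h3 hp, fderiv_eq_of_eqOn hW h4 hp, hσ hp, hτ hp]

theorem differentiableAt_triv [CompleteSpace V] {G : LieQuasiBialgebra 𝕜 V}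
    (R : ReductiveDecomposition G.toQuasiBialgebraData) (p : StrongDual 𝕜 R.l) :
    DifferentiableAt 𝕜 R.triv p :=
  R.contDiff_triv.differentiable (by simp) p

variable {G : LieQuasiBialgebra 𝕜 V} {R : ReductiveDecomposition G.toQuasiBialgebraData}
  (hR : R.CanonicallyCompatible)
include hR

namespace CanonicallyCompatible

/-- The bracket of `𝔤⋆₀` as a continuous bilinear map. -/
def gStarL : R.gStar →L[𝕜] R.gStar →L[𝕜] R.gStar :=
  LinearMap.toContinuousLinearMap
    { toFun := fun x => ((G.adD x).comp R.gStar.subtypeL).codRestrict R.gStar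
        fun y => R.dlie_mem_gStar hR x.2 y.2
      map_add' := fun x y => by
        ext1 w
        exact Subtype.ext (congrArg (fun T => T (w : V × StrongDual 𝕜 V)) (G.adD.map_add x y))
      map_smul' := fun c x => by
        ext1 w
        exact Subtype.ext (congrArg (fun T => T (w : V × StrongDual 𝕜 V)) (G.adD.map_smul c x)) }

theorem isLieAlgebroid_trivial :
    IsLieAlgebroid R.U (trivialAlgebroid 𝕜 (B := StrongDual 𝕜 R.l) (R.gStarLie hR)) := by
  have : CompleteSpace (StrongDual 𝕜 R.l) := FiniteDimensional.complete 𝕜 _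
  exact isLieAlgebroid_trivialAlgebroid hR.isOpen_U hR.gStarL (fun x y => rfl)
    (fun x => Subtype.ext (G.dlie_self x)) (fun x y => Subtype.ext (G.dlie_skew x y))
    (fun x y z => Subtype.ext (G.dlie_jacobi x y z))

theorem fderiv_lcan_skew {p : StrongDual 𝕜 R.l} (hp : p ∈ R.U) (Y : StrongDual 𝕜 R.l)
    (ξ η : StrongDual 𝕜 V) :
    ξ (fderiv 𝕜 R.lcan p Y η) = -η (fderiv 𝕜 R.lcan p Y ξ) := by
  have hd := (hR.contDiffAt_lcan hp).differentiableAt (by simp)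
  have key : ∀ ξ η : StrongDual 𝕜 V,
      fderiv 𝕜 (fun q => ξ (R.lcan q η)) p Y = ξ (fderiv 𝕜 R.lcan p Y η) := fun ξ η => by
    rw [fderiv_clm_comp_apply ξ (hd.clm_apply (differentiableAt_const η)),
      fderiv_clm_apply_apply hd (differentiableAt_const η)]
    simp
  rw [← key, ← key, fderiv_eq_of_eqOn hR.isOpen_U (fun q hq => hR.lcan_skew hq ξ η) hp,
    fderiv_fun_neg, neg_apply]

section
variable [CompleteSpace V]

theorem gauge_eq {p : StrongDual 𝕜 R.l} (hp : p ∈ R.U) (e : StrongDual 𝕜 R.l × R.gStar) :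
    (((R.triv p e).1 : V) + R.lcan p (R.triv p e).2, (R.triv p e).2)
      = famExpDiv G.adD R.sD 1 p (R.sD e.1) - famExp G.adD R.sD 1 p e.2 := by
  rw [← hR.triv_embedding hp, hR.trivFst_eq, hR.trivSnd_eq]
  simp

/-- The 𝔩-part of x may be replaced by x itself, because sinh A / A is self-adjoint and keeps sY in
s𝔩*, which pairs to zero with 𝔩^⊥. This gives the form used in `dorfman_identity`. -/
theorem apply_triv_fst (p Y : StrongDual 𝕜 R.l) (e : StrongDual 𝕜 R.l × R.gStar) :
    Y (R.triv p e).1 = dpair 𝕜 V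
      (famSinhSub G.adD R.sD 1 p (R.sD e.1) - famSinhDiv G.adD R.sD 1 p e.2) (R.sD Y) := by
  have h1 : Y (R.triv p e).1 = dpair 𝕜 V (R.trivFst p e) (R.sD Y) := by
    simp [triv]
  have h2 : dpair 𝕜 V (famSinhDiv G.adD R.sD 1 p (R.coordXi e.2)) (R.sD Y) = 0 := by
    rw [hR.isSymmetricPair.sinhDiv_adjoint]
    have h3 : (famSinhDiv G.adD R.sD 1 p (R.sD Y)).1 = 0 :=
      (hR.isSymmetricPair.sinhDiv_mem_Q 1 p (hR.sD_mem Y)).1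
    rw [dpair_apply, h3]
    simp [coordXi]
  rw [h1, trivFst_apply, famSinhSub_one, ← R.coordZ_add_coordXi, map_add, ← sub_sub,
    map_sub _ _ (famSinhDiv G.adD R.sD 1 p _), sub_apply, h2, sub_zero, famSinhDiv_one]

theorem apply_fderiv_triv_fst (p Y v : StrongDual 𝕜 R.l) (e : StrongDual 𝕜 R.l × R.gStar) :
    Y (fderiv 𝕜 R.triv p v e).1 = dpair 𝕜 V
      (fderiv 𝕜 (famSinhSub G.adD R.sD 1) p v (R.sD e.1)
        - fderiv 𝕜 (famSinhDiv G.adD R.sD 1) p v e.2) (R.sD Y) := by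
  have hd := R.differentiableAt_triv p
  have h1 := differentiable_of_uncurry (contDiff_famSinhSub G.adD R.sD) 1 p
  have h2 := differentiable_of_uncurry (contDiff_famSinhDiv G.adD R.sD) 1 p
  have e1 : fderiv 𝕜 (fun q => Y (R.triv q e).1) p v = Y (fderiv 𝕜 R.triv p v e).1 := by
    refine (fderiv_clm_comp_apply (Y.comp (ContinuousLinearMap.fst 𝕜 R.l (StrongDual 𝕜 V)))
      (hd.clm_apply (differentiableAt_const e)) v).trans ?_
    rw [fderiv_clm_apply_apply hd (differentiableAt_const e)]
    simp
  have e2 := fderiv_clm_comp_apply ((dpair 𝕜 V).flip (R.sD Y))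
    ((h1.clm_apply (differentiableAt_const (R.sD e.1))).sub
      (h2.clm_apply (differentiableAt_const (e.2 : V × StrongDual 𝕜 V)))) v
  rw [← e1, funext fun q => hR.apply_triv_fst q Y e]
  refine e2.trans ?_
  rw [fderiv_sub (h1.clm_apply (differentiableAt_const _))
    (h2.clm_apply (differentiableAt_const _)), sub_apply, fderiv_clm_apply_apply h1 (differentiableAt_const _),
    fderiv_clm_apply_apply h2 (differentiableAt_const _)]
  simp

/-- The derivative of `gauge_eq` with e held fixed, valid because U is open. It brings in the
derivative of ℓ. -/
theorem fderiv_gauge_eq {p : StrongDual 𝕜 R.l} (hp : p ∈ R.U) (Y : StrongDual 𝕜 R.l)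
    (e : StrongDual 𝕜 R.l × R.gStar) :
    (((fderiv 𝕜 R.triv p Y e).1 : V)
        + (fderiv 𝕜 R.lcan p Y (R.triv p e).2 + R.lcan p (fderiv 𝕜 R.triv p Y e).2),
      (fderiv 𝕜 R.triv p Y e).2)
      = fderiv 𝕜 (famExpDiv G.adD R.sD 1) p Y (R.sD e.1)
        - fderiv 𝕜 (famExp G.adD R.sD 1) p Y e.2 := by
  have hd := (R.differentiableAt_triv p).clm_apply (differentiableAt_const e)
  have hl := (hR.contDiffAt_lcan hp).differentiableAt (by simp)
  have h1 := differentiable_of_uncurry (contDiff_famExpDiv G.adD R.sD) 1 p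
  have h2 := differentiable_of_uncurry (contDiff_famExp G.adD R.sD) 1 p
  have e1 : ∀ v, fderiv 𝕜 (fun q => R.triv q e) p v = fderiv 𝕜 R.triv p v e := fun v => by
    rw [fderiv_clm_apply_apply (R.differentiableAt_triv p) (differentiableAt_const e)]
    simp
  have a1 : HasFDerivAt (fun q => ((R.triv q e).1 : V)) (R.l.subtypeL.comp
      ((ContinuousLinearMap.fst 𝕜 R.l (StrongDual 𝕜 V)).comp (fderiv 𝕜 (fun q => R.triv q e) p)))
      p := R.l.subtypeL.hasFDerivAt.comp p hd.hasFDerivAt.fst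
  have a2 : HasFDerivAt (fun q => (R.triv q e).2) ((ContinuousLinearMap.snd 𝕜 R.l
      (StrongDual 𝕜 V)).comp (fderiv 𝕜 (fun q => R.triv q e) p)) p := hd.hasFDerivAt.snd
  have a3 : HasFDerivAt (fun q => (((R.triv q e).1 : V) + R.lcan q (R.triv q e).2,
      (R.triv q e).2)) _ p :=
    (a1.add (hl.hasFDerivAt.clm_apply a2)).prodMk a2
  have a4 : fderiv 𝕜 (fun q => famExpDiv G.adD R.sD 1 q (R.sD e.1)
      - famExp G.adD R.sD 1 q e.2) p Y
      = fderiv 𝕜 (famExpDiv G.adD R.sD 1) p Y (R.sD e.1)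
        - fderiv 𝕜 (famExp G.adD R.sD 1) p Y e.2 := by
    rw [fderiv_fun_sub (h1.clm_apply (differentiableAt_const _))
      (h2.clm_apply (differentiableAt_const _)), sub_apply,
      fderiv_clm_apply_apply h1 (differentiableAt_const _),
      fderiv_clm_apply_apply h2 (differentiableAt_const _)]
    simp
  rw [← a4, ← fderiv_eq_of_eqOn hR.isOpen_U (fun q hq => hR.gauge_eq hq e) hp, a3.fderiv]
  refine Prod.ext ?_ ?_
  · simp only [ContinuousLinearMap.prod_apply, add_apply, ContinuousLinearMap.comp_apply, e1,
      ContinuousLinearMap.flip_apply, ContinuousLinearMap.coe_fst', ContinuousLinearMap.coe_snd',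
      Submodule.subtypeL_apply]
    abel
  · simp only [ContinuousLinearMap.prod_apply, ContinuousLinearMap.comp_apply, e1,
      ContinuousLinearMap.coe_snd']

theorem apply_anchor (p : StrongDual 𝕜 R.l) (e : StrongDual 𝕜 R.l × R.gStar) (w : R.l) :
    (R.triv p e).2 w - p (R.lieL (R.triv p e).1 w) = e.1 w :=
  congrArg (fun T => T w) (hR.anchorN_triv p e)

/-- The anchor of T_p e does not depend on p, so its derivative vanishes; the term with Y comes from
the explicit p in ad*_z p. -/
theorem fderiv_apply_anchor (p Y : StrongDual 𝕜 R.l) (e : StrongDual 𝕜 R.l × R.gStar) (w : R.l) :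
    (fderiv 𝕜 R.triv p Y e).2 w
      = Y (R.lieL (R.triv p e).1 w) + p (R.lieL (fderiv 𝕜 R.triv p Y e).1 w) := by
  have hd := (R.differentiableAt_triv p).clm_apply (differentiableAt_const e)
  have e1 : fderiv 𝕜 (fun q => R.triv q e) p Y = fderiv 𝕜 R.triv p Y e := by
    rw [fderiv_clm_apply_apply (R.differentiableAt_triv p) (differentiableAt_const e)]
    simp
  let M : R.l →L[𝕜] R.l := LinearMap.toContinuousLinearMap (R.lieL.flip w)
  have a1 : HasFDerivAt (fun q => (R.triv q e).2) ((ContinuousLinearMap.snd 𝕜 R.l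
      (StrongDual 𝕜 V)).comp (fderiv 𝕜 (fun q => R.triv q e) p)) p := hd.hasFDerivAt.snd
  have a2 : HasFDerivAt (fun q => M (R.triv q e).1) (M.comp
      ((ContinuousLinearMap.fst 𝕜 R.l (StrongDual 𝕜 V)).comp (fderiv 𝕜 (fun q => R.triv q e) p)))
      p := M.hasFDerivAt.comp p hd.hasFDerivAt.fst
  have a3 : HasFDerivAt (fun q => (R.triv q e).2 (w : V)) _ p :=
    a1.clm_apply (hasFDerivAt_const (w : V) p)
  have a4 : HasFDerivAt (fun q : StrongDual 𝕜 R.l => q (M (R.triv q e).1)) _ p :=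
    (hasFDerivAt_id p).clm_apply a2
  have a5 : HasFDerivAt (fun _ : StrongDual 𝕜 R.l => e.1 w) _ p :=
    (a3.sub a4).congr_of_eventuallyEq
      (Filter.Eventually.of_forall fun q => (hR.apply_anchor q e w).symm)
  have a6 := congrArg (fun T => T Y) (a5.unique (hasFDerivAt_const (e.1 w) p))
  simp only [sub_apply, add_apply, ContinuousLinearMap.comp_apply, ContinuousLinearMap.flip_apply,
    ContinuousLinearMap.coe_fst', ContinuousLinearMap.coe_snd', e1, zero_apply, map_zero,
    ContinuousLinearMap.id_apply, id_eq, zero_add] at a6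
  rw [sub_eq_zero] at a6
  exact a6.trans (add_comm _ _)

/-- Expresses the derivative-free 𝔩-part of the bracket of N(U), paired with Y, by gauge images.
Pair ∂_Y of the gauge image of e with the gauge image of e': skewness of ℓ and of its derivative
isolates ⟨ξ, dℓ ξ'⟩, and the anchor identity with its derivative accounts for the 𝔩-terms. -/
theorem pairing_fderiv {p : StrongDual 𝕜 R.l} (hp : p ∈ R.U) (Y : StrongDual 𝕜 R.l)
    (e e' : StrongDual 𝕜 R.l × R.gStar) :
    (R.triv p e).2 (fderiv 𝕜 R.lcan p Y (R.triv p e').2)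
        - Y (R.lieL (R.triv p e).1 (R.triv p e').1)
      = dpair 𝕜 V (fderiv 𝕜 (famSinhSub G.adD R.sD 1) p Y (R.sD e.1)
          - fderiv 𝕜 (famSinhDiv G.adD R.sD 1) p Y e.2) (R.sD e'.1)
        - dpair 𝕜 V (fderiv 𝕜 (famExpDiv G.adD R.sD 1) p Y (R.sD e.1)
          - fderiv 𝕜 (famExp G.adD R.sD 1) p Y e.2)
          (famExpDiv G.adD R.sD 1 p (R.sD e'.1) - famExp G.adD R.sD 1 p e'.2) := by
  rw [← hR.apply_fderiv_triv_fst, ← hR.gauge_eq hp, ← hR.fderiv_gauge_eq hp]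
  have h1 := hR.apply_anchor p e' (fderiv 𝕜 R.triv p Y e).1
  have h2 := hR.fderiv_apply_anchor p Y e (R.triv p e').1
  have h3 := hR.lcan_skew hp (fderiv 𝕜 R.triv p Y e).2 (R.triv p e').2
  have h4 := hR.fderiv_lcan_skew hp Y (R.triv p e).2 (R.triv p e').2
  have h5 : R.lieL (R.triv p e').1 (fderiv 𝕜 R.triv p Y e).1
      = -R.lieL (fderiv 𝕜 R.triv p Y e).1 (R.triv p e').1 := Subtype.ext (G.lie_skew _ _)
  rw [h5, map_neg] at h1
  simp only [dpair_apply, map_add]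
  linear_combination h1 + h2 + h3 + h4

end

/-- Tested against Y in 𝔩*. Derivatives of the sections match by the product rule; the rest is
exactly `dorfman_identity` combined with `pairing_fderiv`. -/
theorem triv_bracket_fst [CompleteSpace V] {p : StrongDual 𝕜 R.l} (hp : p ∈ R.U)
    {σ τ : StrongDual 𝕜 R.l → StrongDual 𝕜 R.l × R.gStar} (hσ : DifferentiableAt 𝕜 σ p)
    (hτ : DifferentiableAt 𝕜 τ p) :
    (R.triv p ((trivialAlgebroid 𝕜 (R.gStarLie hR)).bracket σ τ p)).1
      = ((R.algebroidN R.lcan).bracket (fun q => R.triv q (σ q))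
          (fun q => R.triv q (τ q)) p).1 := by
  have hd := R.differentiableAt_triv p
  have hbr : (trivialAlgebroid 𝕜 (R.gStarLie hR)).bracket σ τ p
      = fderiv 𝕜 τ p (σ p).1 - fderiv 𝕜 σ p (τ p).1 + (0, R.gStarLie hR (σ p).2 (τ p).2) := by
    simp only [trivialAlgebroid, VectorField.lieBracket]
    refine Prod.ext ?_ ?_
    · exact (congrArg₂ (· - ·)
        (fderiv_clm_comp_apply (ContinuousLinearMap.fst 𝕜 (StrongDual 𝕜 R.l) R.gStar) hτ _)
        (fderiv_clm_comp_apply (ContinuousLinearMap.fst 𝕜 (StrongDual 𝕜 R.l) R.gStar) hσ _)).trans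
        (by simp)
    · exact congrArg (· + R.gStarLie hR (σ p).2 (τ p).2) (congrArg₂ (· - ·)
        (fderiv_clm_comp_apply (ContinuousLinearMap.snd 𝕜 (StrongDual 𝕜 R.l) R.gStar) hτ _)
        (fderiv_clm_comp_apply (ContinuousLinearMap.snd 𝕜 (StrongDual 𝕜 R.l) R.gStar) hσ _))
  have hf : ∀ {f : StrongDual 𝕜 R.l → StrongDual 𝕜 R.l × R.gStar}, DifferentiableAt 𝕜 f p →
      ∀ v, fderiv 𝕜 (fun q => (R.triv q (f q)).1) p v
        = (fderiv 𝕜 R.triv p v (f p)).1 + (R.triv p (fderiv 𝕜 f p v)).1 := fun h v => by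
    have := fderiv_clm_comp_apply (ContinuousLinearMap.fst 𝕜 R.l (StrongDual 𝕜 V))
      (hd.clm_apply h) v
    rw [fderiv_clm_apply_apply hd h] at this
    exact this
  refine eq_of_forall_strongDual (𝕜 := 𝕜) fun Y => ?_
  have hL := hR.pairing_fderiv hp Y (σ p) (τ p)
  have hD := hR.isSymmetricPair.dorfman_identity p (σ p).1 (τ p).1 Y (σ p).2.2 (τ p).2.2
  have h0 := hR.apply_triv_fst p Y (0, R.gStarLie hR (σ p).2 (τ p).2)
  have h1 := hR.apply_fderiv_triv_fst p Y (σ p).1 (τ p)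
  have h2 := hR.apply_fderiv_triv_fst p Y (τ p).1 (σ p)
  have h3 : Y (R.derivPair R.lcan p (R.triv p (σ p)).2 (R.triv p (τ p)).2)
      = (R.triv p (σ p)).2 (fderiv 𝕜 R.lcan p Y (R.triv p (τ p)).2) := apply_ofBidual _ _
  have h4 : G.adD (σ p).2 (τ p).2 = (R.gStarLie hR (σ p).2 (τ p).2 : V × StrongDual 𝕜 V) := rfl
  simp only [map_zero, zero_sub, map_neg, neg_apply] at h0
  rw [hbr]
  simp only [algebroidN, hR.anchorN_triv, hf hσ, hf hτ, map_add, map_sub, Prod.fst_add,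
    Prod.fst_sub, h0, h1, h2, h3]
  rw [h4] at hD
  simp only [map_sub, sub_apply] at hD hL ⊢
  linear_combination -hD - hL

/-- The 𝔤*-component of `gauge_bracket`, read through `gauge_eq`. The bracket of 𝔡 enters with a
minus sign, and its arguments have 𝔤-parts z + ℓ_p ξ; this accounts for the ad* terms in the bracket
of N(U). -/
theorem triv_bracket_snd [CompleteSpace V] {p : StrongDual 𝕜 R.l} {W : Set (StrongDual 𝕜 R.l)}
    (hWU : W ⊆ R.U) (hW : IsOpen W) (hp : p ∈ W)
    {σ τ : StrongDual 𝕜 R.l → StrongDual 𝕜 R.l × R.gStar} (hσ : DifferentiableAt 𝕜 σ p)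
    (hτ : DifferentiableAt 𝕜 τ p) :
    (R.triv p ((trivialAlgebroid 𝕜 (R.gStarLie hR)).bracket σ τ p)).2
      = ((R.algebroidN R.lcan).bracket (fun q => R.triv q (σ q))
          (fun q => R.triv q (τ q)) p).2 := by
  have hx : ∀ {f : StrongDual 𝕜 R.l → StrongDual 𝕜 R.l × R.gStar}, DifferentiableAt 𝕜 f p →
      DifferentiableAt 𝕜 (fun q => ((f q).2 : V × StrongDual 𝕜 V)) p ∧
      ∀ v, fderiv 𝕜 (fun q => ((f q).2 : V × StrongDual 𝕜 V)) p v
        = (fderiv 𝕜 (fun q => (f q).2) p v : R.gStar) := fun h =>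
    ⟨R.gStar.subtypeL.differentiableAt.comp p h.snd,
      fderiv_clm_comp_apply R.gStar.subtypeL h.snd⟩
  -- The gauge image has the 𝔤*-component of T_p as its own, but only over U; openness of `W` lets
  -- the two be differentiated as one.
  have hF : ∀ {f : StrongDual 𝕜 R.l → StrongDual 𝕜 R.l × R.gStar}, DifferentiableAt 𝕜 f p →
      ∀ v, (fderiv 𝕜 (fun q => famExpDiv G.adD R.sD 1 q (R.sD (f q).1)
          - famExp G.adD R.sD 1 q (f q).2) p v).2
        = fderiv 𝕜 (fun q => (R.triv q (f q)).2) p v := fun {f} h v => by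
    have h1 := (differentiable_of_uncurry (contDiff_famExpDiv G.adD R.sD) 1 p).clm_apply
      (R.sD.differentiableAt.comp p h.fst)
    have h2 := (differentiable_of_uncurry (contDiff_famExp G.adD R.sD) 1 p).clm_apply (hx h).1
    have h3 := fderiv_clm_comp_apply (ContinuousLinearMap.snd 𝕜 V (StrongDual 𝕜 V)) (h1.sub h2) v
    refine h3.symm.trans ?_
    have h4 := fderiv_eq_of_eqOn (𝕜 := 𝕜) hW
      (g := fun q => (famExpDiv G.adD R.sD 1 q (R.sD (f q).1) - famExp G.adD R.sD 1 q (f q).2).2)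
      (fun q hq => congrArg Prod.snd (hR.gauge_eq (hWU hq) (f q))) hp
    exact (DFunLike.congr_fun h4 v).symm
  have hg := gauge_bracket (κ := R.sD) G.adD_jacobi G.dlie_skew hσ.fst hτ.fst (hx hσ).1 (hx hτ).1
  have h1 := hR.gauge_eq (hWU hp) ((trivialAlgebroid 𝕜 (R.gStarLie hR)).bracket σ τ p)
  have h2 : (((trivialAlgebroid 𝕜 (R.gStarLie hR)).bracket σ τ p).2 : V × StrongDual 𝕜 V)
      = fderiv 𝕜 (fun q => ((τ q).2 : V × StrongDual 𝕜 V)) p (σ p).1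
        - fderiv 𝕜 (fun q => ((σ q).2 : V × StrongDual 𝕜 V)) p (τ p).1
        + G.adD (σ p).2 (τ p).2 := by
    rw [(hx hσ).2, (hx hτ).2]; rfl
  have h3 : ((trivialAlgebroid 𝕜 (R.gStarLie hR)).bracket σ τ p).1
      = fderiv 𝕜 (fun q => (τ q).1) p (σ p).1 - fderiv 𝕜 (fun q => (σ q).1) p (τ p).1 := rfl
  rw [h2, h3, ← hg, ← hR.gauge_eq (hWU hp), ← hR.gauge_eq (hWU hp)] at h1
  have h4 := congrArg Prod.snd h1
  simp only [Prod.snd_sub, hF hσ, hF hτ] at h4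
  rw [h4]
  have h5 : ∀ ξ η : StrongDual 𝕜 V, G.cocyclePair ξ η = -G.cocyclePair η ξ := fun ξ η => by
    ext x; exact G.cocycle_skew x ξ η
  have h6 : ∀ x y ξ, G.adStar (x + y) ξ = G.adStar x ξ + G.adStar y ξ := fun x y ξ => by
    ext v; simp
  simp only [algebroidN, hR.anchorN_triv, LieQuasiBialgebra.adD_apply,
    QuasiBialgebraData.dad_apply, QuasiBialgebraData.dlie, h6,
    h5 (R.triv p (τ p)).2 (R.triv p (σ p)).2]
  abel

theorem isLieAlgebroidIso :
    IsLieAlgebroidIso R.U (trivialAlgebroid 𝕜 (B := StrongDual 𝕜 R.l) (R.gStarLie hR))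
      (R.algebroidN R.lcan) R.triv := by
  have : CompleteSpace V := FiniteDimensional.complete 𝕜 V
  exact
  { smooth := R.contDiff_triv.contDiffOn
    exists_inverse := hR.exists_inverse_triv
    anchor_comp := fun p _ e => hR.anchorN_triv p e
    map_bracket := fun W hWU hW σ τ hσ hτ p hp =>
      have dσ := hσ.differentiableAt_of_isOpen hW hp
      have dτ := hτ.differentiableAt_of_isOpen hW hp
      Prod.ext (hR.triv_bracket_fst (hWU hp) dσ dτ) (hR.triv_bracket_snd hWU hW hp dσ dτ) }

end CanonicallyCompatible

end ReductiveDecomposition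

theorem mainTheorem4 {𝕜 V : Type*} [RCLike 𝕜] [NormedAddCommGroup V] [NormedSpace 𝕜 V]
    [FiniteDimensional 𝕜 V] (G : LieQuasiBialgebra 𝕜 V)
    (R : ReductiveDecomposition G.toQuasiBialgebraData) (hR : R.CanonicallyCompatible) :
    (∀ p ∈ R.U, ∀ e : StrongDual 𝕜 R.l × R.gStar,
      R.trivFst p e = ((((R.triv p e).1 : R.l) : V), 0) ∧
      R.trivSnd p e = (0, (R.triv p e).2)) ∧
    IsLieAlgebroid R.U
      (trivialAlgebroid 𝕜 (B := StrongDual 𝕜 R.l) (R.gStarLie hR)) ∧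
    IsLieAlgebroid R.U (R.algebroidN R.lcan) ∧
    IsLieAlgebroidIso R.U (trivialAlgebroid 𝕜 (B := StrongDual 𝕜 R.l) (R.gStarLie hR))
      (R.algebroidN R.lcan) R.triv := by
  have : CompleteSpace V := FiniteDimensional.complete 𝕜 V
  exact ⟨fun p _ e => ⟨hR.trivFst_eq p e, hR.trivSnd_eq p e⟩, hR.isLieAlgebroid_trivial,
    -- The laws of N(U) are inherited from the trivial algebroid along T.
    hR.isLieAlgebroid_trivial.of_iso hR.isLieAlgebroidIso
      fun W _ hW _ _ _ _ hσ hτ => R.algebroidN_bracket_eqOn R.lcan hW hσ hτ,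
    hR.isLieAlgebroidIso⟩

end
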